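/- Let $p\ge 1$ and $n\ge p+1$ be integers, and let $X\in\mathbb{R}^{n\times p}$ be a random matrix whose entries are independent with $X_{ai}\sim N(M_{ai},1)$, where $M\in\mathbb{R}^{n\times p}$; write $\mathrm{E}_M$ for expectation under this law. Let $X=U\Sigma V^{\top}$ be a singular value decomposition, where $U\in\mathbb{R}^{n\times p}$, $V\in\mathbb{R}^{p\times p}$, $U^{\top}U=V^{\top}V=I_p$, $\Sigma=\mathrm{diag}(\sigma_1,\dots,\sigma_p)$ and $\sigma_1\ge\cdots\ge\sigma_p\ge 0$, and let $\lambda_k=\sigma_k^2$ be the eigenvalues of $X^{\top}X=V\,\mathrm{diag}(\lambda_1,\dots,\lambda_p)\,V^{\top}$. Stein's estimator is $$\hat M=U\,\mathrm{diag}\Bigl(\sigma_1-\frac{c_1}{\sigma_1},\dots,\sigma_p-\frac{c_p}{\sigma_p}\Bigr)V^{\top},\qquad c_k=n+p-2k-1 .$$ (Almost surely the $\sigma_k$ are positive and distinct, so that $\hat M$ and the matrix $VDV^{\top}$ below do not depend on the choice of the singular value decomposition.) Then, for every $M$, the matrix quadratic risk of $\hat M$ is finite and is given by $$\mathrm{E}_M\bigl[(\hat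 M-M)^{\top}(\hat M-M)\bigr]=nI_p+\mathrm{E}_M[VDV^{\top}],$$ where the last expectation exists and $D$ is the $p\times p$ diagonal matrix with $$D_{kk}=-\frac{1}{\lambda_k}(n+p-2k-1)(n-3p+2k-1)+4\sum_{l\neq k}\frac{k-l}{\lambda_k-\lambda_l}.$$ Consequently, when $n\ge 3p-1$, Stein's estimator dominates the maximum likelihood estimator $X$ under the matrix quadratic loss $L(M,\hat M)=(\hat M-M)^{\top}(\hat M-M)$: for every $M\in\mathbb{R}^{n\times p}$, $$\mathrm{E}_M\bigl[(\hat M-M)^{\top}(\hat M-M)\bigr]\preceq \mathrm{E}_M\bigl[(X-M)^{\top}(X-M)\bigr]=nI_p ,$$ where $A\preceq B$ means that $B-A$ is positive semidefinite. -/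

import Mathlib

open MeasureTheory ProbabilityTheory Matrix

/-- A (thin) singular value decomposition `X = U Σ Vᵀ` of an `n × p` real matrix, with
`Uᵀ U = Vᵀ V = I_p` and singular values `σ₁ ≥ ⋯ ≥ σ_p ≥ 0`. -/
structure ThinSVD {n p : ℕ} (X : Matrix (Fin n) (Fin p) ℝ) where
  /-- left singular vectors (columns) -/
  U : Matrix (Fin n) (Fin p) ℝ
  /-- singular values -/
  σ : Fin p → ℝ
  /-- right singular vectors (columns) -/
  V : Matrix (Fin p) (Fin p) ℝ
  U_orth : Uᵀ * U = 1
  V_orth : Vᵀ * V = 1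
  σ_antitone : Antitone σ
  σ_nonneg : ∀ k, 0 ≤ σ k
  eq_mul : X = U * Matrix.diagonal σ * Vᵀ

/-- Every `n × p` real matrix with `p ≤ n` has a thin singular value decomposition. -/
theorem ThinSVD.nonempty {n p : ℕ} (h : p ≤ n) (X : Matrix (Fin n) (Fin p) ℝ) :
    Nonempty (ThinSVD X) := by
  classical
  have hH : (Xᵀ * X).IsHermitian := by
    simpa using Matrix.isHermitian_conjTranspose_mul_self X
  have hT : (Matrix.toEuclideanLin (Xᵀ * X)).IsSymmetric :=
    Matrix.isSymmetric_toEuclideanLin_iff.2 hH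
  have hp : Module.finrank ℝ (EuclideanSpace ℝ (Fin p)) = p := by simp
  set v := hT.eigenvectorBasis hp with hv
  set ev := hT.eigenvalues hp with hev
  let w : Fin p → EuclideanSpace ℝ (Fin n) := fun k => Matrix.toEuclideanLin X (v k)
  have hvv : ∀ k l, ∑ i, v k i * v l i = if k = l then 1 else 0 := by
    intro k l
    have := orthonormal_iff_ite.1 v.orthonormal k l
    rw [← this]
    simp [PiLp.inner_apply, mul_comm]
  have hww : ∀ k l, inner ℝ (w k) (w l) = if k = l then ev l else 0 := by
    intro k l
    have h1 : inner ℝ (w k) (w l)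
        = inner ℝ (v k) (Matrix.toEuclideanLin (Xᵀ * X) (v l)) := by
      simp only [w, EuclideanSpace.inner_eq_star_dotProduct, Matrix.toLpLin_apply, star_trivial]
      rw [← Matrix.mulVec_mulVec, dotProduct_comm, Matrix.dotProduct_mulVec,
        dotProduct_comm _ (v k).ofLp, Matrix.dotProduct_mulVec (v k).ofLp, Matrix.vecMul_transpose,
        ← Matrix.dotProduct_mulVec]
    rw [h1, hT.apply_eigenvectorBasis hp l, inner_smul_right,
      orthonormal_iff_ite.1 v.orthonormal k l]
    split_ifs <;> simp [hev]
  have hnorm : ∀ k, ‖w k‖ ^ 2 = ev k := by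
    intro k
    rw [← real_inner_self_eq_norm_sq, hww]; simp
  let f : Fin n → EuclideanSpace ℝ (Fin n) := fun a => if h : a.1 < p then w ⟨a, h⟩ else 0
  have hf : Pairwise fun i j => inner ℝ (f i) (f j) = 0 := by
    intro i j hij
    simp only [f]
    split_ifs with h1 h2
    · rw [hww, if_neg]
      intro h; exact hij (Fin.ext (by simpa using h))
    all_goals simp
  have hn : Module.finrank ℝ (EuclideanSpace ℝ (Fin n)) = Fintype.card (Fin n) := by simp
  let b := InnerProductSpace.gramSchmidtOrthonormalBasis hn f
  let u : Fin p → EuclideanSpace ℝ (Fin n) := fun k => b (Fin.castLE h k)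
  have huu : ∀ k l, ∑ a, u k a * u l a = if k = l then 1 else 0 := by
    intro k l
    have := orthonormal_iff_ite.1 b.orthonormal (Fin.castLE h k) (Fin.castLE h l)
    simp only [Fin.castLE_inj] at this
    rw [← this]
    simp [u, PiLp.inner_apply, mul_comm]
  have hw : ∀ k, w k = ‖w k‖ • u k := by
    intro k
    have hfk : f (Fin.castLE h k) = w k := by simp [f]
    by_cases h0 : w k = 0
    · simp [h0]
    · have := InnerProductSpace.gramSchmidtOrthonormalBasis_apply_of_orthogonal hn hf
        (i := Fin.castLE h k) (by rwa [hfk])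
      simp only [u, b]
      rw [this, hfk, smul_smul]
      have : ‖w k‖ ≠ 0 := by simpa using h0
      simp [this]
  have hVo : (Matrix.of fun i k => v k i : Matrix (Fin p) (Fin p) ℝ)ᵀ
      * (Matrix.of fun i k => v k i) = 1 := by
    ext k l
    simp [Matrix.mul_apply, Matrix.one_apply, hvv]
  refine ⟨⟨Matrix.of fun a k => u k a, fun k => ‖w k‖, Matrix.of fun i k => v k i, ?_, hVo,
    ?_, fun k => norm_nonneg _, ?_⟩⟩
  · ext k l
    simp [Matrix.mul_apply, Matrix.one_apply, huu]
  · intro k l hkl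
    have h2 : ev l ≤ ev k := hT.eigenvalues_antitone hp hkl
    rw [← hnorm, ← hnorm] at h2
    exact (sq_le_sq₀ (norm_nonneg _) (norm_nonneg _)).1 h2
  · have hXV : X * (Matrix.of fun i k => v k i : Matrix (Fin p) (Fin p) ℝ)
        = (Matrix.of fun a k => u k a) * Matrix.diagonal fun k => ‖w k‖ := by
      ext a k
      have := congrArg (fun z : EuclideanSpace ℝ (Fin n) => z a) (hw k)
      rw [Matrix.mul_diagonal]
      have h2 : (w k) a = (X * (Matrix.of fun i k => v k i : Matrix (Fin p) (Fin p) ℝ)) a k := by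
        simp [w, Matrix.toLpLin_apply, Matrix.mul_apply, Matrix.mulVec, dotProduct]
      rw [← h2, this]
      simp [mul_comm]
    rw [← hXV, Matrix.mul_assoc, mul_eq_one_comm.1 hVo, Matrix.mul_one]

/-- Real matrices carry the product σ-algebra. -/
instance instMeasurableSpaceRealMatrix {n p : ℕ} :
    MeasurableSpace (Matrix (Fin n) (Fin p) ℝ) :=
  inferInstanceAs (MeasurableSpace (Fin n → Fin p → ℝ))

/-- The law of an `n × p` random matrix `X` whose entries are independent normal random variables
`X_{ai} ∼ N(M_{ai}, 1)`. -/
noncomputable def normalMatrixLaw {n p : ℕ} (M : Matrix (Fin n) (Fin p) ℝ) :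
    Measure (Matrix (Fin n) (Fin p) ℝ) :=
  Measure.pi fun a => Measure.pi fun i => gaussianReal (M a i) 1

/-- Entrywise integrability of a matrix-valued function. -/
def MatrixIntegrable {Ω : Type*} [MeasurableSpace Ω] {p : ℕ}
    (F : Ω → Matrix (Fin p) (Fin p) ℝ) (μ : Measure Ω) : Prop :=
  ∀ i j, Integrable (fun ω => F ω i j) μ

/-- Entrywise expectation of a matrix-valued function. -/
noncomputable def matrixExpectation {Ω : Type*} [MeasurableSpace Ω] {p : ℕ}
    (F : Ω → Matrix (Fin p) (Fin p) ℝ) (μ : Measure Ω) : Matrix (Fin p) (Fin p) ℝ :=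
  Matrix.of fun i j => ∫ ω, F ω i j ∂μ

/-- The matrix quadratic loss `L(M, M̂) = (M̂ - M)ᵀ (M̂ - M)`. -/
def matrixQuadraticLoss {n p : ℕ} (M Mhat : Matrix (Fin n) (Fin p) ℝ) :
    Matrix (Fin p) (Fin p) ℝ :=
  (Mhat - M)ᵀ * (Mhat - M)

/-- The matrix quadratic risk at `M` exists (the loss has finite expectation). -/
def HasMatrixQuadraticRisk {n p : ℕ} (M : Matrix (Fin n) (Fin p) ℝ)
    (est : Matrix (Fin n) (Fin p) ℝ → Matrix (Fin n) (Fin p) ℝ) : Prop :=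
  MatrixIntegrable (fun X => matrixQuadraticLoss M (est X)) (normalMatrixLaw M)

/-- The matrix quadratic risk `R(M, M̂) = E_M [L(M, M̂(X))]`. -/
noncomputable def matrixQuadraticRisk {n p : ℕ} (M : Matrix (Fin n) (Fin p) ℝ)
    (est : Matrix (Fin n) (Fin p) ℝ → Matrix (Fin n) (Fin p) ℝ) : Matrix (Fin p) (Fin p) ℝ :=
  matrixExpectation (fun X => matrixQuadraticLoss M (est X)) (normalMatrixLaw M)

/-- `est₁` dominates `est₂` under the matrix quadratic loss: for every mean matrix `M` both risks
exist and `R(M, est₁) ⪯ R(M, est₂)` in the Löwner order, i.e. the difference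
`R(M, est₂) - R(M, est₁)` is positive semidefinite. -/
def Dominates {n p : ℕ}
    (est₁ est₂ : Matrix (Fin n) (Fin p) ℝ → Matrix (Fin n) (Fin p) ℝ) : Prop :=
  ∀ M, HasMatrixQuadraticRisk M est₁ ∧ HasMatrixQuadraticRisk M est₂ ∧
    (matrixQuadraticRisk M est₂ - matrixQuadraticRisk M est₁).PosSemidef

/-- The maximum likelihood estimator `M̂ = X`. -/
def mle {n p : ℕ} : Matrix (Fin n) (Fin p) ℝ → Matrix (Fin n) (Fin p) ℝ := fun X => X

/-- The singular value shrinkage estimator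
`M̂ = U diag(σ₁ - c₁/σ₁, …, σ_p - c_p/σ_p) Vᵀ`, for a choice `svd` of a singular value decomposition
of every matrix. -/
noncomputable def shrinkageEstimator {n p : ℕ} (c : Fin p → ℝ)
    (svd : ∀ X : Matrix (Fin n) (Fin p) ℝ, ThinSVD X) :
    Matrix (Fin n) (Fin p) ℝ → Matrix (Fin n) (Fin p) ℝ := fun X =>
  (svd X).U * Matrix.diagonal (fun k => (svd X).σ k - c k / (svd X).σ k) * ((svd X).V)ᵀ

/-- Stein's coefficients `c_k = n + p - 2k - 1`, where `k = 1, …, p` is `k.val + 1`. -/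
def steinCoeff (n p : ℕ) (k : Fin p) : ℝ :=
  (n : ℝ) + (p : ℝ) - 2 * ((k.val : ℝ) + 1) - 1

/-- Stein's estimator. -/
noncomputable def steinEstimator {n p : ℕ} (svd : ∀ X : Matrix (Fin n) (Fin p) ℝ, ThinSVD X) :
    Matrix (Fin n) (Fin p) ℝ → Matrix (Fin n) (Fin p) ℝ :=
  shrinkageEstimator (steinCoeff n p) svd

/-- The diagonal entries, as functions of `lam = (λ₁, …, λ_p)`,
`D_kk = -(1/λ_k) (n + p - 2k - 1) (n - 3p + 2k - 1) + 4 ∑_{l ≠ k} (k - l) / (λ_k - λ_l)`,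
where the index `k = 1, …, p` is `k.val + 1`. -/
noncomputable def steinD (n p : ℕ) (lam : Fin p → ℝ) (k : Fin p) : ℝ :=
  -(1 / lam k) * ((n : ℝ) + (p : ℝ) - 2 * ((k.val : ℝ) + 1) - 1)
      * ((n : ℝ) - 3 * (p : ℝ) + 2 * ((k.val : ℝ) + 1) - 1)
    + 4 * ∑ l ∈ Finset.univ.erase k,
        (((k.val : ℝ) + 1) - ((l.val : ℝ) + 1)) / (lam k - lam l)

/-- The matrix `V D Vᵀ` attached to a singular value decomposition of `X`; the eigenvalues of
`Xᵀ X = V Λ Vᵀ` are `λ_k = σ_k²`. -/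
noncomputable def steinVDVt {n p : ℕ} {X : Matrix (Fin n) (Fin p) ℝ} (S : ThinSVD X) :
    Matrix (Fin p) (Fin p) ℝ :=
  S.V * Matrix.diagonal (steinD n p fun k => S.σ k ^ 2) * S.Vᵀ

/-! Write S = XᵀX and M̂ = X - XΦ with Φ = V diag(c_k/λ_k) Vᵀ. The loss expands into (X-M)ᵀ(X-M),
minus (X-M)ᵀXΦ and its transpose, plus ΦSΦ. Gaussian integration by parts should turn E[(X-M)ᵀXΦ]
into the expectation of the matrix divergence of XΦ, which is V diag(`steinDiv`) Vᵀ, and D is λ_k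
(c_k/λ_k)² minus twice that spectrum. The difficulty is analytic: XΦ is singular where an eigenvalue
vanishes or two of them coincide.

Eigenvalues and eigenvectors are never differentiated. Since c_k = n - 2 + ∑ₗ sign(λ_k - λ_l), the
field is a limit of fields with spectrum f(λ_k)(n - 2 + ∑ₗ s(λ_k - λ_l)), where f and s are
polynomials and s is odd. These are linear combinations of tr(S^b) X S^q, hence polynomial in the
entries of X and independent of the chosen decomposition, and their divergence follows from the
product rule (`IsSpectralField.monomial`, `IsSpectralField.pair`). The factor (1 - tr S/R)₊² gives
compact support, so Stein's identity applies at the price of a boundary term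
(`IsSpectralField.integral_eq`).

Two limits follow, and in each the positivity of a divergence supplies the domination. In the first,
s runs through odd polynomials tending to the sign on (-R, R), with f fixed. For f = 1 the trace of
the divergence is nonnegative and Stein's identity bounds its integral. Fatou's lemma then shows
that the eigenvalues are almost surely distinct (otherwise s'(0) → ∞ would make the divergence
explode) and that the limit `coeffDiv n 1` is integrable. This limit controls λ_l/|λ_l - λ_k|, so
dominated convergence works for every polynomial f (`integrable_coeffDiv_and_integral_eq`).

In the second limit f runs through polynomials r_j tending to 1/x, and R = j + 1. The total
divergence is again nonnegative and dominates c_k r_j(λ_k), which in turn dominates ΦSΦ up to a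
constant. Young's inequality in Stein's identity therefore bounds the integral of the divergence by
a constant plus half of itself. Fatou's lemma makes ∑ₖ `steinDiv` integrable, and this sum dominates
every term in the passage to the limit (`integrable_steinDiv_and_integral_eq`).

For n ≥ 3p - 1 every D_kk is nonpositive, because the factors multiplying -1/λ_k are nonnegative and
k - l and λ_k - λ_l never have the same sign. -/

/-! ### Gaussian density, integration by parts and second moments -/

/-- A product of measures with integrable densities has the product density. -/
theorem pi_withDensity_ofReal {ι : Type*} [Fintype ι] {α : ι → Type*}
    [∀ i, MeasurableSpace (α i)] (μ : ∀ i, Measure (α i)) [∀ i, SigmaFinite (μ i)]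
    (g : ∀ i, α i → ℝ) (hg0 : ∀ i x, 0 ≤ g i x) (hgi : ∀ i, Integrable (g i) (μ i)) :
    Measure.pi (fun i => (μ i).withDensity fun x => ENNReal.ofReal (g i x))
      = (Measure.pi μ).withDensity fun x => ENNReal.ofReal (∏ i, g i (x i)) := by
  classical
  have hfin : ∀ i, IsFiniteMeasure ((μ i).withDensity fun x => ENNReal.ofReal (g i x)) :=
    fun i => isFiniteMeasure_withDensity_ofReal (hgi i).2
  refine Measure.pi_eq fun s hs => ?_
  have hind : ∀ x : ∀ i, α i, (Set.univ.pi s).indicator (fun x => ∏ i, g i (x i)) x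
      = ∏ i, (s i).indicator (g i) (x i) := by
    intro x
    by_cases hx : x ∈ Set.univ.pi s
    · rw [Set.indicator_of_mem hx]
      exact Finset.prod_congr rfl fun i _ => (Set.indicator_of_mem (hx i trivial) _).symm
    · rw [Set.indicator_of_notMem hx]
      simp only [Set.mem_pi, Set.mem_univ, true_implies, not_forall] at hx
      obtain ⟨i, hi⟩ := hx
      exact (Finset.prod_eq_zero (Finset.mem_univ i) (Set.indicator_of_notMem hi _)).symm
  rw [withDensity_apply _ (MeasurableSet.univ_pi hs),
    ← ofReal_integral_eq_lintegral_ofReal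
      (Integrable.fintype_prod_dep hgi).integrableOn
      (Filter.Eventually.of_forall fun x => Finset.prod_nonneg fun i _ => hg0 i _),
    ← integral_indicator (MeasurableSet.univ_pi hs)]
  simp_rw [hind]
  rw [integral_fintype_prod_eq_prod (fun i => (s i).indicator (g i)),
    ENNReal.ofReal_prod_of_nonneg
      fun i _ => integral_nonneg fun x => Set.indicator_nonneg (fun x _ => hg0 i x) x]
  refine Finset.prod_congr rfl fun i _ => ?_
  rw [withDensity_apply _ (hs i), integral_indicator (hs i),
    ← ofReal_integral_eq_lintegral_ofReal (hgi i).integrableOn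
      (Filter.Eventually.of_forall (hg0 i))]

/-- The Lebesgue density of `normalMatrixLaw`. -/
noncomputable def normalMatrixDensity {n p : ℕ} (M : Matrix (Fin n) (Fin p) ℝ)
    (X : Fin n → Fin p → ℝ) : ℝ :=
  ∏ a, ∏ i, gaussianPDFReal (M a i) 1 (X a i)

theorem normalMatrixDensity_nonneg {n p : ℕ} (M : Matrix (Fin n) (Fin p) ℝ)
    (X : Fin n → Fin p → ℝ) : 0 ≤ normalMatrixDensity M X :=
  Finset.prod_nonneg fun _ _ => Finset.prod_nonneg fun _ _ => gaussianPDFReal_nonneg _ _ _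

theorem normalMatrixLaw_eq_withDensity {n p : ℕ} (M : Matrix (Fin n) (Fin p) ℝ) :
    normalMatrixLaw M = (volume : Measure (Fin n → Fin p → ℝ)).withDensity
      fun X => ENNReal.ofReal (normalMatrixDensity M X) := by
  have h1 : ∀ a, Measure.pi (fun i => gaussianReal (M a i) 1)
      = (volume : Measure (Fin p → ℝ)).withDensity
        fun x => ENNReal.ofReal (∏ i, gaussianPDFReal (M a i) 1 (x i)) := by
    intro a
    simp_rw [gaussianReal_of_var_ne_zero _ one_ne_zero]
    exact pi_withDensity_ofReal (fun _ => volume) (fun i => gaussianPDFReal (M a i) 1)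
      (fun _ _ => gaussianPDFReal_nonneg _ _ _) fun _ => integrable_gaussianPDFReal _ _
  unfold normalMatrixLaw
  simp_rw [h1]
  exact pi_withDensity_ofReal (fun _ => volume)
    (fun a (x : Fin p → ℝ) => ∏ i, gaussianPDFReal (M a i) 1 (x i))
    (fun _ _ => Finset.prod_nonneg fun _ _ => gaussianPDFReal_nonneg _ _ _)
    fun a => Integrable.fintype_prod_dep fun i => integrable_gaussianPDFReal _ _

instance instBorelSpaceRealMatrix {n p : ℕ} : BorelSpace (Matrix (Fin n) (Fin p) ℝ) :=
  inferInstanceAs (BorelSpace (Fin n → Fin p → ℝ))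

instance instIsProbabilityMeasureNormalMatrixLaw {n p : ℕ} (M : Matrix (Fin n) (Fin p) ℝ) :
    IsProbabilityMeasure (normalMatrixLaw M) := by
  have : ∀ a, IsProbabilityMeasure (Measure.pi fun i => gaussianReal (M a i) 1) := fun a =>
    inferInstance
  exact Measure.pi.instIsProbabilityMeasure fun a => Measure.pi fun i => gaussianReal (M a i) 1

theorem continuous_normalMatrixDensity {n p : ℕ} (M : Matrix (Fin n) (Fin p) ℝ) :
    Continuous (normalMatrixDensity M) := by
  unfold normalMatrixDensity
  simp only [gaussianPDFReal_def]
  fun_prop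

theorem hasLineDerivAt_normalMatrixDensity {n p : ℕ} (M : Matrix (Fin n) (Fin p) ℝ)
    (X : Fin n → Fin p → ℝ) (a : Fin n) (i : Fin p) (e : Fin n → Fin p → ℝ)
    (he : ∀ b j, e b j = if a = b ∧ i = j then 1 else 0) :
    HasLineDerivAt ℝ (normalMatrixDensity M) (-(X a i - M a i) * normalMatrixDensity M X) X e := by
  have hexp : ∀ Y : Fin n → Fin p → ℝ, normalMatrixDensity M Y
      = (∏ _b : Fin n, ∏ _j : Fin p, (√(2 * Real.pi))⁻¹)
        * Real.exp (∑ b, ∑ j, -(Y b j - M b j) ^ 2 / 2) := by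
    intro Y
    simp only [normalMatrixDensity, gaussianPDFReal, Finset.prod_mul_distrib, Real.exp_sum,
      NNReal.coe_one, mul_one]
  unfold HasLineDerivAt
  simp_rw [hexp]
  have hin : HasDerivAt (fun t : ℝ => ∑ b, ∑ j, -((X + t • e) b j - M b j) ^ 2 / 2)
      (-(X a i - M a i)) 0 := by
    have : HasDerivAt (fun t : ℝ => ∑ b, ∑ j, -((X + t • e) b j - M b j) ^ 2 / 2)
      (∑ b, ∑ j, -(X b j - M b j) * e b j) 0 := by
      refine HasDerivAt.fun_sum fun b _ => HasDerivAt.fun_sum fun j _ => ?_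
      have h1 : HasDerivAt (fun t : ℝ => X b j + t * e b j - M b j) (e b j) 0 := by
        simpa using (((hasDerivAt_id (0 : ℝ)).mul_const (e b j)).const_add (X b j)).sub_const
          (M b j)
      have h2 := ((h1.pow 2).neg).div_const 2
      exact h2.congr_deriv (by simp; ring)
    convert this using 1
    rw [Finset.sum_eq_single a, Finset.sum_eq_single i]
    · simp [he]
    · intro j _ hj
      simp [he, hj.symm]
    · simp
    · intro b _ hb
      simp [he, hb.symm]
    · simp
  have := (hin.exp).const_mul (∏ _b : Fin n, ∏ _j : Fin p, (√(2 * Real.pi))⁻¹)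
  exact this.congr_deriv (by simp only [zero_smul, add_zero]; ring)

/-- Stein's identity for functions with compact support. -/
theorem normalMatrixLaw_stein {n p : ℕ} (M : Matrix (Fin n) (Fin p) ℝ) (a : Fin n) (i : Fin p)
    {h h' : Matrix (Fin n) (Fin p) ℝ → ℝ} (hc : Continuous h) (hc' : Continuous h')
    (hs : HasCompactSupport h) (hs' : HasCompactSupport h')
    (hd : ∀ X, HasDerivAt (fun t : ℝ => h (X + t • Matrix.single a i (1 : ℝ))) (h' X) 0) :
    ∫ X, (X a i - M a i) * h X ∂(normalMatrixLaw M) = ∫ X, h' X ∂(normalMatrixLaw M) := by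
  have hD : ∀ k : (Fin n → Fin p → ℝ) → ℝ, ∫ X, k X ∂(normalMatrixLaw M)
      = ∫ X : Fin n → Fin p → ℝ, normalMatrixDensity M X * k X := by
    intro k
    rw [normalMatrixLaw_eq_withDensity]
    have := integral_withDensity_eq_integral_toReal_smul
      (μ := (volume : Measure (Fin n → Fin p → ℝ)))
      (f := fun X => ENNReal.ofReal (normalMatrixDensity M X))
      (continuous_normalMatrixDensity M).measurable.ennreal_ofReal
      (Filter.Eventually.of_forall fun _ => ENNReal.ofReal_lt_top) k
    simp only [ENNReal.toReal_ofReal (normalMatrixDensity_nonneg M _), smul_eq_mul] at this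
    exact this
  have hXc : Continuous fun X : Fin n → Fin p → ℝ => X a i := by fun_prop
  have hDc := continuous_normalMatrixDensity M
  -- Integration by parts against Lebesgue measure: the density has logarithmic derivative -(X a i -
  -- M a i), and compact support makes all three products integrable.
  have key := integral_bilinear_hasLineDerivAt_right_eq_neg_left_of_integrable
    (μ := (volume : Measure (Fin n → Fin p → ℝ))) (B := ContinuousLinearMap.mul ℝ ℝ)
    (f := normalMatrixDensity M)
    (f' := fun X => -(X a i - M a i) * normalMatrixDensity M X)
    (g := h) (g' := h') (v := Matrix.single a i (1 : ℝ)) ?_ ?_ ?_ ?_ ?_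
  · have e1 := hD (fun X => (X a i - M a i) * h X)
    have e2 := hD h'
    refine e1.trans (Eq.trans ?_ e2.symm)
    simp only [ContinuousLinearMap.mul_apply'] at key
    rw [key, ← integral_neg]
    congr 1
    ext X
    ring
  · exact Continuous.integrable_of_hasCompactSupport
      (((hXc.sub continuous_const).neg.mul hDc).mul hc)
      (HasCompactSupport.mul_left (f' := h) hs)
  · exact Continuous.integrable_of_hasCompactSupport (hDc.mul hc')
      (HasCompactSupport.mul_left (f' := h') hs')
  · exact Continuous.integrable_of_hasCompactSupport (hDc.mul hc)
      (HasCompactSupport.mul_left (f' := h) hs)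
  · intro X _
    exact hasLineDerivAt_normalMatrixDensity M X a i _ fun b j => Matrix.single_apply ..
  · intro X _
    exact hd X

theorem normalMatrixLaw_absolutelyContinuous {n p : ℕ} (M : Matrix (Fin n) (Fin p) ℝ) :
    normalMatrixLaw M ≪ (volume : Measure (Fin n → Fin p → ℝ)) := by
  rw [normalMatrixLaw_eq_withDensity]
  exact withDensity_absolutelyContinuous _ _

theorem MeasureTheory.MeasurePreserving.integral_comp_aestronglyMeasurable {α β : Type*}
    [MeasurableSpace α] [MeasurableSpace β] {μ : Measure α} {ν : Measure β} {f : α → β}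
    (hf : MeasurePreserving f μ ν) {g : β → ℝ} (hg : AEStronglyMeasurable g ν) :
    ∫ x, g (f x) ∂μ = ∫ y, g y ∂ν := by
  rw [← hf.map_eq] at hg ⊢
  exact (integral_map hf.measurable.aemeasurable hg).symm

theorem measurePreserving_normalMatrixLaw_row {n p : ℕ} (M : Matrix (Fin n) (Fin p) ℝ)
    (a : Fin n) :
    MeasurePreserving (fun X : Matrix (Fin n) (Fin p) ℝ => X a) (normalMatrixLaw M)
      (Measure.pi fun i => gaussianReal (M a i) 1) := by
  have : ∀ a, IsProbabilityMeasure (Measure.pi fun i => gaussianReal (M a i) 1) := fun a =>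
    inferInstance
  exact measurePreserving_eval (fun a => Measure.pi fun i => gaussianReal (M a i) 1) a

theorem measurePreserving_normalMatrixLaw_entry {n p : ℕ} (M : Matrix (Fin n) (Fin p) ℝ)
    (a : Fin n) (i : Fin p) :
    MeasurePreserving (fun X : Matrix (Fin n) (Fin p) ℝ => X a i) (normalMatrixLaw M)
      (gaussianReal (M a i) 1) :=
  (measurePreserving_eval (fun i => gaussianReal (M a i) 1) i).comp
    (measurePreserving_normalMatrixLaw_row M a)

theorem memLp_sub_normalMatrixLaw {n p : ℕ} (M : Matrix (Fin n) (Fin p) ℝ)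
    (a : Fin n) (i : Fin p) :
    MemLp (fun X : Matrix (Fin n) (Fin p) ℝ => X a i - M a i) 2 (normalMatrixLaw M) := by
  have h1 : MemLp (fun X : Matrix (Fin n) (Fin p) ℝ => X a i) 2 (normalMatrixLaw M) :=
    (memLp_id_gaussianReal' 2 (by simp)).comp_measurePreserving
      (measurePreserving_normalMatrixLaw_entry M a i)
  exact h1.sub (memLp_const _)

theorem integrable_sub_mul_sub_normalMatrixLaw {n p : ℕ} (M : Matrix (Fin n) (Fin p) ℝ)
    (a b : Fin n) (i j : Fin p) :
    Integrable (fun X : Matrix (Fin n) (Fin p) ℝ => (X a i - M a i) * (X b j - M b j))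
      (normalMatrixLaw M) :=
  (memLp_sub_normalMatrixLaw M a i).integrable_mul (memLp_sub_normalMatrixLaw M b j)

theorem integral_sub_mul_sub_normalMatrixLaw {n p : ℕ} (M : Matrix (Fin n) (Fin p) ℝ)
    (a : Fin n) (i j : Fin p) :
    ∫ X : Matrix (Fin n) (Fin p) ℝ, (X a i - M a i) * (X a j - M a j) ∂(normalMatrixLaw M)
      = if i = j then 1 else 0 := by
  have hmean : ∀ m : ℝ, ∫ x, (x - m) ∂(gaussianReal m 1) = 0 := by
    intro m
    have hi : Integrable (fun x : ℝ => x) (gaussianReal m 1) :=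
      (memLp_id_gaussianReal' 1 (by simp)).integrable le_rfl
    rw [integral_sub hi (integrable_const _), integral_id_gaussianReal]
    simp
  split_ifs with hij
  · subst hij
    have := (measurePreserving_normalMatrixLaw_entry M a i).integral_comp_aestronglyMeasurable
      (g := fun x : ℝ => (x - M a i) * (x - M a i)) (by fun_prop)
    rw [this]
    have hv := variance_id_gaussianReal (μ := M a i) (v := 1)
    rw [variance_eq_integral (by fun_prop)] at hv
    simpa [pow_two, integral_id_gaussianReal] using hv
  · have := (measurePreserving_normalMatrixLaw_row M a).integral_comp_aestronglyMeasurable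
      (g := fun x : Fin p → ℝ => (x i - M a i) * (x j - M a j)) (by fun_prop)
    rw [this]
    have hind : IndepFun (fun x : Fin p → ℝ => x i - M a i) (fun x : Fin p → ℝ => x j - M a j)
        (Measure.pi fun i => gaussianReal (M a i) 1) :=
      (iIndepFun_pi (μ := fun i => gaussianReal (M a i) 1) (X := fun i x => x - M a i)
        fun i => by fun_prop).indepFun hij
    rw [hind.integral_fun_mul_eq_mul_integral 
      (by fun_prop : Measurable fun x : Fin p → ℝ => x i - M a i).aestronglyMeasurable
      (by fun_prop : Measurable fun x : Fin p → ℝ => x j - M a j).aestronglyMeasurable]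
    have := (measurePreserving_eval (fun i => gaussianReal (M a i) 1) i).integral_comp_aestronglyMeasurable
      (g := fun x : ℝ => (x - M a i)) (by fun_prop)
    simp only [Function.eval] at this
    rw [this, hmean, zero_mul]

/-- Almost surely all singular values are positive. -/
theorem ae_sigma_pos {n p : ℕ} (h : p ≤ n) (M : Matrix (Fin n) (Fin p) ℝ) :
    ∀ᵐ X ∂(normalMatrixLaw M), ∀ (T : ThinSVD X) (k : Fin p), 0 < T.σ k := by
  set top : (Fin n → Fin p → ℝ) → Matrix (Fin p) (Fin p) ℝ :=
    fun X => Matrix.of fun i j => X (Fin.castLE h i) j with htop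
  set s : Set (Fin n → Fin p → ℝ) := {X | (top X).det ≠ 0} with hs
  have hcont : Continuous fun X => (top X).det :=
    Continuous.matrix_det (continuous_matrix fun i j => by simp only [htop, Matrix.of_apply]; fun_prop)
  have hsm : MeasurableSet s := (isOpen_ne_fun hcont continuous_const).measurableSet
  -- Along the direction e the top block becomes top Y + t I, whose determinant is the
  -- characteristic polynomial of -top Y at t. It has finitely many roots, so every line in this
  -- direction meets the exceptional set in a null set.
  set e : Fin n → Fin p → ℝ := fun a i => if a = Fin.castLE h i then 1 else 0 with he
  have hae : ∀ᵐ X ∂(volume : Measure (Fin n → Fin p → ℝ)), X ∈ s := by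
    refine ae_mem_of_ae_add_linearMap_mem (LinearMap.toSpanSingleton ℝ _ e) volume volume hsm
      fun Y => ?_
    have hfin : {t : ℝ | Y + LinearMap.toSpanSingleton ℝ _ e t ∉ s} ⊆
        ((-top Y).charpoly.roots.toFinset : Set ℝ) := by
      intro t ht
      simp only [hs, Set.mem_ofPred_eq, not_not] at ht
      simp only [Finset.mem_coe, Multiset.mem_toFinset]
      rw [Polynomial.mem_roots (Matrix.charpoly_monic _).ne_zero, Polynomial.IsRoot,
        Matrix.eval_charpoly]
      convert ht using 2
      ext i j
      simp [htop, he, Matrix.scalar_apply, Matrix.diagonal_apply, add_comm]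
    exact (measure_mono_null hfin (Finset.measure_zero _ _))
  filter_upwards [(normalMatrixLaw_absolutelyContinuous M).ae_le hae] with X hX T k
  refine (T.σ_nonneg k).lt_of_ne fun h0 => hX ?_
  have hXV : X * T.V = T.U * Matrix.diagonal T.σ := by
    have := congrArg (· * T.V) T.eq_mul
    simpa only [Matrix.mul_assoc, T.V_orth, Matrix.mul_one] using this
  -- If σ_k = 0, the k-th column of XV = UΣ vanishes, although V is invertible.
  have hz : (top X * T.V).det = 0 := by
    refine Matrix.det_eq_zero_of_column_eq_zero k fun i => ?_
    have := congrFun (congrFun hXV (Fin.castLE h i)) k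
    rw [Matrix.mul_diagonal, ← h0, mul_zero] at this
    exact this
  rw [Matrix.det_mul] at hz
  refine (mul_eq_zero.1 hz).resolve_right fun hV => ?_
  have := congrArg Matrix.det T.V_orth
  rw [Matrix.det_mul, hV] at this
  simp at this

/-! ### Spectral calculus for a fixed singular value decomposition -/

namespace ThinSVD

variable {n p : ℕ} {X : Matrix (Fin n) (Fin p) ℝ}

/-- The eigenvalues `λ_k = σ_k²` of `Xᵀ X`. -/
def lam (T : ThinSVD X) (k : Fin p) : ℝ := T.σ k ^ 2

/-- The matrix `V diag(d) Vᵀ`. -/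
def spec (T : ThinSVD X) (d : Fin p → ℝ) : Matrix (Fin p) (Fin p) ℝ :=
  T.V * Matrix.diagonal d * T.Vᵀ

theorem lam_nonneg (T : ThinSVD X) (k : Fin p) : 0 ≤ T.lam k := sq_nonneg _

theorem lam_antitone (T : ThinSVD X) : Antitone T.lam := fun _ l h =>
  pow_le_pow_left₀ (T.σ_nonneg l) (T.σ_antitone h) 2

theorem V_orth' (T : ThinSVD X) : T.V * T.Vᵀ = 1 := mul_eq_one_comm.1 T.V_orth

theorem spec_apply (T : ThinSVD X) (d : Fin p → ℝ) (i j : Fin p) :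
    T.spec d i j = ∑ k, T.V i k * d k * T.V j k := by
  rw [spec, Matrix.mul_apply]
  simp only [Matrix.mul_diagonal, Matrix.transpose_apply]

theorem mul_V (T : ThinSVD X) : X * T.V = T.U * Matrix.diagonal T.σ := by
  have := congrArg (· * T.V) T.eq_mul
  simpa only [Matrix.mul_assoc, T.V_orth, Matrix.mul_one] using this

theorem spec_one (T : ThinSVD X) : T.spec 1 = 1 := by
  have : Matrix.diagonal (1 : Fin p → ℝ) = 1 := Matrix.diagonal_one
  rw [spec, this, Matrix.mul_one, T.V_orth']

theorem spec_mul (T : ThinSVD X) (d e : Fin p → ℝ) : T.spec d * T.spec e = T.spec (d * e) := by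
  have h : T.spec d * T.spec e
      = T.V * Matrix.diagonal d * (T.Vᵀ * T.V) * Matrix.diagonal e * T.Vᵀ := by
    simp only [spec, Matrix.mul_assoc]
  rw [h, T.V_orth, Matrix.mul_one, Matrix.mul_assoc T.V, Matrix.diagonal_mul_diagonal]
  rfl

theorem spec_add (T : ThinSVD X) (d e : Fin p → ℝ) : T.spec (d + e) = T.spec d + T.spec e := by
  ext i j
  simp [spec_apply, mul_add, add_mul, Finset.sum_add_distrib]

theorem spec_sub (T : ThinSVD X) (d e : Fin p → ℝ) : T.spec (d - e) = T.spec d - T.spec e := by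
  ext i j
  simp [spec_apply, mul_sub, sub_mul, Finset.sum_sub_distrib]

theorem spec_smul (T : ThinSVD X) (c : ℝ) (d : Fin p → ℝ) : T.spec (c • d) = c • T.spec d := by
  ext i j
  simp only [spec_apply, Matrix.smul_apply, Pi.smul_apply, smul_eq_mul, Finset.mul_sum]
  exact Finset.sum_congr rfl fun k _ => by ring

theorem add_spec_apply (T : ThinSVD X) (d e : Fin p → ℝ) (i j : Fin p) :
    T.spec d i j + T.spec e i j = T.spec (fun k => d k + e k) i j := by
  rw [← Matrix.add_apply, ← T.spec_add]
  rfl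

theorem mul_spec_apply (T : ThinSVD X) (c : ℝ) (d : Fin p → ℝ) (i j : Fin p) :
    c * T.spec d i j = T.spec (fun k => c * d k) i j := by
  rw [← smul_eq_mul, ← Matrix.smul_apply, ← T.spec_smul]
  rfl

theorem sum_spec_apply (T : ThinSVD X) {ι : Type*} (s : Finset ι) (d : ι → Fin p → ℝ)
    (i j : Fin p) : ∑ r ∈ s, T.spec (d r) i j = T.spec (fun k => ∑ r ∈ s, d r k) i j := by
  simp only [T.spec_apply, Finset.mul_sum, Finset.sum_mul]
  exact Finset.sum_comm

theorem spec_transpose (T : ThinSVD X) (d : Fin p → ℝ) : (T.spec d)ᵀ = T.spec d := by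
  simp [spec, Matrix.mul_assoc]

theorem gram (T : ThinSVD X) : Xᵀ * X = T.spec T.lam := by
  have h : Xᵀ * X = (T.V * Matrix.diagonal T.σ * T.Uᵀ) * (T.U * Matrix.diagonal T.σ * T.Vᵀ) := by
    have h1 : X = T.U * Matrix.diagonal T.σ * T.Vᵀ := T.eq_mul
    have h2 : Xᵀ = T.V * Matrix.diagonal T.σ * T.Uᵀ := by
      have := congrArg Matrix.transpose h1
      simpa [Matrix.mul_assoc] using this
    exact congrArg₂ (· * ·) h2 h1
  have h3 : T.V * Matrix.diagonal T.σ * T.Uᵀ * (T.U * Matrix.diagonal T.σ * T.Vᵀ)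
      = T.V * Matrix.diagonal T.σ * (T.Uᵀ * T.U) * Matrix.diagonal T.σ * T.Vᵀ := by
    simp only [Matrix.mul_assoc]
  rw [h, h3, T.U_orth, Matrix.mul_one, Matrix.mul_assoc T.V, Matrix.diagonal_mul_diagonal, spec]
  congr 3
  ext k
  simp [lam, pow_two]

theorem spec_pow (T : ThinSVD X) (d : Fin p → ℝ) (q : ℕ) : T.spec d ^ q = T.spec (d ^ q) := by
  induction q with
  | zero => rw [pow_zero, pow_zero, spec_one]
  | succ q ih => rw [pow_succ, pow_succ, ih, spec_mul]

theorem trace_spec (T : ThinSVD X) (d : Fin p → ℝ) : (T.spec d).trace = ∑ k, d k := by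
  rw [spec, Matrix.trace_mul_comm, ← Matrix.mul_assoc, T.V_orth, Matrix.one_mul,
    Matrix.trace_diagonal]

theorem gram_pow (T : ThinSVD X) (q : ℕ) : (Xᵀ * X) ^ q = T.spec fun k => T.lam k ^ q := by
  rw [T.gram, spec_pow]
  rfl

theorem trace_gram_pow (T : ThinSVD X) (q : ℕ) :
    ((Xᵀ * X) ^ q).trace = ∑ k, T.lam k ^ q := by
  rw [T.gram_pow, trace_spec]

theorem abs_V_le (T : ThinSVD X) (i k : Fin p) : |T.V i k| ≤ 1 := by
  have h := congrFun (congrFun T.V_orth' i) i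
  simp only [Matrix.mul_apply, Matrix.transpose_apply, Matrix.one_apply_eq] at h
  have h2 : T.V i k * T.V i k ≤ 1 := by
    rw [← h]
    exact Finset.single_le_sum (f := fun k => T.V i k * T.V i k)
      (fun k _ => mul_self_nonneg _) (Finset.mem_univ k)
  exact abs_le_one_iff_mul_self_le_one.2 h2

/-- Entries of an orthogonal matrix have modulus at most 1. All later matrix estimates thereby
reduce to estimates of spectra. -/
theorem abs_spec_apply_le (T : ThinSVD X) (d : Fin p → ℝ) (i j : Fin p) :
    |T.spec d i j| ≤ ∑ k, |d k| := by
  rw [spec_apply]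
  refine (Finset.abs_sum_le_sum_abs _ _).trans (Finset.sum_le_sum fun k _ => ?_)
  rw [abs_mul, abs_mul]
  have h1 := T.abs_V_le i k
  have h2 := T.abs_V_le j k
  calc |T.V i k| * |d k| * |T.V j k| ≤ 1 * |d k| * 1 := by gcongr
    _ = |d k| := by ring

theorem tendsto_spec_apply (T : ThinSVD X) {ι : Type*} {l : Filter ι} {d : ι → Fin p → ℝ}
    {e : Fin p → ℝ} (h : ∀ k, Filter.Tendsto (fun m => d m k) l (nhds (e k))) (i j : Fin p) :
    Filter.Tendsto (fun m => T.spec (d m) i j) l (nhds (T.spec e i j)) := by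
  simp only [spec_apply]
  exact tendsto_finsetSum _ fun k _ => ((h k).const_mul _).mul_const _

end ThinSVD

/-! ### Polynomial spectral fields and their matrix divergence -/

/-- Entrywise derivative at `0` of a curve of matrices. -/
def HasEntryDeriv {m n : Type*} (A : ℝ → Matrix m n ℝ) (A' : Matrix m n ℝ) : Prop :=
  ∀ i j, HasDerivAt (fun t => A t i j) (A' i j) 0

namespace HasEntryDeriv

theorem mul {l m n : Type*} [Fintype m] {A : ℝ → Matrix l m ℝ} {B : ℝ → Matrix m n ℝ}
    {A' : Matrix l m ℝ} {B' : Matrix m n ℝ} (hA : HasEntryDeriv A A') (hB : HasEntryDeriv B B') :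
    HasEntryDeriv (fun t => A t * B t) (A' * B 0 + A 0 * B') := by
  intro i j
  simp only [Matrix.mul_apply, Matrix.add_apply, ← Finset.sum_add_distrib]
  exact HasDerivAt.fun_sum fun k _ => (hA i k).mul (hB k j)

theorem transpose {m n : Type*} {A : ℝ → Matrix m n ℝ} {A' : Matrix m n ℝ}
    (hA : HasEntryDeriv A A') : HasEntryDeriv (fun t => (A t)ᵀ) A'ᵀ := fun i j => hA j i

theorem pow {m : Type*} [Fintype m] [DecidableEq m] {A : ℝ → Matrix m m ℝ} {A' : Matrix m m ℝ}
    (hA : HasEntryDeriv A A') (q : ℕ) :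
    HasEntryDeriv (fun t => A t ^ q)
      (∑ r ∈ Finset.range q, A 0 ^ r * A' * A 0 ^ (q - 1 - r)) := by
  induction q with
  | zero =>
    intro i j
    simpa using hasDerivAt_const (0 : ℝ) ((1 : Matrix m m ℝ) i j)
  | succ q ih =>
    have h := ih.mul hA
    simp only [← pow_succ] at h
    convert! h using 1
    rw [Finset.sum_range_succ, Finset.sum_mul]
    congr 1
    · refine Finset.sum_congr rfl fun r hr => ?_
      rw [Matrix.mul_assoc _ _ (A 0), ← pow_succ]
      congr 2
      have := Finset.mem_range.1 hr
      omega
    · simp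

theorem trace {m : Type*} [Fintype m] {A : ℝ → Matrix m m ℝ} {A' : Matrix m m ℝ}
    (hA : HasEntryDeriv A A') : HasDerivAt (fun t => (A t).trace) A'.trace 0 := by
  simp only [Matrix.trace, Matrix.diag_apply]
  exact HasDerivAt.fun_sum fun k _ => hA k k

theorem line {m n : Type*} (X E : Matrix m n ℝ) : HasEntryDeriv (fun t : ℝ => X + t • E) E := by
  intro i j
  have := ((hasDerivAt_id (0 : ℝ)).mul_const (E i j)).const_add (X i j)
  exact this.congr_deriv (by simp)

end HasEntryDeriv

/-- `φ` and `d` are the spectra of a continuously differentiable field `X ↦ X V diag(φ(λ)) Vᵀ` and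
of its matrix divergence `V diag(d(λ)) Vᵀ`. -/
def IsSpectralField (n : ℕ) {p : ℕ} (φ d : (Fin p → ℝ) → Fin p → ℝ) : Prop :=
  ∃ (G : Matrix (Fin n) (Fin p) ℝ → Matrix (Fin n) (Fin p) ℝ)
    (G' : Fin n → Fin p → Fin p → Matrix (Fin n) (Fin p) ℝ → ℝ),
    (∀ a j, Continuous fun X => G X a j) ∧ (∀ a i j, Continuous (G' a i j)) ∧
    (∀ a i j X, HasDerivAt (fun t : ℝ => G (X + t • Matrix.single a i (1 : ℝ)) a j)
      (G' a i j X) 0) ∧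
    ∀ X (T : ThinSVD X), G X = X * T.spec (φ T.lam) ∧
      ∀ i j, ∑ a, G' a i j X = T.spec (d T.lam) i j

theorem mul_single_one_mul_apply {k l m o : Type*} [Fintype l] [Fintype m] [DecidableEq l]
    [DecidableEq m] (A : Matrix k l ℝ) (B : Matrix m o ℝ) (i : l) (a : m) (x : k) (y : o) :
    (A * Matrix.single i a (1 : ℝ) * B) x y = A x i * B a y := by
  rw [Matrix.mul_assoc, Matrix.mul_apply, Finset.sum_eq_single i]
  · simp
  · intro b _ hb
    rw [Matrix.single_mul_apply_of_ne _ _ _ _ _ hb, mul_zero]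
  · simp

theorem trace_mul_single_one {l m : Type*} [Fintype l] [Fintype m] [DecidableEq l]
    [DecidableEq m] (A : Matrix m l ℝ) (i : l) (a : m) :
    (A * Matrix.single i a (1 : ℝ)).trace = A a i := by
  rw [Matrix.trace_mul_single]
  simp

/-- The derivative of `Xᵀ X` in the direction of a matrix unit. -/
theorem hasEntryDeriv_gram {n p : ℕ} (X : Matrix (Fin n) (Fin p) ℝ) (a : Fin n) (i : Fin p) :
    HasEntryDeriv (fun t : ℝ => (X + t • Matrix.single a i (1 : ℝ))ᵀ
        * (X + t • Matrix.single a i (1 : ℝ)))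
      (Matrix.single i a (1 : ℝ) * X + Xᵀ * Matrix.single a i (1 : ℝ)) := by
  have h := (HasEntryDeriv.line X (Matrix.single a i (1 : ℝ))).transpose.mul
    (HasEntryDeriv.line X (Matrix.single a i (1 : ℝ)))
  simpa [Matrix.transpose_single] using h

/-- Under the trace the s terms of the noncommutative product rule agree by cyclicity, and the two
halves of the derivative of XᵀX are transposes of each other, whence the factor 2s. For s = 0 this
factor cancels the truncated exponent s - 1. -/
theorem hasDerivAt_trace_gram_pow {n p : ℕ} (X : Matrix (Fin n) (Fin p) ℝ) (a : Fin n)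
    (i : Fin p) (s : ℕ) :
    HasDerivAt (fun t : ℝ => (((X + t • Matrix.single a i (1 : ℝ))ᵀ
        * (X + t • Matrix.single a i (1 : ℝ))) ^ s).trace)
      (2 * s * (X * (Xᵀ * X) ^ (s - 1)) a i) 0 := by
  refine ((hasEntryDeriv_gram X a i).pow s).trace.congr_deriv ?_
  simp only [zero_smul, add_zero, Matrix.trace_sum]
  have hterm : ∀ r ∈ Finset.range s, ((Xᵀ * X) ^ r * (Matrix.single i a (1 : ℝ) * X
      + Xᵀ * Matrix.single a i (1 : ℝ)) * (Xᵀ * X) ^ (s - 1 - r)).trace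
      = 2 * (X * (Xᵀ * X) ^ (s - 1)) a i := by
    intro r hr
    have hr' : s - 1 - r + r = s - 1 := by have := Finset.mem_range.1 hr; omega
    have hsymm : ((Xᵀ * X) ^ (s - 1))ᵀ = (Xᵀ * X) ^ (s - 1) := by
      rw [Matrix.transpose_pow]
      simp
    rw [Matrix.trace_mul_comm, ← Matrix.mul_assoc, ← pow_add, hr', Matrix.mul_add,
      Matrix.trace_add, ← Matrix.mul_assoc, ← Matrix.mul_assoc, Matrix.trace_mul_comm,
      ← Matrix.mul_assoc, trace_mul_single_one, trace_mul_single_one]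
    have : ((Xᵀ * X) ^ (s - 1) * Xᵀ) i a = (X * (Xᵀ * X) ^ (s - 1)) a i := by
      rw [← Matrix.transpose_apply (X * (Xᵀ * X) ^ (s - 1)), Matrix.transpose_mul, hsymm]
    rw [this]
    ring
  rw [Finset.sum_congr rfl hterm, Finset.sum_const, Finset.card_range, nsmul_eq_mul]
  ring

namespace IsSpectralField

variable {n p : ℕ} {φ₁ φ₂ d₁ d₂ φ d : (Fin p → ℝ) → Fin p → ℝ}

theorem add (h₁ : IsSpectralField n φ₁ d₁) (h₂ : IsSpectralField n φ₂ d₂) :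
    IsSpectralField n (φ₁ + φ₂) (d₁ + d₂) := by
  obtain ⟨G, G', a1, a2, a3, a4⟩ := h₁
  obtain ⟨H, H', b1, b2, b3, b4⟩ := h₂
  refine ⟨fun X => G X + H X, fun a i j X => G' a i j X + H' a i j X,
    fun a j => (a1 a j).add (b1 a j), fun a i j => (a2 a i j).add (b2 a i j),
    fun a i j X => (a3 a i j X).add (b3 a i j X), fun X T => ⟨?_, fun i j => ?_⟩⟩
  · dsimp only
    rw [(a4 X T).1, (b4 X T).1, Pi.add_apply, T.spec_add, Matrix.mul_add]
  · rw [Finset.sum_add_distrib, (a4 X T).2, (b4 X T).2, Pi.add_apply, T.spec_add, Matrix.add_apply]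

theorem smul (c : ℝ) (h : IsSpectralField n φ d) : IsSpectralField n (c • φ) (c • d) := by
  obtain ⟨G, G', a1, a2, a3, a4⟩ := h
  refine ⟨fun X => c • G X, fun a i j X => c * G' a i j X,
    fun a j => continuous_const.mul (a1 a j), fun a i j => continuous_const.mul (a2 a i j),
    fun a i j X => (a3 a i j X).const_mul c, fun X T => ⟨?_, fun i j => ?_⟩⟩
  · dsimp only
    rw [(a4 X T).1, Pi.smul_apply, T.spec_smul, Matrix.mul_smul]
  · rw [← Finset.mul_sum, (a4 X T).2, Pi.smul_apply, T.spec_smul, Matrix.smul_apply, smul_eq_mul]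

theorem congr (h : IsSpectralField n φ₁ d₁) (hφ : φ₁ = φ₂) (hd : d₁ = d₂) :
    IsSpectralField n φ₂ d₂ := hφ ▸ hd ▸ h

theorem sum {ι : Type*} (s : Finset ι) {φ d : ι → (Fin p → ℝ) → Fin p → ℝ}
    (h : ∀ q ∈ s, IsSpectralField n (φ q) (d q)) :
    IsSpectralField n (∑ q ∈ s, φ q) (∑ q ∈ s, d q) := by
  classical
  induction s using Finset.induction_on with
  | empty =>
    refine ⟨fun _ => 0, fun _ _ _ _ => 0, fun _ _ => continuous_const,
      fun _ _ _ => continuous_const, fun _ _ _ _ => hasDerivAt_const _ _, fun X T => ⟨?_, ?_⟩⟩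
    · ext i j
      simp [Matrix.mul_apply, T.spec_apply]
    · intro i j
      simp [T.spec_apply]
  | insert q s hq ih =>
    rw [Finset.sum_insert hq, Finset.sum_insert hq]
    exact (h q (Finset.mem_insert_self _ _)).add
      (ih fun r hr => h r (Finset.mem_insert_of_mem hr))

/-- The field is tr(S^s) X S^q with S = XᵀX. Differentiating the factor X and summing over rows
gives n S^q. The two halves of dS inside S^q give q S^q and ∑ᵣ tr(S^(r+1)) S^(q-1-r); the latter is
the sum over l in the spectrum. The derivative of the scalar factor contributes 2s S^(s+q). -/
theorem monomial (n : ℕ) {p : ℕ} (q s : ℕ) :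
    IsSpectralField n (p := p) (fun lam k => (∑ m, lam m ^ s) * lam k ^ q)
      (fun lam k => (∑ m, lam m ^ s) * (n * lam k ^ q + q * lam k ^ q
          + ∑ l, lam l * ∑ r ∈ Finset.range q, lam l ^ r * lam k ^ (q - 1 - r))
        + 2 * lam k * lam k ^ q * (s * lam k ^ (s - 1))) := by
  have hX : Continuous fun X : Matrix (Fin n) (Fin p) ℝ => X := continuous_id
  have hS : Continuous fun X : Matrix (Fin n) (Fin p) ℝ => Xᵀ * X :=
    hX.matrix_transpose.matrix_mul hX
  have hent : ∀ {m l : Type} {A : Matrix (Fin n) (Fin p) ℝ → Matrix m l ℝ}, Continuous A →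
      ∀ i j, Continuous fun X => A X i j := fun hA i j => hA.matrix_elem i j
  refine ⟨fun X => ((Xᵀ * X) ^ s).trace • (X * (Xᵀ * X) ^ q),
    fun a i j X => ((Xᵀ * X) ^ s).trace * (((Xᵀ * X) ^ q) i j
        + ∑ r ∈ Finset.range q, ((X * (Xᵀ * X) ^ r) a i * (X * (Xᵀ * X) ^ (q - 1 - r)) a j
          + (X * (Xᵀ * X) ^ r * Xᵀ) a a * ((Xᵀ * X) ^ (q - 1 - r)) i j))
      + (2 * s * (X * (Xᵀ * X) ^ (s - 1)) a i) * (X * (Xᵀ * X) ^ q) a j,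
    ?_, ?_, ?_, ?_⟩
  · intro a j
    exact ((hS.pow s).matrix_trace.smul (hX.matrix_mul (hS.pow q))).matrix_elem a j
  · intro a i j
    refine (((hS.pow s).matrix_trace).mul ((hent (hS.pow q) i j).add
      (continuous_finsetSum _ fun r _ => ?_))).add ?_
    · exact ((hent (hX.matrix_mul (hS.pow r)) a i).mul
        (hent (hX.matrix_mul (hS.pow _)) a j)).add
        ((hent ((hX.matrix_mul (hS.pow r)).matrix_mul hX.matrix_transpose) a a).mul
          (hent (hS.pow _) i j))
    · exact (continuous_const.mul (hent (hX.matrix_mul (hS.pow _)) a i)).mul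
        (hent (hX.matrix_mul (hS.pow q)) a j)
  · intro a i j X
    have hG := (HasEntryDeriv.line X (Matrix.single a i (1 : ℝ))).mul
      ((hasEntryDeriv_gram X a i).pow q)
    refine ((hasDerivAt_trace_gram_pow X a i s).mul (hG a j)).congr_deriv ?_
    simp only [zero_smul, add_zero, Matrix.add_apply, Matrix.single_mul_apply_same, one_mul]
    have hterm : (X * ∑ r ∈ Finset.range q, (Xᵀ * X) ^ r * (Matrix.single i a (1 : ℝ) * X
        + Xᵀ * Matrix.single a i (1 : ℝ)) * (Xᵀ * X) ^ (q - 1 - r)) a j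
        = ∑ r ∈ Finset.range q, ((X * (Xᵀ * X) ^ r) a i * (X * (Xᵀ * X) ^ (q - 1 - r)) a j
          + (X * (Xᵀ * X) ^ r * Xᵀ) a a * ((Xᵀ * X) ^ (q - 1 - r)) i j) := by
      rw [Matrix.mul_sum, Matrix.sum_apply]
      refine Finset.sum_congr rfl fun r _ => ?_
      rw [← mul_single_one_mul_apply, ← mul_single_one_mul_apply, ← Matrix.add_apply]
      simp only [Matrix.mul_add, Matrix.add_mul, Matrix.mul_assoc]
    rw [hterm]
    ring
  · intro X T
    -- The sum over the rows a contracts the two copies of X to XᵀX, which puts every term back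
    -- among the functions of XᵀX.
    have hXX : ∀ A B : Matrix (Fin p) (Fin p) ℝ, ∀ i j, Aᵀ = A →
        ∑ a, (X * A) a i * (X * B) a j = (A * (Xᵀ * X) * B) i j := by
      intro A B i j hA
      have : A * (Xᵀ * X) * B = (X * A)ᵀ * (X * B) := by
        rw [Matrix.transpose_mul, hA]
        simp only [Matrix.mul_assoc]
      rw [this, Matrix.mul_apply]
      rfl
    have hsymm : ∀ r, ((Xᵀ * X) ^ r)ᵀ = (Xᵀ * X) ^ r := by
      intro r
      rw [Matrix.transpose_pow]
      simp
    constructor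
    · dsimp only
      rw [T.trace_gram_pow, T.gram_pow, ← Matrix.mul_smul, ← T.spec_smul]
      rfl
    · intro i j
      have h1 : ∀ r ∈ Finset.range q, ∑ a, ((X * (Xᵀ * X) ^ r) a i
            * (X * (Xᵀ * X) ^ (q - 1 - r)) a j
          + (X * (Xᵀ * X) ^ r * Xᵀ) a a * ((Xᵀ * X) ^ (q - 1 - r)) i j)
          = ((Xᵀ * X) ^ q) i j + (∑ l, T.lam l ^ (r + 1)) * ((Xᵀ * X) ^ (q - 1 - r)) i j := by
        intro r hr
        have hr' : r + 1 + (q - 1 - r) = q := by have := Finset.mem_range.1 hr; omega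
        rw [Finset.sum_add_distrib, hXX _ _ _ _ (hsymm r), ← pow_succ, ← pow_add, hr',
          ← Finset.sum_mul]
        congr 2
        rw [← T.trace_gram_pow, pow_succ, ← Matrix.mul_assoc, ← Matrix.trace_mul_comm,
          ← Matrix.mul_assoc]
        rfl
      have h2 : ∑ a, (2 * s * (X * (Xᵀ * X) ^ (s - 1)) a i) * (X * (Xᵀ * X) ^ q) a j
          = 2 * s * ((Xᵀ * X) ^ (s - 1) * (Xᵀ * X) * (Xᵀ * X) ^ q) i j := by
        rw [← hXX _ _ _ _ (hsymm (s - 1)), Finset.mul_sum]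
        exact Finset.sum_congr rfl fun a _ => by ring
      rw [Finset.sum_add_distrib, h2, ← Finset.mul_sum, Finset.sum_add_distrib, Finset.sum_comm,
        Finset.sum_congr rfl h1, T.trace_gram_pow]
      simp only [T.gram_pow, Finset.sum_add_distrib, Finset.sum_const, Finset.card_univ,
        Fintype.card_fin, Finset.card_range, nsmul_eq_mul]
      rw [T.gram, T.spec_mul, T.spec_mul]
      simp only [T.mul_spec_apply, T.sum_spec_apply, T.add_spec_apply]
      congr 2
      ext k
      have h3 : ∑ l, T.lam l * ∑ r ∈ Finset.range q, T.lam l ^ r * T.lam k ^ (q - 1 - r)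
          = ∑ r ∈ Finset.range q, (∑ l, T.lam l ^ (r + 1)) * T.lam k ^ (q - 1 - r) := by
        simp only [Finset.mul_sum, Finset.sum_mul]
        rw [Finset.sum_comm]
        exact Finset.sum_congr rfl fun r _ => Finset.sum_congr rfl fun l _ => by ring
      simp only [Pi.mul_apply]
      rw [h3]
      ring

end IsSpectralField

/-- The divided difference of a polynomial. -/
noncomputable def Polynomial.dividedDiff (f : Polynomial ℝ) (a b : ℝ) : ℝ :=
  if a = b then f.derivative.eval a else (f.eval a - f.eval b) / (a - b)

theorem Polynomial.dividedDiff_add (f g : Polynomial ℝ) (a b : ℝ) :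
    (f + g).dividedDiff a b = f.dividedDiff a b + g.dividedDiff a b := by
  unfold Polynomial.dividedDiff
  split_ifs
  · simp
  · simp only [Polynomial.eval_add]
    ring

theorem Polynomial.dividedDiff_monomial (q : ℕ) (c a b : ℝ) :
    (Polynomial.monomial q c).dividedDiff a b
      = c * ∑ r ∈ Finset.range q, a ^ r * b ^ (q - 1 - r) := by
  unfold Polynomial.dividedDiff
  split_ifs with h
  · subst h
    have : ∀ r ∈ Finset.range q, a ^ r * a ^ (q - 1 - r) = a ^ (q - 1) := by
      intro r hr
      rw [← pow_add]
      congr 1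
      have := Finset.mem_range.1 hr
      omega
    rw [Finset.sum_congr rfl this]
    simp [Polynomial.derivative_monomial, Polynomial.eval_monomial, mul_assoc]
  · have h' : a - b ≠ 0 := sub_ne_zero.2 h
    rw [div_eq_iff h', mul_assoc, geom_sum₂_mul]
    simp [Polynomial.eval_monomial, mul_sub]

namespace IsSpectralField

variable {n p : ℕ}

/-- Both sides are bilinear in (f, h), so monomials suffice. The geometric sum of a monomial is its
divided difference, which stays meaningful when eigenvalues coincide. -/
theorem mul_trace (f h : Polynomial ℝ) :
    IsSpectralField n (p := p) (fun lam k => (∑ m, h.eval (lam m)) * f.eval (lam k))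
      (fun lam k => (∑ m, h.eval (lam m)) * (n * f.eval (lam k)
          + lam k * f.derivative.eval (lam k) + ∑ l, lam l * f.dividedDiff (lam l) (lam k))
        + 2 * lam k * f.eval (lam k) * h.derivative.eval (lam k)) := by
  induction f using Polynomial.induction_on' with
  | add f g hf hg =>
    refine (hf.add hg).congr ?_ ?_
    · ext lam k
      simp only [Pi.add_apply, Polynomial.eval_add]
      ring
    · ext lam k
      simp only [Pi.add_apply, Polynomial.eval_add, Polynomial.derivative_add,
        Polynomial.dividedDiff_add, mul_add, Finset.sum_add_distrib]
      ring
  | monomial q c =>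
    induction h using Polynomial.induction_on' with
    | add f g hf hg =>
      refine (hf.add hg).congr ?_ ?_
      · ext lam k
        simp only [Pi.add_apply, Polynomial.eval_add, Finset.sum_add_distrib]
        ring
      · ext lam k
        simp only [Pi.add_apply, Polynomial.eval_add, Polynomial.derivative_add,
          Finset.sum_add_distrib]
        ring
    | monomial s b =>
      refine ((IsSpectralField.monomial n q s).smul (b * c)).congr ?_ ?_
      · ext lam k
        simp only [Pi.smul_apply, smul_eq_mul, Polynomial.eval_monomial, ← Finset.mul_sum]
        ring
      · ext lam k
        have hq : lam k * (q * lam k ^ (q - 1)) = q * lam k ^ q := by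
          rcases q with _ | q
          · simp
          · simp only [Nat.add_sub_cancel, pow_succ]
            ring
        have hd : lam k * (Polynomial.monomial q c).derivative.eval (lam k)
            = c * (q * lam k ^ q) := by
          rw [← hq]
          simp [Polynomial.derivative_monomial, Polynomial.eval_monomial]
          ring
        rw [hd]
        simp only [Pi.smul_apply, smul_eq_mul, Polynomial.eval_monomial, ← Finset.mul_sum,
          Polynomial.dividedDiff_monomial, Polynomial.derivative_monomial]
        have h3 : ∑ l, lam l * (c * ∑ r ∈ Finset.range q, lam l ^ r * lam k ^ (q - 1 - r))
            = c * ∑ l, lam l * ∑ r ∈ Finset.range q, lam l ^ r * lam k ^ (q - 1 - r) := by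
          rw [Finset.mul_sum]
          exact Finset.sum_congr rfl fun l _ => by ring
        rw [h3]
        ring

/-- This treats a separable kernel k(t, u) = ∑ⱼ fⱼ(t) hⱼ(u): F is t ↦ ∑ₘ k(t, λₘ), and K t is the
polynomial u ↦ k(t, u). The last term of the divergence, which comes from differentiating the
traces, is the u-derivative of k on the diagonal. -/
theorem sum_mul_trace (N : ℕ) (f h : ℕ → Polynomial ℝ)
    (F : (Fin p → ℝ) → Polynomial ℝ) (K : ℝ → Polynomial ℝ)
    (hF : ∀ lam, F lam = ∑ j ∈ Finset.range N, Polynomial.C (∑ m, (h j).eval (lam m)) * f j)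
    (hK : ∀ t, K t = ∑ j ∈ Finset.range N, Polynomial.C ((f j).eval t) * h j) :
    IsSpectralField n (p := p) (fun lam k => (F lam).eval (lam k))
      (fun lam k => n * (F lam).eval (lam k) + lam k * (F lam).derivative.eval (lam k)
        + ∑ l, lam l * (F lam).dividedDiff (lam l) (lam k)
        + 2 * lam k * (K (lam k)).derivative.eval (lam k)) := by
  refine (IsSpectralField.sum (Finset.range N) fun j _ => mul_trace (f j) (h j)).congr ?_ ?_
  · ext lam k
    simp [hF, Polynomial.eval_finsetSum, Finset.sum_apply]
  · ext lam k
    have hdd : ∀ a b, (F lam).dividedDiff a b = ∑ j ∈ Finset.range N,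
        (∑ m, (h j).eval (lam m)) * (f j).dividedDiff a b := by
      intro a b
      unfold Polynomial.dividedDiff
      split_ifs
      · simp [hF, Polynomial.eval_finsetSum]
      · simp only [hF, Polynomial.eval_finsetSum, Polynomial.eval_mul, Polynomial.eval_C]
        rw [← Finset.sum_sub_distrib, Finset.sum_div]
        exact Finset.sum_congr rfl fun j _ => by ring
    have h1 : (F lam).eval (lam k) = ∑ j ∈ Finset.range N,
        (∑ m, (h j).eval (lam m)) * (f j).eval (lam k) := by
      simp [hF, Polynomial.eval_finsetSum]
    have h2 : (F lam).derivative.eval (lam k) = ∑ j ∈ Finset.range N,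
        (∑ m, (h j).eval (lam m)) * (f j).derivative.eval (lam k) := by
      simp [hF, Polynomial.eval_finsetSum]
    have h3 : (K (lam k)).derivative.eval (lam k) = ∑ j ∈ Finset.range N,
        (f j).eval (lam k) * (h j).derivative.eval (lam k) := by
      simp [hK, Polynomial.eval_finsetSum]
    have h4 : ∑ l, lam l * (F lam).dividedDiff (lam l) (lam k) = ∑ j ∈ Finset.range N,
        (∑ m, (h j).eval (lam m)) * ∑ l, lam l * (f j).dividedDiff (lam l) (lam k) := by
      simp only [hdd, Finset.mul_sum]
      rw [Finset.sum_comm]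
      exact Finset.sum_congr rfl fun j _ => Finset.sum_congr rfl fun l _ => by ring
    rw [h1, h2, h3, h4]
    simp only [Finset.sum_apply, Finset.mul_sum, ← Finset.sum_add_distrib]
    refine Finset.sum_congr rfl fun j _ => ?_
    simp only [← Finset.mul_sum]
    ring

/-- The field attached to the pair interaction `(t, u) ↦ f(t) (β + s(t - u))`. -/
theorem pair (f s : Polynomial ℝ) (β : ℝ) (F : (Fin p → ℝ) → Polynomial ℝ)
    (hF : ∀ lam, F lam = f * (Polynomial.C (p * β)
      + ∑ m, s.comp (Polynomial.X - Polynomial.C (lam m)))) :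
    IsSpectralField n (p := p) (fun lam k => (F lam).eval (lam k))
      (fun lam k => n * (F lam).eval (lam k) + lam k * (F lam).derivative.eval (lam k)
        + ∑ l, lam l * (F lam).dividedDiff (lam l) (lam k)
        - 2 * lam k * (f.eval (lam k) * s.derivative.eval 0)) := by
  -- Taylor's formula separates the variables of s(t - u).
  have htaylor : ∀ t u : ℝ, s.eval (t - u) = ∑ j ∈ Finset.range (s.natDegree + 1),
      (Polynomial.hasseDeriv j s).eval t * (-u) ^ j := by
    intro t u
    have h1 : s.eval (t - u) = (Polynomial.taylor t s).eval (-u) := by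
      rw [Polynomial.taylor_eval]
      congr 1
      ring
    rw [h1, Polynomial.eval_eq_sum_range' (n := s.natDegree + 1)]
    · simp only [Polynomial.taylor_coeff]
    · rw [Polynomial.natDegree_taylor]
      omega
  -- Index 0 carries the constant β and index j + 1 the j-th Taylor term, hence `s.natDegree + 2`
  -- summands.
  set f' : ℕ → Polynomial ℝ := fun j => if j = 0 then f * Polynomial.C β else
    f * Polynomial.hasseDeriv (j - 1) s with hf'
  set h' : ℕ → Polynomial ℝ := fun j => if j = 0 then 1 else
    (-Polynomial.X) ^ (j - 1) with hh'
  refine (sum_mul_trace (s.natDegree + 2) f' h' F (fun t => Polynomial.C (f.eval t)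
    * (Polynomial.C β + s.comp (Polynomial.C t - Polynomial.X))) ?_ ?_).congr rfl ?_
  · intro lam
    rw [hF]
    refine Polynomial.funext fun t => ?_
    rw [Finset.sum_range_succ']
    simp [hf', hh', Polynomial.eval_finsetSum, htaylor, Finset.mul_sum, Finset.sum_mul, mul_add]
    rw [Finset.sum_comm, add_comm]
    congr 1
    · exact Finset.sum_congr rfl fun j _ => Finset.sum_congr rfl fun l _ => by ring
    · ring
  · intro t
    refine Polynomial.funext fun u => ?_
    rw [Finset.sum_range_succ']
    simp [hf', hh', Polynomial.eval_finsetSum, htaylor, Finset.mul_sum, mul_add]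
    rw [add_comm]
    congr 1
    exact Finset.sum_congr rfl fun j _ => by ring
  · ext lam k
    simp [Polynomial.derivative_comp]
    ring

end IsSpectralField

/-! ### Cutoff and localized Stein identity -/

theorem trace_gram_eq_sum {n p : ℕ} (X : Matrix (Fin n) (Fin p) ℝ) :
    (Xᵀ * X).trace = ∑ a, ∑ i, X a i ^ 2 := by
  simp only [Matrix.trace, Matrix.diag_apply, Matrix.mul_apply, Matrix.transpose_apply, ← pow_two]
  exact Finset.sum_comm

/-- The cutoff `(1 - tr(Xᵀ X) / R)₊`. -/
noncomputable def cutoff {n p : ℕ} (R : ℝ) (X : Matrix (Fin n) (Fin p) ℝ) : ℝ :=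
  max 0 (1 - (Xᵀ * X).trace / R)

theorem cutoff_nonneg {n p : ℕ} (R : ℝ) (X : Matrix (Fin n) (Fin p) ℝ) : 0 ≤ cutoff R X :=
  le_max_left _ _

theorem cutoff_le_one {n p : ℕ} {R : ℝ} (hR : 0 < R) (X : Matrix (Fin n) (Fin p) ℝ) :
    cutoff R X ≤ 1 := by
  have : 0 ≤ (Xᵀ * X).trace := by
    rw [trace_gram_eq_sum]
    positivity
  have : 0 ≤ (Xᵀ * X).trace / R := by positivity
  exact max_le zero_le_one (by linarith)

theorem trace_gram_lt_of_cutoff_pos {n p : ℕ} {R : ℝ} (hR : 0 < R)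
    {X : Matrix (Fin n) (Fin p) ℝ} (h : cutoff R X ≠ 0) : (Xᵀ * X).trace < R := by
  by_contra hc
  refine h (max_eq_left ?_)
  have : 1 ≤ (Xᵀ * X).trace / R := (one_le_div hR).2 (not_lt.1 hc)
  linarith

theorem continuous_cutoff {n p : ℕ} (R : ℝ) :
    Continuous (cutoff R : Matrix (Fin n) (Fin p) ℝ → ℝ) := by
  have hX : Continuous fun X : Matrix (Fin n) (Fin p) ℝ => X := continuous_id
  exact continuous_const.max
    (continuous_const.sub (((hX.matrix_transpose.matrix_mul hX).matrix_trace).div_const R))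

theorem hasCompactSupport_mul_cutoff {n p : ℕ} {R : ℝ} (hR : 0 < R)
    {g : Matrix (Fin n) (Fin p) ℝ → ℝ} (hg : ∀ X, cutoff R X = 0 → g X = 0) :
    HasCompactSupport g := by
  have hK : IsCompact (Set.univ.pi fun _ : Fin n => Set.univ.pi fun _ : Fin p =>
      Set.Icc (-√R) (√R)) :=
    isCompact_univ_pi fun _ => isCompact_univ_pi fun _ => isCompact_Icc
  refine HasCompactSupport.intro hK fun X hX => hg X ?_
  by_contra h
  refine hX fun a _ i _ => abs_le.1 (Real.abs_le_sqrt ?_)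
  refine le_trans ?_ (trace_gram_lt_of_cutoff_pos hR h).le
  rw [trace_gram_eq_sum]
  exact (Finset.single_le_sum (f := fun i => X a i ^ 2) (fun _ _ => sq_nonneg _)
    (Finset.mem_univ i)).trans (Finset.single_le_sum (f := fun a => ∑ i, X a i ^ 2)
      (fun _ _ => Finset.sum_nonneg fun _ _ => sq_nonneg _) (Finset.mem_univ a))

/-- The positive part becomes continuously differentiable once squared; this is why the cutoff
enters Stein's identity through its square. -/
theorem hasDerivAt_max_zero_sq (y : ℝ) : HasDerivAt (fun y : ℝ => max 0 y ^ 2) (2 * max 0 y) y := by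
  rcases lt_trichotomy y 0 with h | h | h
  · rw [max_eq_left h.le, mul_zero]
    refine (hasDerivAt_const y (0 : ℝ)).congr_of_eventuallyEq ?_
    filter_upwards [Iio_mem_nhds h] with z hz
    rw [max_eq_left (le_of_lt hz)]
    simp
  · subst h
    rw [max_self, mul_zero, hasDerivAt_iff_isLittleO_nhds_zero]
    have : (fun h : ℝ => h ^ 2) =o[nhds 0] fun h : ℝ => h := by
      simpa using Asymptotics.isLittleO_pow_id (𝕜 := ℝ) (n := 2) one_lt_two
    refine Asymptotics.IsBigO.trans_isLittleO (Asymptotics.IsBigO.of_bound 1 ?_) this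
    refine Filter.Eventually.of_forall fun h => ?_
    simp only [zero_add, max_self, ne_eq, OfNat.ofNat_ne_zero, not_false_eq_true, zero_pow, sub_zero,
      smul_zero, norm_pow, Real.norm_eq_abs, sq_abs, one_mul]
    rcases le_total 0 h with h0 | h0
    · rw [max_eq_right h0]
    · rw [max_eq_left h0]
      simp [sq_nonneg]
  · rw [max_eq_right h.le]
    refine HasDerivAt.congr_of_eventuallyEq (f := fun y : ℝ => y ^ 2) ?_ ?_
    · simpa using hasDerivAt_pow 2 y
    · filter_upwards [Ioi_mem_nhds h] with z hz
      rw [max_eq_right (le_of_lt hz)]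

theorem hasDerivAt_cutoff_sq {n p : ℕ} (R : ℝ) (X : Matrix (Fin n) (Fin p) ℝ) (a : Fin n)
    (i : Fin p) :
    HasDerivAt (fun t : ℝ => cutoff R (X + t • Matrix.single a i (1 : ℝ)) ^ 2)
      (-(4 / R) * cutoff R X * X a i) 0 := by
  have h1 := hasDerivAt_trace_gram_pow X a i 1
  simp only [pow_one, Nat.cast_one, mul_one, Nat.sub_self, pow_zero, Matrix.mul_one] at h1
  have h2 := (h1.div_const R).const_sub 1
  have h3 := (hasDerivAt_max_zero_sq _).comp (0 : ℝ) h2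
  refine h3.congr_deriv ?_
  simp only [zero_smul, add_zero, cutoff]
  ring

theorem integrable_of_cutoff {n p : ℕ} {R : ℝ} (hR : 0 < R) (M : Matrix (Fin n) (Fin p) ℝ)
    {g : Matrix (Fin n) (Fin p) ℝ → ℝ} (hc : Continuous g) (hg : ∀ X, cutoff R X = 0 → g X = 0) :
    Integrable g (normalMatrixLaw M) :=
  hc.integrable_of_hasCompactSupport (hasCompactSupport_mul_cutoff hR hg)

namespace IsSpectralField

variable {n p : ℕ} {φ d : (Fin p → ℝ) → Fin p → ℝ}

theorem continuous_field (h : IsSpectralField n φ d)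
    (svd : ∀ X : Matrix (Fin n) (Fin p) ℝ, ThinSVD X) (a : Fin n) (j : Fin p) :
    Continuous fun X => (X * (svd X).spec (φ (svd X).lam)) a j := by
  obtain ⟨G, G', a1, a2, a3, a4⟩ := h
  simpa only [← (a4 _ (svd _)).1] using a1 a j

theorem continuous_divergence (h : IsSpectralField n φ d)
    (svd : ∀ X : Matrix (Fin n) (Fin p) ℝ, ThinSVD X) (i j : Fin p) :
    Continuous fun X => (svd X).spec (d (svd X).lam) i j := by
  obtain ⟨G, G', a1, a2, a3, a4⟩ := h
  simp only [← (a4 _ (svd _)).2]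
  exact continuous_finsetSum _ fun a _ => a2 a i j

theorem continuous_inner (h : IsSpectralField n φ d)
    (svd : ∀ X : Matrix (Fin n) (Fin p) ℝ, ThinSVD X) (M : Matrix (Fin n) (Fin p) ℝ)
    (i j : Fin p) :
    Continuous fun X => ((X - M)ᵀ * (X * (svd X).spec (φ (svd X).lam))) i j := by
  simp only [Matrix.mul_apply (M := (_ - M)ᵀ), Matrix.transpose_apply, Matrix.sub_apply]
  refine continuous_finsetSum _ fun a _ => Continuous.mul ?_ (h.continuous_field svd a j)
  exact (continuous_id.matrix_elem a i).sub continuous_const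

theorem continuous_gram (h : IsSpectralField n φ d)
    (svd : ∀ X : Matrix (Fin n) (Fin p) ℝ, ThinSVD X) (i j : Fin p) :
    Continuous fun X => (svd X).spec ((svd X).lam * φ (svd X).lam) i j := by
  have := h.continuous_inner svd 0 i j
  simpa only [sub_zero, ← Matrix.mul_assoc, (svd _).gram, ThinSVD.spec_mul] using this

/-- Stein's identity, localized by the cutoff. -/
theorem integral_eq (h : IsSpectralField n φ d)
    (svd : ∀ X : Matrix (Fin n) (Fin p) ℝ, ThinSVD X) (M : Matrix (Fin n) (Fin p) ℝ) {R : ℝ}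
    (hR : 0 < R) (i j : Fin p) :
    ∫ X, ((X - M)ᵀ * (X * (svd X).spec (φ (svd X).lam))) i j * cutoff R X ^ 2
        ∂(normalMatrixLaw M)
      = ∫ X, ((svd X).spec (d (svd X).lam) i j * cutoff R X ^ 2
        - 4 / R * cutoff R X * (svd X).spec ((svd X).lam * φ (svd X).lam) i j)
        ∂(normalMatrixLaw M) := by
  obtain ⟨G, G', a1, a2, a3, a4⟩ := h
  have hcut := continuous_cutoff (n := n) (p := p) R
  have hel : ∀ a, Continuous fun X : Matrix (Fin n) (Fin p) ℝ => X a i := fun a =>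
    continuous_id.matrix_elem a i
  have hL : ∀ X, ((X - M)ᵀ * (X * (svd X).spec (φ (svd X).lam))) i j * cutoff R X ^ 2
      = ∑ a, (X a i - M a i) * (G X a j * cutoff R X ^ 2) := by
    intro X
    rw [← (a4 X (svd X)).1, Matrix.mul_apply, Finset.sum_mul]
    exact Finset.sum_congr rfl fun a _ => by
      simp only [Matrix.transpose_apply, Matrix.sub_apply]
      ring
  have hRt : ∀ X, (svd X).spec (d (svd X).lam) i j * cutoff R X ^ 2
        - 4 / R * cutoff R X * (svd X).spec ((svd X).lam * φ (svd X).lam) i j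
      = ∑ a, (G' a i j X * cutoff R X ^ 2 + G X a j * (-(4 / R) * cutoff R X * X a i)) := by
    intro X
    -- The gradient of the squared cutoff is proportional to X, so the boundary term contracts the
    -- field with X and yields XᵀXΦ, whose spectrum is λφ.
    have h1 : (svd X).spec ((svd X).lam * φ (svd X).lam) i j = ∑ a, X a i * G X a j := by
      rw [← ThinSVD.spec_mul, ← (svd X).gram, Matrix.mul_assoc, ← (a4 X (svd X)).1,
        Matrix.mul_apply]
      rfl
    rw [h1, ← (a4 X (svd X)).2, Finset.sum_mul, Finset.mul_sum, ← Finset.sum_sub_distrib]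
    exact Finset.sum_congr rfl fun a _ => by ring
  have c1 : ∀ a, Continuous fun X => G X a j * cutoff R X ^ 2 := fun a =>
    (a1 a j).mul (hcut.pow 2)
  have c2 : ∀ a, Continuous fun X => G' a i j X * cutoff R X ^ 2
      + G X a j * (-(4 / R) * cutoff R X * X a i) := fun a =>
    ((a2 a i j).mul (hcut.pow 2)).add ((a1 a j).mul ((continuous_const.mul hcut).mul (hel a)))
  simp_rw [hL, hRt]
  rw [integral_finsetSum, integral_finsetSum]
  · refine Finset.sum_congr rfl fun a _ => ?_
    refine normalMatrixLaw_stein M a i (c1 a) (c2 a) ?_ ?_ fun X => ?_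
    · exact hasCompactSupport_mul_cutoff hR fun X hX => by simp [hX]
    · exact hasCompactSupport_mul_cutoff hR fun X hX => by simp [hX]
    · refine ((a3 a i j X).mul (hasDerivAt_cutoff_sq R X a i)).congr_deriv ?_
      simp
  · exact fun a _ => integrable_of_cutoff hR M (c2 a) fun X hX => by simp [hX]
  · exact fun a _ => integrable_of_cutoff hR M (((hel a).sub continuous_const).mul (c1 a))
      fun X hX => by simp [hX]

end IsSpectralField

/-! ### Odd polynomial approximations of the sign function -/

theorem Polynomial.exists_derivative_eq (q : Polynomial ℝ) :
    ∃ A : Polynomial ℝ, A.derivative = q ∧ A.eval 0 = 0 := by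
  induction q using Polynomial.induction_on' with
  | add f g hf hg =>
    obtain ⟨A, hA, hA0⟩ := hf
    obtain ⟨B, hB, hB0⟩ := hg
    exact ⟨A + B, by simp [hA, hB], by simp [hA0, hB0]⟩
  | monomial m c =>
    refine ⟨Polynomial.monomial (m + 1) (c / (m + 1)), ?_, by simp [Polynomial.eval_monomial]⟩
    rw [Polynomial.derivative_monomial, Nat.add_sub_cancel]
    congr 1
    push_cast
    field_simp

theorem Polynomial.exists_eval_sub_eq (s : Polynomial ℝ) {a b : ℝ} (h : a < b) :
    ∃ ξ ∈ Set.Ioo a b, s.eval b - s.eval a = s.derivative.eval ξ * (b - a) := by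
  obtain ⟨ξ, hξ, he⟩ := exists_hasDerivAt_eq_slope (fun x => s.eval x)
    (fun x => s.derivative.eval x) h s.continuous.continuousOn fun x _ => s.hasDerivAt x
  refine ⟨ξ, hξ, ?_⟩
  rw [he, div_mul_cancel₀ _ (sub_pos.2 h).ne']

/-- A sequence of odd polynomials that approximates the sign function on `[-R, R]`. -/
structure IsSignApprox (R : ℝ) (s : ℕ → Polynomial ℝ) : Prop where
  eval_neg : ∀ m t, (s m).eval (-t) = -(s m).eval t
  derivative_nonneg : ∀ m t, |t| ≤ R → 0 ≤ (s m).derivative.eval t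
  abs_le_one : ∀ m t, |t| ≤ R → |(s m).eval t| ≤ 1
  abs_mul_derivative_le : ∀ m t, |t| ≤ R → |t| * (s m).derivative.eval t ≤ 1
  tendsto_derivative : ∀ t, 0 < |t| → |t| < R →
    Filter.Tendsto (fun m => (s m).derivative.eval t) Filter.atTop (nhds 0)
  tendsto_one : ∀ t, 0 < t → t < R →
    Filter.Tendsto (fun m => (s m).eval t) Filter.atTop (nhds 1)
  tendsto_derivative_zero :
    Filter.Tendsto (fun m => (s m).derivative.eval 0) Filter.atTop Filter.atTop

/-- The primitives of the Landau kernels `(1 - t²/R²)^m`. -/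
theorem exists_isSignApprox {R : ℝ} (hR : 0 < R) : ∃ s, IsSignApprox R s := by
  choose A hA hA0 using fun m : ℕ => Polynomial.exists_derivative_eq
    ((1 - (Polynomial.C R⁻¹ * Polynomial.X) ^ 2) ^ m)
  have hA' : ∀ m t, (A m).derivative.eval t = (1 - (R⁻¹ * t) ^ 2) ^ m := by
    intro m t
    rw [hA]
    simp
  have hbase : ∀ t, |t| ≤ R → 0 ≤ 1 - (R⁻¹ * t) ^ 2 := by
    intro t ht
    have : |R⁻¹ * t| ≤ 1 := by
      rw [abs_mul, abs_inv, abs_of_pos hR, inv_mul_le_iff₀ hR]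
      linarith
    have := (sq_le_one_iff_abs_le_one _).2 this
    linarith
  have hbase' : ∀ t, |t| < R → 0 < 1 - (R⁻¹ * t) ^ 2 := by
    intro t ht
    have : |R⁻¹ * t| < 1 := by
      rw [abs_mul, abs_inv, abs_of_pos hR, inv_mul_lt_iff₀ hR]
      linarith
    have := (sq_lt_one_iff_abs_lt_one _).2 this
    linarith
  have hc : ∀ m, 0 < (A m).eval R := by
    intro m
    obtain ⟨ξ, hξ, he⟩ := (A m).exists_eval_sub_eq hR
    rw [hA0, sub_zero, sub_zero, hA'] at he
    rw [he]
    exact mul_pos (pow_pos (hbase' ξ (by rw [abs_of_pos hξ.1]; exact hξ.2)) m) hR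
  have hodd : ∀ m t, (A m).eval (-t) = -(A m).eval t := by
    intro m t
    -- The kernel is even, so its primitive vanishing at 0 is odd.
    have hd : (A m + (A m).comp (-Polynomial.X)).derivative = 0 := by
      rw [Polynomial.derivative_add, Polynomial.derivative_comp, hA]
      simp
    have hconst := Polynomial.eq_C_of_derivative_eq_zero hd
    have e0 := congrArg (Polynomial.eval 0) hconst
    have et := congrArg (Polynomial.eval t) hconst
    simp [hA0] at e0 et
    rw [← e0] at et
    linarith
  -- Normalized so that s(R) = 1.
  set s : ℕ → Polynomial ℝ := fun m => Polynomial.C ((A m).eval R)⁻¹ * A m with hs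
  have hs' : ∀ m t, (s m).derivative.eval t = ((A m).eval R)⁻¹ * (1 - (R⁻¹ * t) ^ 2) ^ m := by
    intro m t
    simp [hs, hA']
  have hs0 : ∀ m, (s m).eval 0 = 0 := fun m => by simp [hs, hA0]
  have hsR : ∀ m, (s m).eval R = 1 := fun m => by simp [hs, (hc m).ne']
  have hsneg : ∀ m t, (s m).eval (-t) = -(s m).eval t := fun m t => by simp [hs, hodd]
  have hnn : ∀ m t, |t| ≤ R → 0 ≤ (s m).derivative.eval t := by
    intro m t ht
    rw [hs']
    exact mul_nonneg (inv_nonneg.2 (hc m).le) (pow_nonneg (hbase t ht) m)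
  have heven : ∀ m t, (s m).derivative.eval t = (s m).derivative.eval |t| := by
    intro m t
    rw [hs', hs', mul_pow, mul_pow, sq_abs]
  have hanti : ∀ m a b, 0 ≤ a → a ≤ b → b ≤ R →
      (s m).derivative.eval b ≤ (s m).derivative.eval a := by
    intro m a b ha hab hb
    rw [hs', hs']
    have h0 := hbase b (by rwa [abs_of_nonneg (ha.trans hab)])
    have : (0 : ℝ) ≤ ((A m).eval R)⁻¹ := inv_nonneg.2 (hc m).le
    gcongr
  have hmono : ∀ m a b, 0 ≤ a → a ≤ b → b ≤ R → (s m).eval a ≤ (s m).eval b := by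
    intro m a b ha hab hb
    rcases hab.eq_or_lt with h | h
    · rw [h]
    · obtain ⟨ξ, hξ, he⟩ := (s m).exists_eval_sub_eq h
      have := hnn m ξ (by rw [abs_of_pos (ha.trans_lt hξ.1)]; exact hξ.2.le.trans hb)
      have := mul_nonneg this (sub_pos.2 h).le
      linarith
  -- Concavity on [0, R]: the chord from 0 to t has slope between s'(t) and s'(0). The first bound
  -- yields |t| s'(t) ≤ 1, the second forces s'(0) → ∞.
  have hchord : ∀ m t, 0 < t → t ≤ R → t * (s m).derivative.eval t ≤ (s m).eval t
      ∧ (s m).eval t ≤ t * (s m).derivative.eval 0 := by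
    intro m t ht htR
    obtain ⟨ξ, hξ, he⟩ := (s m).exists_eval_sub_eq ht
    rw [hs0, sub_zero, sub_zero] at he
    have h1 := hanti m ξ t hξ.1.le hξ.2.le htR
    have h2 := hanti m 0 ξ le_rfl hξ.1.le (hξ.2.le.trans htR)
    rw [he]
    constructor <;> nlinarith
  have hle1 : ∀ m t, 0 ≤ t → t ≤ R → 0 ≤ (s m).eval t ∧ (s m).eval t ≤ 1 := by
    intro m t h0 h1
    exact ⟨hs0 m ▸ hmono m 0 t le_rfl h0 h1, hsR m ▸ hmono m t R h0 h1 le_rfl⟩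
  have htd : ∀ t, 0 < t → t < R →
      Filter.Tendsto (fun m => (s m).derivative.eval t) Filter.atTop (nhds 0) := by
    intro t ht htR
    have hb1 := hbase' t (by rwa [abs_of_pos ht])
    have hb2 := hbase' (t / 2) (by rw [abs_of_pos (by positivity)]; linarith)
    -- The ratio s'(t)/s'(t/2) equals ρ^m with ρ < 1, and the chord bound gives s'(t/2) ≤ 2/t
    -- uniformly in m.
    set ρ := (1 - (R⁻¹ * t) ^ 2) / (1 - (R⁻¹ * (t / 2)) ^ 2) with hρ
    have hρ0 : 0 ≤ ρ := (div_pos hb1 hb2).le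
    have hρ1 : ρ < 1 := by
      rw [hρ, div_lt_one hb2]
      have : 0 < R⁻¹ * t := by positivity
      nlinarith
    have hlim : Filter.Tendsto (fun m => 2 / t * ρ ^ m) Filter.atTop (nhds 0) := by
      simpa using (tendsto_pow_atTop_nhds_zero_of_lt_one hρ0 hρ1).const_mul (2 / t)
    refine squeeze_zero (fun m => hnn m t (by rw [abs_of_pos ht]; exact htR.le)) (fun m => ?_) hlim
    have e : (s m).derivative.eval t = (s m).derivative.eval (t / 2) * ρ ^ m := by
      rw [hs', hs', hρ, div_pow, mul_assoc, mul_div_cancel₀ _ (pow_pos hb2 m).ne']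
    have h1 := (hchord m (t / 2) (by positivity) (by linarith)).1
    have h2 := (hle1 m (t / 2) (by positivity) (by linarith)).2
    have h3 : (s m).derivative.eval (t / 2) ≤ 2 / t := by
      rw [le_div_iff₀ ht]
      linarith
    rw [e]
    exact mul_le_mul_of_nonneg_right h3 (pow_nonneg hρ0 m)
  have ht1 : ∀ t, 0 < t → t < R →
      Filter.Tendsto (fun m => (s m).eval t) Filter.atTop (nhds 1) := by
    intro t ht htR
    -- By the mean value theorem and the monotonicity of s', 1 - s(t) ≤ (R - t) s'(t) ≤ R s'(t) → 0.
    have hlim : Filter.Tendsto (fun m => 1 - (s m).derivative.eval t * R) Filter.atTop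
        (nhds 1) := by
      simpa using ((htd t ht htR).mul_const R).const_sub 1
    refine tendsto_of_tendsto_of_tendsto_of_le_of_le hlim tendsto_const_nhds (fun m => ?_)
      fun m => (hle1 m t ht.le htR.le).2
    obtain ⟨ξ, hξ, he⟩ := (s m).exists_eval_sub_eq htR
    rw [hsR] at he
    have h1 := hanti m t ξ ht.le hξ.1.le hξ.2.le
    have h2 := hnn m t (by rw [abs_of_pos ht]; exact htR.le)
    have : (s m).derivative.eval ξ * (R - t) ≤ (s m).derivative.eval t * R :=
      mul_le_mul h1 (by linarith) (by linarith) h2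
    simp only
    linarith
  refine ⟨s, hsneg, hnn, fun m t ht => ?_, fun m t ht => ?_, fun t h0 h1 => ?_, ht1, ?_⟩
  · rcases le_total 0 t with h | h
    · rw [abs_of_nonneg h] at ht
      rw [abs_of_nonneg (hle1 m t h ht).1]
      exact (hle1 m t h ht).2
    · rw [abs_of_nonpos h] at ht
      have := hle1 m (-t) (by linarith) ht
      rw [hsneg] at this
      rw [abs_of_nonpos (by linarith)]
      exact this.2
  · rw [heven]
    rcases (abs_nonneg t).eq_or_lt with h | h
    · rw [← h]
      simp
    · exact (hchord m |t| h ht).1.trans (hle1 m |t| h.le ht).2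
  · simp_rw [fun m => heven m t]
    exact htd _ h0 h1
  · rw [Filter.tendsto_atTop]
    intro B
    -- If s'(0) were below |B| + 1, the chord bound would give s(t) ≤ 1/2 at this t, whereas s(t) →
    -- 1.
    set t := min (R / 2) (1 / (2 * (|B| + 1))) with ht
    have hB : 0 < 2 * (|B| + 1) := by positivity
    have ht0 : 0 < t := lt_min (by positivity) (by positivity)
    have htR : t < R := (min_le_left _ _).trans_lt (by linarith)
    have htB : t * (2 * (|B| + 1)) ≤ 1 := by
      rw [← le_div_iff₀ hB]
      exact min_le_right _ _
    filter_upwards [(ht1 t ht0 htR).eventually (lt_mem_nhds (by norm_num : (1 / 2 : ℝ) < 1))]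
      with m hm
    have h1 := (hchord m t ht0 htR.le).2
    by_contra hcon
    have h2 : (s m).derivative.eval 0 < |B| + 1 := by
      have := le_abs_self B
      linarith [not_le.1 hcon]
    nlinarith

/-! ### Consequences of Fatou's lemma -/

section Fatou

variable {Ω : Type*} [MeasurableSpace Ω] {μ : Measure Ω} {F : ℕ → Ω → ℝ} {C : ℝ}

theorem liminf_lintegral_ofReal_lt_top (hF : ∀ m, Integrable (F m) μ) (h0 : ∀ m, 0 ≤ᵐ[μ] F m)
    (hb : ∀ m, ∫ ω, F m ω ∂μ ≤ C) :
    ∫⁻ ω, Filter.liminf (fun m => ENNReal.ofReal (F m ω)) Filter.atTop ∂μ < ⊤ := by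
  refine (lintegral_liminf_le' fun m => (hF m).aestronglyMeasurable.aemeasurable.ennreal_ofReal
    ).trans_lt ?_
  refine lt_of_le_of_lt (b := ENNReal.ofReal C) ?_ ENNReal.ofReal_lt_top
  refine Filter.liminf_le_of_le (by isBoundedDefault) fun b hb' => ?_
  obtain ⟨m, hm⟩ := hb'.exists
  refine hm.trans ?_
  rw [← ofReal_integral_eq_lintegral_ofReal (hF m) (h0 m)]
  exact ENNReal.ofReal_le_ofReal (hb m)

/-- A nonnegative sequence with bounded integrals almost surely does not diverge. -/
theorem ae_not_tendsto_atTop (hF : ∀ m, Integrable (F m) μ) (h0 : ∀ m, 0 ≤ᵐ[μ] F m)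
    (hb : ∀ m, ∫ ω, F m ω ∂μ ≤ C) :
    ∀ᵐ ω ∂μ, ¬ Filter.Tendsto (fun m => F m ω) Filter.atTop Filter.atTop := by
  have hm : AEMeasurable (fun ω => Filter.liminf (fun m => ENNReal.ofReal (F m ω)) Filter.atTop) μ :=
    ⟨fun ω => Filter.liminf (fun m => ENNReal.ofReal ((hF m).aestronglyMeasurable.mk _ ω))
        Filter.atTop,
      Measurable.liminf fun m =>
        (hF m).aestronglyMeasurable.stronglyMeasurable_mk.measurable.ennreal_ofReal, by
      filter_upwards [ae_all_iff.2 fun m => (hF m).aestronglyMeasurable.ae_eq_mk] with ω h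
      simp only [h]⟩
  filter_upwards [ae_lt_top' hm (liminf_lintegral_ofReal_lt_top hF h0 hb).ne] with ω hω ht
  exact hω.ne (ENNReal.tendsto_ofReal_atTop.comp ht).liminf_eq

/-- An almost sure limit of a nonnegative sequence with bounded integrals is integrable. -/
theorem integrable_of_tendsto_of_integral_le {f : Ω → ℝ} (hF : ∀ m, Integrable (F m) μ)
    (h0 : ∀ m, 0 ≤ᵐ[μ] F m) (hb : ∀ m, ∫ ω, F m ω ∂μ ≤ C)
    (hlim : ∀ᵐ ω ∂μ, Filter.Tendsto (fun m => F m ω) Filter.atTop (nhds (f ω))) :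
    Integrable f μ := by
  have hf0 : 0 ≤ᵐ[μ] f := by
    filter_upwards [ae_all_iff.2 h0, hlim] with ω h1 h2
    exact ge_of_tendsto' h2 h1
  refine ⟨aestronglyMeasurable_of_tendsto_ae _ (fun m => (hF m).aestronglyMeasurable) hlim, ?_⟩
  rw [hasFiniteIntegral_iff_ofReal hf0]
  refine lt_of_eq_of_lt (lintegral_congr_ae ?_) (liminf_lintegral_ofReal_lt_top hF h0 hb)
  filter_upwards [hlim] with ω h
  exact (((ENNReal.continuous_ofReal.tendsto _).comp h).liminf_eq).symm

end Fatou

/-! ### Stein's coefficients as sums of signs -/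

section Coeff

variable {n p : ℕ}

theorem steinCoeff_nonneg (hn : p + 1 ≤ n) (k : Fin p) : 0 ≤ steinCoeff n p k := by
  have h1 : (k.val : ℝ) + 1 ≤ p := by exact_mod_cast k.2
  have h2 : (p : ℝ) + 1 ≤ n := by exact_mod_cast hn
  unfold steinCoeff
  linarith

theorem steinCoeff_le (k : Fin p) : steinCoeff n p k ≤ n + p := by
  have h1 : (0 : ℝ) ≤ k.val := by positivity
  unfold steinCoeff
  linarith

/-- Coefficients and eigenvalues both decrease with the index, so the slope is positive; consecutive
coefficients differ by 2, so its numerator has modulus at least 2. This lets slopes control every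
singularity 1/|λ_l - λ_k|. -/
theorem two_div_abs_le_steinCoeff_slope {lam : Fin p → ℝ} (ha : Antitone lam)
    (hi : Function.Injective lam) {k l : Fin p} (h : l ≠ k) :
    2 / |lam l - lam k| ≤ (steinCoeff n p l - steinCoeff n p k) / (lam l - lam k) := by
  have hc : steinCoeff n p l - steinCoeff n p k = 2 * ((k.val : ℝ) - l.val) := by
    unfold steinCoeff
    ring
  rw [hc]
  rcases h.lt_or_gt with hlt | hlt
  · have h1 : 0 < lam l - lam k := sub_pos.2 ((ha hlt.le).lt_of_ne fun e => hlt.ne (hi e).symm)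
    have h2 : (l.val : ℝ) + 1 ≤ k.val := by exact_mod_cast hlt
    rw [abs_of_pos h1]
    gcongr
    linarith
  · have h1 : lam l - lam k < 0 := sub_neg.2 ((ha hlt.le).lt_of_ne fun e => hlt.ne (hi e).symm)
    have h2 : (k.val : ℝ) + 1 ≤ l.val := by exact_mod_cast hlt
    rw [abs_of_neg h1, ← neg_div_neg_eq (2 * ((k.val : ℝ) - l.val))]
    have : 0 < -(lam l - lam k) := by linarith
    gcongr
    linarith

/-- There are p - 1 - k indices above k and k below it (counted from 0). Hence c_k = n - 2 + ∑ₗ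
sign(λ_k - λ_l) for distinct ordered eigenvalues. -/
theorem sum_sign_eq (k : Fin p) :
    ∑ l : Fin p, (if k < l then (1 : ℝ) else if l < k then -1 else 0) = p - 1 - 2 * k.val := by
  have h : ∀ l : Fin p, (if k < l then (1 : ℝ) else if l < k then -1 else 0)
      = (if k < l then 1 else 0) - (if l < k then 1 else 0) := by
    intro l
    split_ifs with h1 h2 <;> first | exact absurd (h1.trans h2) (lt_irrefl _) | norm_num
  have hI : (Finset.univ.filter fun l : Fin p => k < l) = Finset.Ioi k := by ext; simp
  have hI' : (Finset.univ.filter fun l : Fin p => l < k) = Finset.Iio k := by ext; simp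
  simp_rw [h]
  rw [Finset.sum_sub_distrib, Finset.sum_boole, Finset.sum_boole, hI, hI', Fin.card_Ioi,
    Fin.card_Iio]
  have : ((p - 1 - k.val : ℕ) : ℝ) = p - 1 - k.val := by
    have := k.2
    rw [Nat.cast_sub (by omega), Nat.cast_sub (by omega)]
    simp
  rw [this]
  ring

end Coeff

/-! ### Pair fields approximating the spectrum c_k f(λ_k) -/

/-- The polynomial `f(t) (n - 2 + ∑ₗ s(t - λₗ))`. -/
noncomputable def pairPoly (n : ℕ) {p : ℕ} (f s : Polynomial ℝ) (lam : Fin p → ℝ) :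
    Polynomial ℝ :=
  f * (Polynomial.C (p * (((n : ℝ) - 2) / p))
    + ∑ l, s.comp (Polynomial.X - Polynomial.C (lam l)))

/-- The weight `n - 2 + ∑ₗ s(t - λₗ)`. -/
noncomputable def pairWeight (n : ℕ) {p : ℕ} (s : Polynomial ℝ) (lam : Fin p → ℝ) (t : ℝ) : ℝ :=
  (n : ℝ) - 2 + ∑ l, s.eval (t - lam l)

/-- The divergence spectrum of the field with spectrum `pairPoly`. -/
noncomputable def pairDiv (n : ℕ) {p : ℕ} (f s : Polynomial ℝ) (lam : Fin p → ℝ) (k : Fin p) : ℝ :=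
  n * (pairPoly n f s lam).eval (lam k) + lam k * (pairPoly n f s lam).derivative.eval (lam k)
        + ∑ l, lam l * (pairPoly n f s lam).dividedDiff (lam l) (lam k)
        - 2 * lam k * (f.eval (lam k) * s.derivative.eval 0)

/-- The divergence spectrum of the field with spectrum `c_k f(λ_k)`. -/
noncomputable def coeffDiv (n : ℕ) {p : ℕ} (f : Polynomial ℝ) (lam : Fin p → ℝ) (k : Fin p) : ℝ :=
  steinCoeff n p k * (n * f.eval (lam k) + 2 * lam k * f.derivative.eval (lam k)
      + ∑ l ∈ Finset.univ.erase k, lam l * ((f.eval (lam l) - f.eval (lam k)) / (lam l - lam k)))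
    + ∑ l ∈ Finset.univ.erase k, lam l * f.eval (lam l)
      * ((steinCoeff n p l - steinCoeff n p k) / (lam l - lam k))

section Pair

variable {n p : ℕ}

/-- The constant of the kernel is summed over the p eigenvalues; β = (n - 2)/p makes the total n -
2. -/
theorem isSpectralField_pair (n : ℕ) {p : ℕ} (f s : Polynomial ℝ) :
    IsSpectralField n (p := p) (fun lam k => (pairPoly n f s lam).eval (lam k))
      (pairDiv n f s) :=
  IsSpectralField.pair f s (((n : ℝ) - 2) / p) (pairPoly n f s) fun _ => rfl

theorem eval_pairPoly (f s : Polynomial ℝ) (lam : Fin p → ℝ) (k : Fin p) (t : ℝ) :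
    (pairPoly n f s lam).eval t = f.eval t * pairWeight n s lam t := by
  have : (p : ℝ) ≠ 0 := by
    have := k.pos
    positivity
  simp [pairPoly, pairWeight, Polynomial.eval_finsetSum, mul_div_cancel₀, this]

theorem eval_derivative_pairPoly (f s : Polynomial ℝ) (lam : Fin p → ℝ) (k : Fin p) (t : ℝ) :
    (pairPoly n f s lam).derivative.eval t = f.derivative.eval t * pairWeight n s lam t
      + f.eval t * ∑ l, s.derivative.eval (t - lam l) := by
  have : (p : ℝ) ≠ 0 := by
    have := k.pos
    positivity
  simp [pairPoly, pairWeight, Polynomial.eval_finsetSum, mul_div_cancel₀, this,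
    Polynomial.derivative_comp]

/-- The derivative of F and the diagonal divided difference together contribute 2λ_k f(λ_k) s'(0),
which cancels the negative term of `pairDiv` exactly. No s'(0) then remains in this expression when
the eigenvalues are distinct, which is what permits s'(0) → ∞. -/
theorem pairDiv_eq (f s : Polynomial ℝ) (lam : Fin p → ℝ) (k : Fin p) :
    pairDiv n f s lam k = n * (f.eval (lam k) * pairWeight n s lam (lam k))
      + 2 * lam k * f.derivative.eval (lam k) * pairWeight n s lam (lam k)
      + 2 * lam k * f.eval (lam k) * ∑ l ∈ Finset.univ.erase k, s.derivative.eval (lam k - lam l)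
      + ∑ l ∈ Finset.univ.erase k,
          lam l * (pairPoly n f s lam).dividedDiff (lam l) (lam k) := by
  have h1 := Finset.add_sum_erase Finset.univ
    (fun l => lam l * (pairPoly n f s lam).dividedDiff (lam l) (lam k)) (Finset.mem_univ k)
  have h2 := Finset.add_sum_erase Finset.univ
    (fun l => s.derivative.eval (lam k - lam l)) (Finset.mem_univ k)
  have h3 : (pairPoly n f s lam).dividedDiff (lam k) (lam k)
      = (pairPoly n f s lam).derivative.eval (lam k) := if_pos rfl
  simp only [h3, sub_self] at h1 h2
  unfold pairDiv
  rw [← h1, eval_pairPoly f s lam k, eval_derivative_pairPoly f s lam k, ← h2]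
  ring

/-- Product rule for divided differences, separating the slope of the weight from the slope of f. -/
theorem dividedDiff_pairPoly (f s : Polynomial ℝ) (lam : Fin p → ℝ) (k l : Fin p)
    (h : lam l ≠ lam k) :
    (pairPoly n f s lam).dividedDiff (lam l) (lam k)
      = f.eval (lam l) * ∑ m, (s.eval (lam l - lam m) - s.eval (lam k - lam m)) / (lam l - lam k)
        + pairWeight n s lam (lam k) * ((f.eval (lam l) - f.eval (lam k)) / (lam l - lam k)) := by
  have h' : lam l - lam k ≠ 0 := sub_ne_zero.2 h
  rw [Polynomial.dividedDiff, if_neg h, eval_pairPoly f s lam k, eval_pairPoly f s lam k,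
    ← Finset.sum_div, Finset.sum_sub_distrib]
  unfold pairWeight
  field_simp
  ring

end Pair

namespace IsSignApprox

variable {R : ℝ} {s : ℕ → Polynomial ℝ}

theorem eval_zero (h : IsSignApprox R s) (m : ℕ) : (s m).eval 0 = 0 := by
  have := h.eval_neg m 0
  rw [neg_zero] at this
  linarith

theorem slope_nonneg (h : IsSignApprox R s) (m : ℕ) {x y : ℝ} (hx : |x| ≤ R) (hy : |y| ≤ R) :
    0 ≤ ((s m).eval x - (s m).eval y) / (x - y) := by
  have key : ∀ x y : ℝ, |x| ≤ R → |y| ≤ R → x < y → (s m).eval x ≤ (s m).eval y := by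
    intro x y hx hy hxy
    obtain ⟨ξ, hξ, he⟩ := (s m).exists_eval_sub_eq hxy
    have h1 : |ξ| ≤ R := abs_le.2 ⟨(abs_le.1 hx).1.trans hξ.1.le, hξ.2.le.trans (abs_le.1 hy).2⟩
    have := mul_nonneg (h.derivative_nonneg m ξ h1) (sub_pos.2 hxy).le
    linarith
  rcases lt_trichotomy x y with hlt | heq | hlt
  · exact div_nonneg_of_nonpos (sub_nonpos.2 (key x y hx hy hlt)) (sub_neg.2 hlt).le
  · simp [heq]
  · exact div_nonneg (sub_nonneg.2 (key y x hy hx hlt)) (sub_pos.2 hlt).le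

theorem abs_slope_le (h : IsSignApprox R s) (m : ℕ) {x y : ℝ} (hx : |x| ≤ R) (hy : |y| ≤ R)
    (z : ℝ) : |((s m).eval x - (s m).eval y) / z| ≤ 2 / |z| := by
  rw [abs_div]
  gcongr
  have h1 := abs_le.1 (h.abs_le_one m x hx)
  have h2 := abs_le.1 (h.abs_le_one m y hy)
  exact abs_le.2 ⟨by linarith [h1.1, h2.2], by linarith [h1.2, h2.1]⟩

theorem tendsto_neg_one (h : IsSignApprox R s) {t : ℝ} (h0 : t < 0) (hR : -R < t) :
    Filter.Tendsto (fun m => (s m).eval t) Filter.atTop (nhds (-1)) := by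
  have := (h.tendsto_one (-t) (by linarith) (by linarith)).neg
  simpa only [h.eval_neg, neg_neg] using this

end IsSignApprox

/-! ### Positivity, limits and domination of the pair divergence -/

section PairBounds

variable {n p : ℕ} {R : ℝ} {s : ℕ → Polynomial ℝ} {lam : Fin p → ℝ}

theorem abs_sub_lt_of_mem_Ico (h0 : ∀ k, 0 ≤ lam k) (hR : ∀ k, lam k < R) (k l : Fin p) :
    |lam k - lam l| < R :=
  abs_lt.2 ⟨by linarith [h0 k, hR l], by linarith [h0 l, hR k]⟩

theorem abs_pairWeight_le (h : IsSignApprox R s) (h0 : ∀ k, 0 ≤ lam k) (hR : ∀ k, lam k < R)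
    (m : ℕ) (k : Fin p) : |pairWeight n (s m) lam (lam k)| ≤ n + 2 + p := by
  have h1 : |∑ l, (s m).eval (lam k - lam l)| ≤ p := by
    refine (Finset.abs_sum_le_sum_abs _ _).trans ?_
    refine (Finset.sum_le_sum fun l _ => h.abs_le_one m _
      (abs_sub_lt_of_mem_Ico h0 hR k l).le).trans ?_
    simp
  have h2 : |(n : ℝ) - 2| ≤ n + 2 := by
    have : (0 : ℝ) ≤ n := by positivity
    exact abs_le.2 ⟨by linarith, by linarith⟩
  exact (abs_add_le _ _).trans (add_le_add h2 h1)

/-- The term l = k is s(0) = 0 and the other p - 1 terms are at least -1, so the weight is at least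
n - p - 1. -/
theorem pairWeight_nonneg (hn : p + 1 ≤ n) (h : IsSignApprox R s) (h0 : ∀ k, 0 ≤ lam k)
    (hR : ∀ k, lam k < R) (m : ℕ) (k : Fin p) : 0 ≤ pairWeight n (s m) lam (lam k) := by
  have h1 : -((p : ℝ) - 1) ≤ ∑ l, (s m).eval (lam k - lam l) := by
    rw [← Finset.add_sum_erase _ _ (Finset.mem_univ k), sub_self, h.eval_zero, zero_add]
    have : ∑ l ∈ Finset.univ.erase k, (-1 : ℝ)
        ≤ ∑ l ∈ Finset.univ.erase k, (s m).eval (lam k - lam l) :=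
      Finset.sum_le_sum fun l _ => (abs_le.1 (h.abs_le_one m _
        (abs_sub_lt_of_mem_Ico h0 hR k l).le)).1
    rw [Finset.sum_const, Finset.card_erase_of_mem (Finset.mem_univ k), Finset.card_univ,
      Fintype.card_fin, nsmul_eq_mul, Nat.cast_sub k.pos] at this
    simpa using this
  have h2 : (p : ℝ) + 1 ≤ n := by exact_mod_cast hn
  unfold pairWeight
  linarith

theorem tendsto_pairWeight (h : IsSignApprox R s) (h0 : ∀ k, 0 ≤ lam k) (hR : ∀ k, lam k < R)
    (ha : Antitone lam) (hi : Function.Injective lam) (k : Fin p) :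
    Filter.Tendsto (fun m => pairWeight n (s m) lam (lam k)) Filter.atTop
      (nhds (steinCoeff n p k)) := by
  have hc : steinCoeff n p k = (n : ℝ) - 2
      + ∑ l : Fin p, (if k < l then (1 : ℝ) else if l < k then -1 else 0) := by
    rw [sum_sign_eq]
    unfold steinCoeff
    ring
  rw [hc]
  refine (tendsto_finsetSum _ fun l _ => ?_).const_add _
  have hR' := abs_lt.1 (abs_sub_lt_of_mem_Ico h0 hR k l)
  split_ifs with h1 h2
  · exact h.tendsto_one _ (sub_pos.2 ((ha h1.le).lt_of_ne fun e => h1.ne (hi e).symm)) hR'.2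
  · exact h.tendsto_neg_one (sub_neg.2 ((ha h2.le).lt_of_ne fun e => h2.ne (hi e).symm)) hR'.1
  · have : l = k := le_antisymm (not_lt.1 h1) (not_lt.1 h2)
    subst this
    simp only [sub_self, h.eval_zero]
    exact tendsto_const_nhds

/-- Off the diagonal s' tends to 0 and the weights tend to the coefficients, so the slopes of the
weight become the slopes of c. -/
theorem tendsto_pairDiv (f : Polynomial ℝ) (h : IsSignApprox R s) (h0 : ∀ k, 0 ≤ lam k)
    (hR : ∀ k, lam k < R) (ha : Antitone lam) (hi : Function.Injective lam) (k : Fin p) :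
    Filter.Tendsto (fun m => pairDiv n f (s m) lam k) Filter.atTop
      (nhds (coeffDiv n f lam k)) := by
  have hW := fun k => tendsto_pairWeight (n := n) h h0 hR ha hi k
  have hval : coeffDiv n f lam k = n * (f.eval (lam k) * steinCoeff n p k)
      + 2 * lam k * f.derivative.eval (lam k) * steinCoeff n p k
      + 2 * lam k * f.eval (lam k) * ∑ l ∈ Finset.univ.erase k, (0 : ℝ)
      + ∑ l ∈ Finset.univ.erase k, lam l * (f.eval (lam l)
          * ((steinCoeff n p l - steinCoeff n p k) / (lam l - lam k))
        + steinCoeff n p k * ((f.eval (lam l) - f.eval (lam k)) / (lam l - lam k))) := by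
    unfold coeffDiv
    simp only [Finset.sum_const_zero, mul_zero, add_zero, mul_add, Finset.sum_add_distrib,
      Finset.mul_sum]
    have e1 : ∀ l, steinCoeff n p k * (lam l * ((f.eval (lam l) - f.eval (lam k))
        / (lam l - lam k))) = lam l * (steinCoeff n p k * ((f.eval (lam l) - f.eval (lam k))
        / (lam l - lam k))) := fun l => by ring
    simp only [e1]
    simp only [mul_assoc]
    ring
  rw [hval]
  simp only [pairDiv_eq]
  refine ((((((hW k).const_mul _).const_mul _)).add ((hW k).const_mul _)).add
    ((tendsto_finsetSum _ fun l hl => ?_).const_mul _)).add (tendsto_finsetSum _ fun l hl => ?_)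
  · have hne : lam k - lam l ≠ 0 := sub_ne_zero.2 fun e => (Finset.ne_of_mem_erase hl) (hi e).symm
    exact h.tendsto_derivative _ (abs_pos.2 hne) (abs_sub_lt_of_mem_Ico h0 hR k l)
  · have hne : lam l ≠ lam k := fun e => (Finset.ne_of_mem_erase hl) (hi e)
    refine Filter.Tendsto.const_mul _ ?_
    simp only [dividedDiff_pairPoly _ _ _ _ _ hne]
    refine Filter.Tendsto.add (Filter.Tendsto.const_mul _ ?_) ((hW k).mul_const _)
    have e : ∀ m, ∑ j, ((s m).eval (lam l - lam j) - (s m).eval (lam k - lam j))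
        / (lam l - lam k) = (pairWeight n (s m) lam (lam l) - pairWeight n (s m) lam (lam k))
        / (lam l - lam k) := by
      intro m
      rw [← Finset.sum_div, Finset.sum_sub_distrib]
      unfold pairWeight
      congr 1
      ring
    simp only [e]
    exact ((hW l).sub (hW k)).div_const _

/-- For f = 1 every term of `pairDiv_eq` is nonnegative because s increases on [-R, R]. Eigenvalues
are allowed to coincide here, as needed for proving that they almost surely do not. -/
theorem pairDiv_one_ge (hn : p + 1 ≤ n) (h : IsSignApprox R s) (h0 : ∀ k, 0 ≤ lam k)
    (hR : ∀ k, lam k < R) (m : ℕ) (k : Fin p) :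
    2 * lam k * ∑ l ∈ Finset.univ.erase k, (s m).derivative.eval (lam k - lam l)
      ≤ pairDiv n 1 (s m) lam k := by
  have h1 : 0 ≤ ∑ l ∈ Finset.univ.erase k,
      lam l * (pairPoly n 1 (s m) lam).dividedDiff (lam l) (lam k) := by
    refine Finset.sum_nonneg fun l _ => mul_nonneg (h0 l) ?_
    by_cases he : lam l = lam k
    · rw [he, Polynomial.dividedDiff, if_pos rfl, eval_derivative_pairPoly _ _ _ k]
      simp only [Polynomial.derivative_one, Polynomial.eval_zero, zero_mul, zero_add,
        Polynomial.eval_one, one_mul]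
      exact Finset.sum_nonneg fun j _ => h.derivative_nonneg m _
        (abs_sub_lt_of_mem_Ico h0 hR k j).le
    · rw [dividedDiff_pairPoly _ _ _ _ _ he]
      simp only [Polynomial.eval_one, one_mul, sub_self, zero_div, mul_zero, add_zero]
      refine Finset.sum_nonneg fun j _ => ?_
      have := h.slope_nonneg m (abs_sub_lt_of_mem_Ico h0 hR l j).le
        (abs_sub_lt_of_mem_Ico h0 hR k j).le
      rwa [sub_sub_sub_cancel_right] at this
  have h2 := pairWeight_nonneg hn h h0 hR m k
  have h3 : 0 ≤ (n : ℝ) * pairWeight n (s m) lam (lam k) := mul_nonneg (by positivity) h2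
  rw [pairDiv_eq]
  simp only [Polynomial.derivative_one, Polynomial.eval_zero, mul_zero, zero_mul, add_zero,
    Polynomial.eval_one, one_mul, mul_one]
  linarith

theorem pairDiv_one_nonneg (hn : p + 1 ≤ n) (h : IsSignApprox R s) (h0 : ∀ k, 0 ≤ lam k)
    (hR : ∀ k, lam k < R) (m : ℕ) (k : Fin p) : 0 ≤ pairDiv n 1 (s m) lam k :=
  (mul_nonneg (mul_nonneg zero_le_two (h0 k)) (Finset.sum_nonneg fun l _ =>
    h.derivative_nonneg m _ (abs_sub_lt_of_mem_Ico h0 hR k l).le)).trans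
    (pairDiv_one_ge hn h h0 hR m k)

/-- A coincidence λ_k = λ_l leaves 2λ_k s'(0) among the terms with l ≠ k, and s'(0) → ∞ while λ_k >
0. -/
theorem tendsto_sum_pairDiv_one_atTop (hn : p + 1 ≤ n) (h : IsSignApprox R s)
    (h0 : ∀ k, 0 < lam k) (hR : ∀ k, lam k < R) (hi : ¬ Function.Injective lam) :
    Filter.Tendsto (fun m => ∑ k, pairDiv n 1 (s m) lam k) Filter.atTop Filter.atTop := by
  have h0' : ∀ k, 0 ≤ lam k := fun k => (h0 k).le
  obtain ⟨k, l, hkl, hne⟩ : ∃ k l, lam k = lam l ∧ k ≠ l := by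
    simpa [Function.Injective] using hi
  refine Filter.tendsto_atTop_mono (fun m => ?_)
    (h.tendsto_derivative_zero.const_mul_atTop (r := 2 * lam k) (by have := h0 k; positivity))
  refine le_trans ?_ (Finset.single_le_sum (f := fun k => pairDiv n 1 (s m) lam k)
    (fun k _ => pairDiv_one_nonneg hn h h0' hR m k) (Finset.mem_univ k))
  refine le_trans ?_ (pairDiv_one_ge hn h h0' hR m k)
  refine mul_le_mul_of_nonneg_left ?_ (by have := h0 k; positivity)
  have := Finset.single_le_sum (s := Finset.univ.erase k)
    (f := fun l => (s m).derivative.eval (lam k - lam l))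
    (fun l _ => h.derivative_nonneg m _ (abs_sub_lt_of_mem_Ico h0' hR k l).le)
    (Finset.mem_erase.2 ⟨hne.symm, Finset.mem_univ l⟩)
  simpa [hkl] using this

theorem coeffDiv_one (lam : Fin p → ℝ) (k : Fin p) :
    coeffDiv n 1 lam k = n * steinCoeff n p k + ∑ l ∈ Finset.univ.erase k, lam l
      * ((steinCoeff n p l - steinCoeff n p k) / (lam l - lam k)) := by
  unfold coeffDiv
  simp
  ring

theorem coeffDiv_one_terms_nonneg (h0 : ∀ k, 0 ≤ lam k) (ha : Antitone lam)
    (hi : Function.Injective lam) {k l : Fin p} (hkl : l ∈ Finset.univ.erase k) :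
    0 ≤ lam l * ((steinCoeff n p l - steinCoeff n p k) / (lam l - lam k)) :=
  mul_nonneg (h0 l) (le_trans (by positivity)
    (two_div_abs_le_steinCoeff_slope ha hi (Finset.ne_of_mem_erase hkl)))

theorem coeffDiv_one_nonneg (hn : p + 1 ≤ n) (h0 : ∀ k, 0 ≤ lam k) (ha : Antitone lam)
    (hi : Function.Injective lam) (k : Fin p) : 0 ≤ coeffDiv n 1 lam k := by
  rw [coeffDiv_one]
  exact add_nonneg (mul_nonneg (by positivity) (steinCoeff_nonneg hn k))
    (Finset.sum_nonneg fun l hl => coeffDiv_one_terms_nonneg h0 ha hi hl)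

theorem two_mul_div_abs_le_sum_coeffDiv_one (hn : p + 1 ≤ n) (h0 : ∀ k, 0 ≤ lam k)
    (ha : Antitone lam) (hi : Function.Injective lam) {k l : Fin p} (hkl : l ≠ k) :
    lam l * (2 / |lam l - lam k|) ≤ ∑ k, coeffDiv n 1 lam k := by
  refine le_trans ?_ (Finset.single_le_sum (f := fun k => coeffDiv n 1 lam k)
    (fun k _ => coeffDiv_one_nonneg hn h0 ha hi k) (Finset.mem_univ k))
  have hl : l ∈ Finset.univ.erase k := Finset.mem_erase.2 ⟨hkl, Finset.mem_univ l⟩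
  have h1 := Finset.single_le_sum (f := fun l => lam l
      * ((steinCoeff n p l - steinCoeff n p k) / (lam l - lam k)))
    (fun l hl => coeffDiv_one_terms_nonneg h0 ha hi hl) hl
  have h2 := mul_le_mul_of_nonneg_left
    (two_div_abs_le_steinCoeff_slope (n := n) ha hi hkl) (h0 l)
  have h3 : 0 ≤ (n : ℝ) * steinCoeff n p k := mul_nonneg (by positivity) (steinCoeff_nonneg hn k)
  rw [coeffDiv_one]
  linarith

theorem Polynomial.exists_abs_le_Icc (f : Polynomial ℝ) (R : ℝ) :
    ∃ C, 0 ≤ C ∧ ∀ t, 0 ≤ t → t ≤ R → |f.eval t| ≤ C := by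
  obtain ⟨C, hC⟩ := (isCompact_Icc (a := (0 : ℝ)) (b := R)).exists_bound_of_continuousOn
    f.continuous.continuousOn
  exact ⟨max C 0, le_max_right _ _, fun t h0 h1 => (hC t ⟨h0, h1⟩).trans (le_max_left _ _)⟩

theorem Polynomial.abs_slope_le (f : Polynomial ℝ) {C : ℝ}
    (hC : ∀ t, 0 ≤ t → t ≤ R → |f.derivative.eval t| ≤ C) {x y : ℝ} (hx : 0 ≤ x) (hxR : x ≤ R)
    (hy : 0 ≤ y) (hyR : y ≤ R) (hxy : x ≠ y) : |(f.eval x - f.eval y) / (x - y)| ≤ C := by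
  rcases hxy.lt_or_gt with h | h
  · obtain ⟨ξ, hξ, he⟩ := f.exists_eval_sub_eq h
    rw [← neg_div_neg_eq, neg_sub, neg_sub, he, mul_div_cancel_right₀ _ (sub_pos.2 h).ne']
    exact hC ξ (hx.trans hξ.1.le) (hξ.2.le.trans hyR)
  · obtain ⟨ξ, hξ, he⟩ := f.exists_eval_sub_eq h
    rw [he, mul_div_cancel_right₀ _ (sub_pos.2 h).ne']
    exact hC ξ (hy.trans hξ.1.le) (hξ.2.le.trans hxR)

/-- Domination uniform in m: the singular parts are λ_k s'(λ_k - λ_l) and λ_l times a slope of s,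
both bounded by λ 2/|λ_l - λ_k| and thus by the total divergence for f = 1. The remaining parts are
bounded on [0, R]. -/
theorem exists_abs_pairDiv_le (hn : p + 1 ≤ n) (f : Polynomial ℝ) (h : IsSignApprox R s) :
    ∃ A B : ℝ, ∀ lam : Fin p → ℝ, (∀ k, 0 ≤ lam k) → (∀ k, lam k < R) → Antitone lam →
      Function.Injective lam → ∀ m k,
        |pairDiv n f (s m) lam k| ≤ A + B * ∑ k, coeffDiv n 1 lam k := by
  obtain ⟨C, hC0, hC⟩ := f.exists_abs_le_Icc R
  obtain ⟨C', hC0', hC'⟩ := f.derivative.exists_abs_le_Icc R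
  set K : ℝ := n + 2 + p with hK
  have hK0 : 0 ≤ K := by positivity
  refine ⟨n * (C * K) + 2 * R * C' * K + p * (R * (K * C')), p * (2 * C) + p * (C * p), ?_⟩
  intro lam h0 hR ha hi m k
  set T := ∑ k, coeffDiv n 1 lam k with hT
  have hT0 : 0 ≤ T := Finset.sum_nonneg fun k _ => coeffDiv_one_nonneg hn h0 ha hi k
  have hR0 : 0 ≤ R := (h0 k).trans (hR k).le
  have hW := abs_pairWeight_le (n := n) h h0 hR m k
  have hf := fun l => hC (lam l) (h0 l) (hR l).le
  have hf' := hC' (lam k) (h0 k) (hR k).le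
  have hcard : ∀ c : ℝ, 0 ≤ c → ∑ l ∈ Finset.univ.erase k, c ≤ p * c := by
    intro c hc
    refine (Finset.sum_le_sum_of_subset_of_nonneg (Finset.erase_subset k Finset.univ)
      fun _ _ _ => hc).trans ?_
    simp
  have b1 : |n * (f.eval (lam k) * pairWeight n (s m) lam (lam k))| ≤ n * (C * K) := by
    rw [abs_mul, abs_mul, Nat.abs_cast]
    gcongr
    exact hf k
  have b2 : |2 * lam k * f.derivative.eval (lam k) * pairWeight n (s m) lam (lam k)|
      ≤ 2 * R * C' * K := by
    rw [abs_mul, abs_mul, abs_mul, abs_two, abs_of_nonneg (h0 k)]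
    gcongr
    exact (hR k).le
  have b3 : |2 * lam k * f.eval (lam k)
      * ∑ l ∈ Finset.univ.erase k, (s m).derivative.eval (lam k - lam l)| ≤ p * (2 * C) * T := by
    have e : 2 * lam k * f.eval (lam k)
        * ∑ l ∈ Finset.univ.erase k, (s m).derivative.eval (lam k - lam l)
        = ∑ l ∈ Finset.univ.erase k,
          2 * (f.eval (lam k) * (lam k * (s m).derivative.eval (lam k - lam l))) := by
      rw [Finset.mul_sum]
      exact Finset.sum_congr rfl fun l _ => by ring
    rw [e, mul_assoc]
    refine (Finset.abs_sum_le_sum_abs _ _).trans (le_trans (Finset.sum_le_sum fun l hl => ?_)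
      (hcard (2 * C * T) (by positivity)))
    have hlt := abs_sub_lt_of_mem_Ico h0 hR k l
    have hne : l ≠ k := Finset.ne_of_mem_erase hl
    have hpos : 0 < |lam k - lam l| := abs_pos.2 (sub_ne_zero.2 fun e => hne (hi e).symm)
    have h1 := h.derivative_nonneg m _ hlt.le
    -- The estimate |t| s'(t) ≤ 1, weakened by a factor 2 to match the slope bound for the
    -- coefficients.
    have h2 : (s m).derivative.eval (lam k - lam l) ≤ 2 / |lam k - lam l| := by
      rw [le_div_iff₀ hpos, mul_comm]
      linarith [h.abs_mul_derivative_le m _ hlt.le]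
    have h3 : lam k * (s m).derivative.eval (lam k - lam l) ≤ T :=
      (mul_le_mul_of_nonneg_left h2 (h0 k)).trans
        (two_mul_div_abs_le_sum_coeffDiv_one hn h0 ha hi hne.symm)
    rw [abs_mul, abs_mul, abs_two, abs_of_nonneg (mul_nonneg (h0 k) h1), mul_assoc]
    gcongr
    · exact mul_nonneg (h0 k) h1
    · exact hf k
  have b4 : |∑ l ∈ Finset.univ.erase k,
      lam l * (pairPoly n f (s m) lam).dividedDiff (lam l) (lam k)|
      ≤ p * (R * (K * C')) + p * (C * p) * T := by
    have e : p * (R * (K * C')) + p * (C * p) * T = p * (C * (p * T) + R * (K * C')) := by ring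
    rw [e]
    refine (Finset.abs_sum_le_sum_abs _ _).trans (le_trans (Finset.sum_le_sum fun l hl => ?_)
      (hcard _ (by positivity)))
    have hne : l ≠ k := Finset.ne_of_mem_erase hl
    have hne' : lam l ≠ lam k := fun e => hne (hi e)
    rw [dividedDiff_pairPoly _ _ _ _ _ hne', mul_add]
    refine (abs_add_le _ _).trans (add_le_add ?_ ?_)
    · have h1 : lam l * |∑ j, ((s m).eval (lam l - lam j) - (s m).eval (lam k - lam j))
          / (lam l - lam k)| ≤ p * T := by
        refine (mul_le_mul_of_nonneg_left (Finset.abs_sum_le_sum_abs _ _) (h0 l)).trans ?_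
        rw [Finset.mul_sum]
        refine (Finset.sum_le_sum fun j _ => ?_).trans (b := ∑ j : Fin p, T) (by simp)
        exact (mul_le_mul_of_nonneg_left (h.abs_slope_le m (abs_sub_lt_of_mem_Ico h0 hR l j).le
          (abs_sub_lt_of_mem_Ico h0 hR k j).le _) (h0 l)).trans
          (two_mul_div_abs_le_sum_coeffDiv_one hn h0 ha hi hne)
      rw [abs_mul, abs_mul, abs_of_nonneg (h0 l), mul_left_comm]
      gcongr
      · exact mul_nonneg (h0 l) (abs_nonneg _)
      · exact hf l
    · rw [abs_mul, abs_mul, abs_of_nonneg (h0 l)]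
      gcongr
      · exact (hR l).le
      · exact f.abs_slope_le hC' (h0 l) (hR l).le (h0 k) (hR k).le hne'
  rw [pairDiv_eq]
  refine (abs_add_le _ _).trans ((add_le_add ((abs_add_le _ _).trans
    (add_le_add ((abs_add_le _ _).trans (add_le_add b1 b2)) b3)) b4).trans (le_of_eq ?_))
  ring

end PairBounds

/-! ### Bounds on the support of the cutoff -/

section Localized

variable {n p : ℕ}

theorem ThinSVD.lam_lt_of_cutoff_ne_zero {X : Matrix (Fin n) (Fin p) ℝ} (T : ThinSVD X) {R : ℝ}
    (hR : 0 < R) (h : cutoff R X ≠ 0) (k : Fin p) : T.lam k < R := by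
  have h1 := trace_gram_lt_of_cutoff_pos hR h
  rw [T.gram, T.trace_spec] at h1
  exact (Finset.single_le_sum (f := T.lam) (fun k _ => T.lam_nonneg k)
    (Finset.mem_univ k)).trans_lt h1

theorem ae_lam_pos (hn : p + 1 ≤ n) (svd : ∀ X : Matrix (Fin n) (Fin p) ℝ, ThinSVD X)
    (M : Matrix (Fin n) (Fin p) ℝ) :
    ∀ᵐ X ∂(normalMatrixLaw M), ∀ k, 0 < (svd X).lam k := by
  filter_upwards [ae_sigma_pos (by omega) M] with X hX k
  exact pow_pos (hX _ k) 2

theorem ThinSVD.abs_inner_le {X : Matrix (Fin n) (Fin p) ℝ} (T : ThinSVD X)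
    (M : Matrix (Fin n) (Fin p) ℝ) (φ : Fin p → ℝ) (i j : Fin p) :
    |((X - M)ᵀ * (X * T.spec φ)) i j| ≤ (∑ l, |((X - M)ᵀ * X) i l|) * ∑ k, |φ k| := by
  rw [← Matrix.mul_assoc, Matrix.mul_apply, Finset.sum_mul]
  refine (Finset.abs_sum_le_sum_abs _ _).trans (Finset.sum_le_sum fun l _ => ?_)
  rw [abs_mul]
  exact mul_le_mul_of_nonneg_left (T.abs_spec_apply_le φ l j) (abs_nonneg _)

theorem integrable_inner_bound {R : ℝ} (hR : 0 < R) (M : Matrix (Fin n) (Fin p) ℝ) (i : Fin p)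
    (K : ℝ) :
    Integrable (fun X : Matrix (Fin n) (Fin p) ℝ =>
      (∑ l, |((X - M)ᵀ * X) i l|) * K * cutoff R X ^ 2) (normalMatrixLaw M) := by
  have hX : Continuous fun X : Matrix (Fin n) (Fin p) ℝ => X := continuous_id
  refine integrable_of_cutoff hR M ?_ fun X h => by simp [h]
  refine ((continuous_finsetSum _ fun l _ => ?_).mul continuous_const).mul
    ((continuous_cutoff R).pow 2)
  exact (((hX.sub continuous_const).matrix_transpose.matrix_mul hX).matrix_elem i l).abs

theorem abs_inner_mul_cutoff_le {R K : ℝ} {X : Matrix (Fin n) (Fin p) ℝ} (T : ThinSVD X)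
    (M : Matrix (Fin n) (Fin p) ℝ) {φ : Fin p → ℝ} (h : cutoff R X ≠ 0 → ∀ k, |φ k| ≤ K)
    (i j : Fin p) :
    |((X - M)ᵀ * (X * T.spec φ)) i j * cutoff R X ^ 2|
      ≤ (∑ l, |((X - M)ᵀ * X) i l|) * (p * K) * cutoff R X ^ 2 := by
  by_cases hc : cutoff R X = 0
  · simp [hc]
  rw [abs_mul, abs_of_nonneg (sq_nonneg (cutoff R X))]
  refine mul_le_mul_of_nonneg_right ((T.abs_inner_le M φ i j).trans ?_) (sq_nonneg _)
  refine mul_le_mul_of_nonneg_left ?_ (Finset.sum_nonneg fun _ _ => abs_nonneg _)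
  exact (Finset.sum_le_sum fun k _ => h hc k).trans (by simp)

theorem abs_boundary_le {R K : ℝ} (hR : 0 < R) {X : Matrix (Fin n) (Fin p) ℝ}
    (T : ThinSVD X) {φ : Fin p → ℝ} (h : cutoff R X ≠ 0 → ∀ k, |φ k| ≤ K) (i j : Fin p) :
    |4 / R * cutoff R X * T.spec (T.lam * φ) i j| ≤ 4 / R * (p * (R * |K|)) := by
  by_cases hc : cutoff R X = 0
  · simp only [hc, mul_zero, zero_mul, abs_zero]
    positivity
  have h1 : |T.spec (T.lam * φ) i j| ≤ p * (R * |K|) := by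
    refine (T.abs_spec_apply_le _ i j).trans
      ((Finset.sum_le_sum fun k _ => ?_).trans (b := ∑ k : Fin p, R * |K|) (by simp))
    rw [Pi.mul_apply, abs_mul, abs_of_nonneg (T.lam_nonneg k)]
    exact mul_le_mul (T.lam_lt_of_cutoff_ne_zero hR hc k).le ((h hc k).trans (le_abs_self K))
      (abs_nonneg _) hR.le
  rw [abs_mul, abs_mul, abs_of_nonneg (by positivity : 0 ≤ 4 / R),
    abs_of_nonneg (cutoff_nonneg R X)]
  calc 4 / R * cutoff R X * |T.spec (T.lam * φ) i j| ≤ 4 / R * 1 * (p * (R * |K|)) := by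
        gcongr
        exact cutoff_le_one hR X
    _ = _ := by ring

end Localized

/-! ### First limit: distinct eigenvalues and the identity for c_k f(λ_k) -/

section SignLimit

variable {n p : ℕ} {R : ℝ} {s : ℕ → Polynomial ℝ}

theorem exists_abs_eval_pairPoly_le (n p : ℕ) (f : Polynomial ℝ) (h : IsSignApprox R s) :
    ∃ K : ℝ, 0 ≤ K ∧ ∀ lam : Fin p → ℝ, (∀ k, 0 ≤ lam k) → (∀ k, lam k < R) → ∀ m k,
      |(pairPoly n f (s m) lam).eval (lam k)| ≤ K := by
  obtain ⟨C, hC0, hC⟩ := f.exists_abs_le_Icc R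
  refine ⟨C * (n + 2 + p), by positivity, fun lam h0 hR m k => ?_⟩
  rw [eval_pairPoly f (s m) lam k, abs_mul]
  exact mul_le_mul (hC _ (h0 k) (hR k).le) (abs_pairWeight_le h h0 hR m k) (abs_nonneg _) hC0

theorem integrable_divergence_mul_cutoff {φ d : (Fin p → ℝ) → Fin p → ℝ}
    (h : IsSpectralField n φ d) (svd : ∀ X : Matrix (Fin n) (Fin p) ℝ, ThinSVD X)
    (M : Matrix (Fin n) (Fin p) ℝ) (hR : 0 < R) (i j : Fin p) :
    Integrable (fun X => (svd X).spec (d (svd X).lam) i j * cutoff R X ^ 2)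
      (normalMatrixLaw M) :=
  integrable_of_cutoff hR M ((h.continuous_divergence svd i j).mul ((continuous_cutoff R).pow 2))
    fun X hX => by simp [hX]

theorem integrable_sum_pairDiv (f : Polynomial ℝ) (m : ℕ)
    (svd : ∀ X : Matrix (Fin n) (Fin p) ℝ, ThinSVD X) (M : Matrix (Fin n) (Fin p) ℝ)
    (hR : 0 < R) :
    Integrable (fun X => (∑ k, pairDiv n f (s m) (svd X).lam k) * cutoff R X ^ 2)
      (normalMatrixLaw M) := by
  have := integrable_finsetSum (Finset.univ : Finset (Fin p)) fun i _ =>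
    integrable_divergence_mul_cutoff (isSpectralField_pair n f (s m)) svd M hR i i
  refine this.congr (Filter.Eventually.of_forall fun X => ?_)
  simp only
  rw [← Finset.sum_mul, ← (svd X).trace_spec (pairDiv n f (s m) (svd X).lam)]
  rfl

/-- In Stein's identity the inner product and the boundary term involve only the spectrum, which is
bounded uniformly in m on the support of the cutoff. The divergence inherits the bound although its
integrand has none. -/
theorem exists_integral_sum_pairDiv_le (svd : ∀ X : Matrix (Fin n) (Fin p) ℝ, ThinSVD X)
    (M : Matrix (Fin n) (Fin p) ℝ) (hR : 0 < R) (h : IsSignApprox R s) :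
    ∃ C, ∀ m, ∫ X, (∑ k, pairDiv n 1 (s m) (svd X).lam k) * cutoff R X ^ 2
      ∂(normalMatrixLaw M) ≤ C := by
  obtain ⟨K, hK0, hK⟩ := exists_abs_eval_pairPoly_le n p 1 h
  refine ⟨∑ i : Fin p, (∫ X, (∑ l, |((X - M)ᵀ * X) i l|) * (p * K) * cutoff R X ^ 2
    ∂(normalMatrixLaw M) + 4 / R * (p * (R * |K|))), fun m => ?_⟩
  have hF := isSpectralField_pair n (p := p) 1 (s m)
  have hφ : ∀ X, cutoff R X ≠ 0 → ∀ k,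
      |(pairPoly n 1 (s m) (svd X).lam).eval ((svd X).lam k)| ≤ K := fun X hX k =>
    hK _ (svd X).lam_nonneg ((svd X).lam_lt_of_cutoff_ne_zero hR hX) m k
  have htr : ∀ X, (∑ k, pairDiv n 1 (s m) (svd X).lam k) * cutoff R X ^ 2
      = ∑ i, (svd X).spec (pairDiv n 1 (s m) (svd X).lam) i i * cutoff R X ^ 2 := by
    intro X
    rw [← Finset.sum_mul, ← (svd X).trace_spec]
    rfl
  have hint := fun i => integrable_divergence_mul_cutoff hF svd M hR i i
  simp_rw [htr]
  rw [integral_finsetSum _ fun i _ => hint i]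
  refine Finset.sum_le_sum fun i _ => ?_
  have hbd : Integrable (fun X => 4 / R * cutoff R X * (svd X).spec ((svd X).lam
      * fun k => (pairPoly n 1 (s m) (svd X).lam).eval ((svd X).lam k)) i i)
      (normalMatrixLaw M) :=
    integrable_of_cutoff hR M ((continuous_const.mul (continuous_cutoff R)).mul
      (hF.continuous_gram svd i i)) fun X hX => by simp [hX]
  have heq := hF.integral_eq svd M hR i i
  rw [integral_sub (hint i) hbd] at heq
  have h1 : ∫ X, ((X - M)ᵀ * (X * (svd X).spec
      fun k => (pairPoly n 1 (s m) (svd X).lam).eval ((svd X).lam k))) i i * cutoff R X ^ 2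
      ∂(normalMatrixLaw M) ≤ ∫ X, (∑ l, |((X - M)ᵀ * X) i l|) * (p * K) * cutoff R X ^ 2
      ∂(normalMatrixLaw M) := by
    refine integral_mono (integrable_of_cutoff hR M ((hF.continuous_inner svd M i i).mul
      ((continuous_cutoff R).pow 2)) fun X hX => by simp [hX])
      (integrable_inner_bound hR M i _) fun X => ?_
    exact (le_abs_self _).trans (abs_inner_mul_cutoff_le (svd X) M (hφ X) i i)
  have h2 : ∫ X, 4 / R * cutoff R X * (svd X).spec ((svd X).lam
      * fun k => (pairPoly n 1 (s m) (svd X).lam).eval ((svd X).lam k)) i i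
      ∂(normalMatrixLaw M) ≤ 4 / R * (p * (R * |K|)) := by
    refine (integral_mono hbd (integrable_const (4 / R * (p * (R * |K|)))) fun X =>
      (le_abs_self _).trans (abs_boundary_le hR (svd X) (hφ X) i i)).trans ?_
    simp
  linarith

theorem sum_pairDiv_mul_cutoff_nonneg (hn : p + 1 ≤ n) (h : IsSignApprox R s) (hR : 0 < R) (m : ℕ)
    {X : Matrix (Fin n) (Fin p) ℝ} (T : ThinSVD X) :
    0 ≤ (∑ k, pairDiv n 1 (s m) T.lam k) * cutoff R X ^ 2 := by
  by_cases hc : cutoff R X = 0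
  · simp [hc]
  · exact mul_nonneg (Finset.sum_nonneg fun k _ => pairDiv_one_nonneg hn h T.lam_nonneg
      (T.lam_lt_of_cutoff_ne_zero hR hc) m k) (sq_nonneg _)

/-- Almost surely the eigenvalues of `Xᵀ X` are distinct. -/
theorem ae_lam_injective (hn : p + 1 ≤ n) (svd : ∀ X : Matrix (Fin n) (Fin p) ℝ, ThinSVD X)
    (M : Matrix (Fin n) (Fin p) ℝ) :
    ∀ᵐ X ∂(normalMatrixLaw M), Function.Injective (svd X).lam := by
  have key : ∀ R : ℕ, ∀ᵐ X ∂(normalMatrixLaw M), cutoff ((R : ℝ) + 1) X ≠ 0 →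
      Function.Injective (svd X).lam := by
    intro R
    have hR : (0 : ℝ) < (R : ℝ) + 1 := by positivity
    obtain ⟨s, h⟩ := exists_isSignApprox hR
    obtain ⟨C, hC⟩ := exists_integral_sum_pairDiv_le svd M hR h
    filter_upwards [ae_lam_pos hn svd M, ae_not_tendsto_atTop
      (fun m => integrable_sum_pairDiv 1 m svd M hR) (fun m => Filter.Eventually.of_forall fun X =>
        sum_pairDiv_mul_cutoff_nonneg hn h hR m (svd X)) hC] with X hpos hX hc
    -- A repeated eigenvalue would make a nonnegative sequence with bounded integrals diverge, which
    -- happens only on a null set.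
    by_contra hi
    refine hX (Filter.Tendsto.atTop_mul_const ?_ (tendsto_sum_pairDiv_one_atTop hn h hpos
      ((svd X).lam_lt_of_cutoff_ne_zero hR hc) hi))
    exact pow_pos ((cutoff_nonneg _ X).lt_of_ne hc.symm) 2
  filter_upwards [ae_all_iff.2 key] with X hX
  -- Every X has positive cutoff at some integer radius, so countably many null sets suffice.
  obtain ⟨R, hR⟩ := exists_nat_gt (Xᵀ * X).trace
  refine hX R (ne_of_gt (lt_max_of_lt_right ?_))
  have h1 : (Xᵀ * X).trace / ((R : ℝ) + 1) < 1 := by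
    rw [div_lt_one (by positivity)]
    linarith
  linarith

theorem integrable_sum_coeffDiv_one (hn : p + 1 ≤ n)
    (svd : ∀ X : Matrix (Fin n) (Fin p) ℝ, ThinSVD X) (M : Matrix (Fin n) (Fin p) ℝ)
    (hR : 0 < R) :
    Integrable (fun X => (∑ k, coeffDiv n 1 (svd X).lam k) * cutoff R X ^ 2)
      (normalMatrixLaw M) := by
  obtain ⟨s, h⟩ := exists_isSignApprox hR
  obtain ⟨C, hC⟩ := exists_integral_sum_pairDiv_le svd M hR h
  refine integrable_of_tendsto_of_integral_le (fun m => integrable_sum_pairDiv 1 m svd M hR)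
    (fun m => Filter.Eventually.of_forall fun X =>
      sum_pairDiv_mul_cutoff_nonneg hn h hR m (svd X)) hC ?_
  filter_upwards [ae_lam_injective hn svd M] with X hi
  by_cases hc : cutoff R X = 0
  · simp [hc]
  exact (tendsto_finsetSum _ fun k _ => tendsto_pairDiv 1 h (svd X).lam_nonneg
    ((svd X).lam_lt_of_cutoff_ne_zero hR hc) (svd X).lam_antitone hi k).mul_const _

/-- The spectrum `c_k f(λ_k)`. -/
noncomputable def coeffField (n : ℕ) {p : ℕ} (f : Polynomial ℝ) (lam : Fin p → ℝ) (k : Fin p) : ℝ :=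
  steinCoeff n p k * f.eval (lam k)

theorem tendsto_eval_pairPoly (f : Polynomial ℝ) (h : IsSignApprox R s) (hR : 0 < R)
    {X : Matrix (Fin n) (Fin p) ℝ} (T : ThinSVD X) (hc : cutoff R X ≠ 0)
    (hi : Function.Injective T.lam) (k : Fin p) :
    Filter.Tendsto (fun m => (pairPoly n f (s m) T.lam).eval (T.lam k)) Filter.atTop
      (nhds (coeffField n f T.lam k)) := by
  simp only [eval_pairPoly f _ T.lam k]
  rw [coeffField, mul_comm]
  exact (tendsto_pairWeight h T.lam_nonneg (T.lam_lt_of_cutoff_ne_zero hR hc) T.lam_antitone hi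
    k).const_mul _

/-- The decomposition is chosen arbitrarily, without measurability. Measurability of the field comes
from its being an almost sure limit of continuous fields; the cutoff confines the eigenvalues to the
range where the sign approximation converges. -/
theorem aestronglyMeasurable_coeffField (hn : p + 1 ≤ n) (f : Polynomial ℝ)
    (svd : ∀ X : Matrix (Fin n) (Fin p) ℝ, ThinSVD X) (M : Matrix (Fin n) (Fin p) ℝ)
    (hR : 0 < R) (a : Fin n) (j : Fin p) :
    AEStronglyMeasurable (fun X => (X * (svd X).spec (coeffField n f (svd X).lam)) a j * cutoff R X)
      (normalMatrixLaw M) := by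
  obtain ⟨s, h⟩ := exists_isSignApprox hR
  refine aestronglyMeasurable_of_tendsto_ae Filter.atTop
    (f := fun m X => (X * (svd X).spec fun k => (pairPoly n f (s m) (svd X).lam).eval
      ((svd X).lam k)) a j * cutoff R X) (fun m =>
      (((isSpectralField_pair n f (s m)).continuous_field svd a j).mul
        (continuous_cutoff R)).aestronglyMeasurable) ?_
  filter_upwards [ae_lam_injective hn svd M] with X hi
  by_cases hc : cutoff R X = 0
  · simp [hc]
  refine Filter.Tendsto.mul_const _ ?_
  simp only [Matrix.mul_apply]
  exact tendsto_finsetSum _ fun l _ => ((svd X).tendsto_spec_apply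
    (fun k => tendsto_eval_pairPoly f h hR (svd X) hc hi k) l j).const_mul _

theorem ThinSVD.tendsto_inner {X : Matrix (Fin n) (Fin p) ℝ} (T : ThinSVD X)
    (M : Matrix (Fin n) (Fin p) ℝ) {φ : ℕ → Fin p → ℝ} {ψ : Fin p → ℝ}
    (h : ∀ k, Filter.Tendsto (fun m => φ m k) Filter.atTop (nhds (ψ k))) (i j : Fin p) :
    Filter.Tendsto (fun m => ((X - M)ᵀ * (X * T.spec (φ m))) i j) Filter.atTop
      (nhds (((X - M)ᵀ * (X * T.spec ψ)) i j)) := by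
  simp only [← Matrix.mul_assoc]
  simp only [Matrix.mul_apply (N := T.spec _)]
  exact tendsto_finsetSum _ fun l _ => (T.tendsto_spec_apply h l j).const_mul _

/-- Dominated convergence in the localized identity for the pair fields, each of the three terms
having its own dominating function. -/
theorem integrable_coeffDiv_and_integral_eq (hn : p + 1 ≤ n) (f : Polynomial ℝ)
    (svd : ∀ X : Matrix (Fin n) (Fin p) ℝ, ThinSVD X) (M : Matrix (Fin n) (Fin p) ℝ)
    (hR : 0 < R) (i j : Fin p) :
    Integrable (fun X => (svd X).spec (coeffDiv n f (svd X).lam) i j * cutoff R X ^ 2)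
        (normalMatrixLaw M) ∧
      Integrable (fun X => ((X - M)ᵀ * (X * (svd X).spec (coeffField n f (svd X).lam))) i j
        * cutoff R X ^ 2) (normalMatrixLaw M) ∧
      Integrable (fun X => 4 / R * cutoff R X
        * (svd X).spec ((svd X).lam * coeffField n f (svd X).lam) i j) (normalMatrixLaw M) ∧
      ∫ X, ((X - M)ᵀ * (X * (svd X).spec (coeffField n f (svd X).lam))) i j * cutoff R X ^ 2
          ∂(normalMatrixLaw M)
        = ∫ X, (svd X).spec (coeffDiv n f (svd X).lam) i j * cutoff R X ^ 2 ∂(normalMatrixLaw M)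
          - ∫ X, 4 / R * cutoff R X * (svd X).spec ((svd X).lam * coeffField n f (svd X).lam) i j
          ∂(normalMatrixLaw M) := by
  obtain ⟨s, h⟩ := exists_isSignApprox hR
  obtain ⟨A, B, hAB⟩ := exists_abs_pairDiv_le hn f h
  obtain ⟨K, hK0, hK⟩ := exists_abs_eval_pairPoly_le n p f h
  have hinj := ae_lam_injective hn svd M
  have hF := fun m => isSpectralField_pair n (p := p) f (s m)
  have hφ : ∀ m X, cutoff R X ≠ 0 → ∀ k,
      |(pairPoly n f (s m) (svd X).lam).eval ((svd X).lam k)| ≤ K := fun m X hX k =>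
    hK _ (svd X).lam_nonneg ((svd X).lam_lt_of_cutoff_ne_zero hR hX) m k
  -- Dominates the divergence: integrable by Fatou's lemma for f = 1, with the factor p coming from
  -- the passage from spectra to entries.
  set G : Matrix (Fin n) (Fin p) ℝ → ℝ := fun X =>
    p * (A * cutoff R X ^ 2 + B * ((∑ k, coeffDiv n 1 (svd X).lam k) * cutoff R X ^ 2)) with hG
  have hGi : Integrable G (normalMatrixLaw M) := by
    have h1 : Integrable (fun X : Matrix (Fin n) (Fin p) ℝ => A * cutoff R X ^ 2)
        (normalMatrixLaw M) :=
      integrable_of_cutoff hR M (continuous_const.mul ((continuous_cutoff R).pow 2))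
        fun X hX => by simp [hX]
    exact (h1.add ((integrable_sum_coeffDiv_one hn svd M hR).const_mul B)).const_mul _
  have hGb : ∀ m, ∀ᵐ X ∂(normalMatrixLaw M),
      ‖(svd X).spec (pairDiv n f (s m) (svd X).lam) i j * cutoff R X ^ 2‖ ≤ G X := by
    intro m
    filter_upwards [hinj] with X hi
    by_cases hc : cutoff R X = 0
    · simp [hG, hc]
    rw [Real.norm_eq_abs, abs_mul, abs_of_nonneg (sq_nonneg (cutoff R X))]
    have h1 : |(svd X).spec (pairDiv n f (s m) (svd X).lam) i j|
        ≤ p * (A + B * ∑ k, coeffDiv n 1 (svd X).lam k) := by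
      refine ((svd X).abs_spec_apply_le _ i j).trans ((Finset.sum_le_sum fun k _ =>
        hAB _ (svd X).lam_nonneg ((svd X).lam_lt_of_cutoff_ne_zero hR hc) (svd X).lam_antitone hi
          m k).trans ?_)
      simp [mul_add]
    refine (mul_le_mul_of_nonneg_right h1 (sq_nonneg _)).trans (le_of_eq ?_)
    simp only [hG]
    ring
  have hlim1 : ∀ᵐ X ∂(normalMatrixLaw M), Filter.Tendsto
      (fun m => (svd X).spec (pairDiv n f (s m) (svd X).lam) i j * cutoff R X ^ 2) Filter.atTop
      (nhds ((svd X).spec (coeffDiv n f (svd X).lam) i j * cutoff R X ^ 2)) := by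
    filter_upwards [hinj] with X hi
    by_cases hc : cutoff R X = 0
    · simp [hc]
    exact ((svd X).tendsto_spec_apply (fun k => tendsto_pairDiv f h (svd X).lam_nonneg
      ((svd X).lam_lt_of_cutoff_ne_zero hR hc) (svd X).lam_antitone hi k) i j).mul_const _
  have hint := fun m => integrable_divergence_mul_cutoff (hF m) svd M hR i j
  have T1 := tendsto_integral_of_dominated_convergence G (fun m => (hint m).aestronglyMeasurable)
    hGi hGb hlim1
  have hbd : ∀ m, Integrable (fun X => 4 / R * cutoff R X * (svd X).spec ((svd X).lam
      * fun k => (pairPoly n f (s m) (svd X).lam).eval ((svd X).lam k)) i j)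
      (normalMatrixLaw M) := fun m =>
    integrable_of_cutoff hR M ((continuous_const.mul (continuous_cutoff R)).mul
      ((hF m).continuous_gram svd i j)) fun X hX => by simp [hX]
  have hlim2 : ∀ᵐ X ∂(normalMatrixLaw M), Filter.Tendsto (fun m => 4 / R * cutoff R X
      * (svd X).spec ((svd X).lam * fun k => (pairPoly n f (s m) (svd X).lam).eval
        ((svd X).lam k)) i j) Filter.atTop (nhds (4 / R * cutoff R X
      * (svd X).spec ((svd X).lam * coeffField n f (svd X).lam) i j)) := by
    filter_upwards [hinj] with X hi
    by_cases hc : cutoff R X = 0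
    · simp [hc]
    exact ((svd X).tendsto_spec_apply (fun k =>
      (tendsto_eval_pairPoly f h hR (svd X) hc hi k).const_mul _) i j).const_mul _
  have hlim3 : ∀ᵐ X ∂(normalMatrixLaw M), Filter.Tendsto (fun m => ((X - M)ᵀ * (X * (svd X).spec
      fun k => (pairPoly n f (s m) (svd X).lam).eval ((svd X).lam k))) i j * cutoff R X ^ 2)
      Filter.atTop (nhds (((X - M)ᵀ * (X * (svd X).spec (coeffField n f (svd X).lam))) i j
        * cutoff R X ^ 2)) := by
    filter_upwards [hinj] with X hi
    by_cases hc : cutoff R X = 0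
    · simp [hc]
    exact ((svd X).tendsto_inner M (fun k =>
      tendsto_eval_pairPoly f h hR (svd X) hc hi k) i j).mul_const _
  have hb2 : ∀ m, ∀ᵐ X ∂(normalMatrixLaw M), ‖4 / R * cutoff R X * (svd X).spec ((svd X).lam
      * fun k => (pairPoly n f (s m) (svd X).lam).eval ((svd X).lam k)) i j‖
      ≤ 4 / R * (p * (R * |K|)) := fun m => Filter.Eventually.of_forall fun X =>
    abs_boundary_le hR (svd X) (hφ m X) i j
  have hb3 : ∀ m, ∀ᵐ X ∂(normalMatrixLaw M), ‖((X - M)ᵀ * (X * (svd X).spec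
      fun k => (pairPoly n f (s m) (svd X).lam).eval ((svd X).lam k))) i j * cutoff R X ^ 2‖
      ≤ (∑ l, |((X - M)ᵀ * X) i l|) * (p * K) * cutoff R X ^ 2 := fun m =>
    Filter.Eventually.of_forall fun X => abs_inner_mul_cutoff_le (svd X) M (hφ m X) i j
  have hm3 : ∀ m, AEStronglyMeasurable (fun X => ((X - M)ᵀ * (X * (svd X).spec
      fun k => (pairPoly n f (s m) (svd X).lam).eval ((svd X).lam k))) i j * cutoff R X ^ 2)
      (normalMatrixLaw M) := fun m => (((hF m).continuous_inner svd M i j).mul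
      ((continuous_cutoff R).pow 2)).aestronglyMeasurable
  have T2 := tendsto_integral_of_dominated_convergence (fun _ => 4 / R * (p * (R * |K|)))
    (fun m => (hbd m).aestronglyMeasurable) (integrable_const _) hb2 hlim2
  have T3 := tendsto_integral_of_dominated_convergence _ hm3
    (integrable_inner_bound hR M i (p * K)) hb3 hlim3
  have T4 := T1.sub T2
  have heq : ∀ m, ∫ X, ((X - M)ᵀ * (X * (svd X).spec
      fun k => (pairPoly n f (s m) (svd X).lam).eval ((svd X).lam k))) i j * cutoff R X ^ 2
      ∂(normalMatrixLaw M) = ∫ X, (svd X).spec (pairDiv n f (s m) (svd X).lam) i j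
        * cutoff R X ^ 2 ∂(normalMatrixLaw M) - ∫ X, 4 / R * cutoff R X * (svd X).spec
        ((svd X).lam * fun k => (pairPoly n f (s m) (svd X).lam).eval ((svd X).lam k)) i j
        ∂(normalMatrixLaw M) := by
    intro m
    rw [(hF m).integral_eq svd M hR i j, integral_sub (hint m) (hbd m)]
  rw [funext heq] at T3
  refine ⟨?_, ?_, ?_, tendsto_nhds_unique T3 T4⟩
  · refine hGi.mono' (aestronglyMeasurable_of_tendsto_ae _
      (fun m => (hint m).aestronglyMeasurable) hlim1) ?_
    filter_upwards [hlim1, ae_all_iff.2 hGb] with X h1 h2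
    exact le_of_tendsto' h1.norm h2
  · refine (integrable_inner_bound hR M i (p * K)).mono'
      (aestronglyMeasurable_of_tendsto_ae _ hm3 hlim3) ?_
    filter_upwards [hlim3, ae_all_iff.2 hb3] with X h1 h2
    exact le_of_tendsto' h1.norm h2
  · refine (integrable_const (4 / R * (p * (R * |K|)))).mono' (aestronglyMeasurable_of_tendsto_ae _
      (fun m => (hbd m).aestronglyMeasurable) hlim2) ?_
    filter_upwards [hlim2, ae_all_iff.2 hb2] with X h1 h2
    exact le_of_tendsto' h1.norm h2

end SignLimit

/-! ### Polynomial approximations of 1/x -/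

/-- Polynomials that approximate `1 / x` on `(0, ∞)`, controlled on `[0, j + 1]`. -/
structure IsInvApprox (r : ℕ → Polynomial ℝ) : Prop where
  nonneg : ∀ (j : ℕ) (x : ℝ), 0 ≤ x → x ≤ (j : ℝ) + 1 → 0 ≤ (r j).eval x
  mul_le_one : ∀ (j : ℕ) (x : ℝ), 0 ≤ x → x ≤ (j : ℝ) + 1 → x * (r j).eval x ≤ 1
  deriv_nonneg : ∀ (j : ℕ) (x : ℝ), 0 ≤ x → x ≤ (j : ℝ) + 1 →
    0 ≤ (r j).eval x + x * (r j).derivative.eval x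
  mul_deriv_le_one : ∀ (j : ℕ) (x : ℝ), 0 ≤ x → x ≤ (j : ℝ) + 1 →
    x * ((r j).eval x + x * (r j).derivative.eval x) ≤ 1
  tendsto_inv : ∀ x, 0 < x → Filter.Tendsto (fun j => (r j).eval x) Filter.atTop (nhds (1 / x))
  tendsto_deriv : ∀ x, 0 < x → Filter.Tendsto
    (fun j => (r j).eval x + x * (r j).derivative.eval x) Filter.atTop (nhds 0)

/-- Multiplied by 1 - y it reads (N + 1) y^N (1 - y) ≤ 1 - y^(N+1), the source of both the decay and
the derivative bound for the approximations. -/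
theorem natCast_mul_pow_le_geom_sum {y : ℝ} (h0 : 0 ≤ y) (h1 : y ≤ 1) (N : ℕ) :
    (N + 1 : ℝ) * y ^ N ≤ ∑ i ∈ Finset.range (N + 1), y ^ i := by
  have : ∑ _i ∈ Finset.range (N + 1), y ^ N ≤ ∑ i ∈ Finset.range (N + 1), y ^ i :=
    Finset.sum_le_sum fun i hi => pow_le_pow_of_le_one h0 h1 (by
      have := Finset.mem_range.1 hi
      omega)
  simpa using this

theorem exists_isInvApprox : ∃ r, IsInvApprox r := by
  -- The degree is 2R²: with y = 1 - x/R one has y^(R²) ≤ 1/(Rx), and its square still beats the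
  -- factor (N + 1)/R ≤ 3R in the derivative of x r(x).
  set N : ℕ → ℕ := fun j => 2 * (j + 1) ^ 2 with hN
  set R : ℕ → ℝ := fun j => (j : ℝ) + 1 with hR
  have hR0 : ∀ j, 0 < R j := fun j => by positivity
  -- Truncated geometric series of 1/x about R, so that x r(x) = 1 - (1 - x/R)^(N+1) is explicit and
  -- increasing on [0, R].
  set r : ℕ → Polynomial ℝ := fun j => Polynomial.C (R j)⁻¹
    * ∑ i ∈ Finset.range (N j + 1), (1 - Polynomial.C (R j)⁻¹ * Polynomial.X) ^ i with hr
  have hrev : ∀ (j : ℕ) (x : ℝ), (r j).eval x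
      = (R j)⁻¹ * ∑ i ∈ Finset.range (N j + 1), (1 - (R j)⁻¹ * x) ^ i := by
    intro j x
    simp [hr, Polynomial.eval_finsetSum]
  have hXr : ∀ j, Polynomial.X * r j
      = 1 - (1 - Polynomial.C (R j)⁻¹ * Polynomial.X) ^ (N j + 1) := by
    intro j
    have := geom_sum_mul_neg (1 - Polynomial.C (R j)⁻¹ * Polynomial.X) (N j + 1)
    rw [← this]
    simp only [hr]
    ring
  have hρ : ∀ (j : ℕ) (x : ℝ), x * (r j).eval x = 1 - (1 - (R j)⁻¹ * x) ^ (N j + 1) := by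
    intro j x
    simpa using congrArg (Polynomial.eval x) (hXr j)
  have hρ' : ∀ (j : ℕ) (x : ℝ), (r j).eval x + x * (r j).derivative.eval x
      = (N j + 1) * (R j)⁻¹ * (1 - (R j)⁻¹ * x) ^ N j := by
    intro j x
    have h1 : (Polynomial.X * r j).derivative.eval x
        = (r j).eval x + x * (r j).derivative.eval x := by simp
    rw [← h1, hXr]
    simp [Polynomial.derivative_pow]
    ring
  have hy : ∀ (j : ℕ) (x : ℝ), 0 ≤ x → x ≤ (j : ℝ) + 1 → 0 ≤ 1 - (R j)⁻¹ * x ∧ 1 - (R j)⁻¹ * x ≤ 1 := by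
    intro j x h0 h1
    have h2 : (R j)⁻¹ * x ≤ 1 := by
      rw [inv_mul_le_iff₀ (hR0 j)]
      simpa [hR] using h1
    have h3 : 0 ≤ (R j)⁻¹ * x := mul_nonneg (inv_nonneg.2 (hR0 j).le) h0
    constructor <;> linarith
  have hpow : ∀ (j : ℕ) (x : ℝ), 0 < x → x ≤ (j : ℝ) + 1 → (1 - (R j)⁻¹ * x) ^ N j ≤ 1 / (R j * x) ^ 2 := by
    intro j x h0 h1
    obtain ⟨hy0, hy1⟩ := hy j x h0.le h1
    have hz : (1 - (R j)⁻¹ * x) ^ ((j + 1) ^ 2) ≤ 1 / (R j * x) := by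
      have hR1 := hR0 j
      have h3 := natCast_mul_pow_le_geom_sum hy0 hy1 ((j + 1) ^ 2)
      have h4 := geom_sum_mul_neg (1 - (R j)⁻¹ * x) ((j + 1) ^ 2 + 1)
      rw [sub_sub_cancel] at h4
      have h5 : 0 < (R j)⁻¹ * x := by positivity
      have h6 : (((j + 1) ^ 2 : ℕ) : ℝ) = R j ^ 2 := by simp [hR]
      rw [h6] at h3
      have h7 := mul_le_mul_of_nonneg_right h3 h5.le
      rw [h4] at h7
      have h8 : 0 ≤ (1 - (R j)⁻¹ * x) ^ ((j + 1) ^ 2 + 1) := pow_nonneg hy0 _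
      have h9 : 0 ≤ (1 - (R j)⁻¹ * x) ^ ((j + 1) ^ 2) := pow_nonneg hy0 _
      rw [le_div_iff₀ (by positivity)]
      have h10 : R j ^ 2 * ((R j)⁻¹ * x) = R j * x := by field_simp
      nlinarith [mul_nonneg h9 h5.le]
    have e : N j = (j + 1) ^ 2 * 2 := by simp only [hN]; ring
    rw [e, pow_mul]
    calc ((1 - (R j)⁻¹ * x) ^ ((j + 1) ^ 2)) ^ 2 ≤ (1 / (R j * x)) ^ 2 := by
          gcongr
      _ = 1 / (R j * x) ^ 2 := by rw [div_pow, one_pow]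
  have hinvR : Filter.Tendsto (fun j => (R j)⁻¹) Filter.atTop (nhds 0) :=
    (Filter.tendsto_atTop_add_const_right _ _ tendsto_natCast_atTop_atTop).inv_tendsto_atTop
  have hev : ∀ x : ℝ, ∀ᶠ j : ℕ in Filter.atTop, x ≤ (j : ℝ) + 1 := by
    intro x
    filter_upwards [Filter.eventually_ge_atTop ⌈x⌉₊] with j hj
    have : x ≤ j := (Nat.le_ceil x).trans (by exact_mod_cast hj)
    linarith
  have htd : ∀ x, 0 < x → Filter.Tendsto
      (fun j => (r j).eval x + x * (r j).derivative.eval x) Filter.atTop (nhds 0) := by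
    intro x hx
    have hlim : Filter.Tendsto (fun j => 3 / x ^ 2 * (R j)⁻¹) Filter.atTop (nhds 0) := by
      simpa using hinvR.const_mul (3 / x ^ 2)
    refine tendsto_of_tendsto_of_tendsto_of_le_of_le' tendsto_const_nhds hlim ?_ ?_
    · filter_upwards [hev x] with j hj
      rw [hρ']
      have := (hy j x hx.le hj).1
      have := hR0 j
      positivity
    · filter_upwards [hev x] with j hj
      have hR1 := hR0 j
      have h1 : (1 : ℝ) ≤ R j := by simp [hR]
      rw [hρ']
      have hN3 : ((N j : ℝ) + 1) ≤ 3 * R j ^ 2 := by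
        simp only [hN, hR] at h1 ⊢
        push_cast
        nlinarith
      calc ((N j : ℝ) + 1) * (R j)⁻¹ * (1 - (R j)⁻¹ * x) ^ N j
          ≤ (3 * R j ^ 2) * (R j)⁻¹ * (1 / (R j * x) ^ 2) := by
            have := hpow j x hx hj
            have := pow_nonneg (hy j x hx.le hj).1 (N j)
            gcongr
        _ = 3 / x ^ 2 * (R j)⁻¹ := by field_simp
  refine ⟨r, fun j x h0 h1 => ?_, fun j x h0 h1 => ?_, fun j x h0 h1 => ?_, fun j x h0 h1 => ?_,
    fun x hx => ?_, htd⟩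
  · rw [hrev]
    exact mul_nonneg (inv_nonneg.2 (hR0 j).le)
      (Finset.sum_nonneg fun i _ => pow_nonneg (hy j x h0 h1).1 i)
  · rw [hρ]
    have := pow_nonneg (hy j x h0 h1).1 (N j + 1)
    linarith
  · rw [hρ']
    have := (hy j x h0 h1).1
    have := hR0 j
    positivity
  · obtain ⟨hy0, hy1⟩ := hy j x h0 h1
    have h3 := natCast_mul_pow_le_geom_sum hy0 hy1 (N j)
    have h4 := geom_sum_mul_neg (1 - (R j)⁻¹ * x) (N j + 1)
    rw [sub_sub_cancel] at h4
    have h5 : 0 ≤ (R j)⁻¹ * x := mul_nonneg (inv_nonneg.2 (hR0 j).le) h0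
    have h7 := mul_le_mul_of_nonneg_right h3 h5
    rw [h4] at h7
    have h8 : 0 ≤ (1 - (R j)⁻¹ * x) ^ (N j + 1) := pow_nonneg hy0 _
    rw [hρ']
    linarith
  · have hlim : Filter.Tendsto (fun j => (1 - (1 - (R j)⁻¹ * x) ^ (N j + 1)) / x) Filter.atTop
        (nhds ((1 - 0) / x)) := by
      refine Filter.Tendsto.div_const (Filter.Tendsto.const_sub _ ?_) _
      have hz : Filter.Tendsto (fun j => 1 / x ^ 2 * ((R j)⁻¹ * (R j)⁻¹)) Filter.atTop
          (nhds 0) := by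
        have := (hinvR.mul hinvR).const_mul (1 / x ^ 2)
        rwa [mul_zero, mul_zero] at this
      refine tendsto_of_tendsto_of_tendsto_of_le_of_le' tendsto_const_nhds hz ?_ ?_
      · filter_upwards [hev x] with j hj
        exact pow_nonneg (hy j x hx.le hj).1 _
      · filter_upwards [hev x] with j hj
        obtain ⟨hy0, hy1⟩ := hy j x hx.le hj
        refine (pow_le_pow_of_le_one hy0 hy1 (Nat.le_succ (N j))).trans
          ((hpow j x hx hj).trans (le_of_eq ?_))
        have := hR0 j
        field_simp
    rw [sub_zero] at hlim
    refine hlim.congr fun j => ?_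
    rw [← hρ, mul_div_cancel_left₀ _ hx.ne']

theorem IsInvApprox.slope_nonneg {r : ℕ → Polynomial ℝ} (h : IsInvApprox r) (j : ℕ) {x y : ℝ}
    (hx : 0 ≤ x) (hxR : x ≤ (j : ℝ) + 1) (hy : 0 ≤ y) (hyR : y ≤ (j : ℝ) + 1) :
    0 ≤ (x * (r j).eval x - y * (r j).eval y) / (x - y) := by
  have key : ∀ x y : ℝ, 0 ≤ x → y ≤ (j : ℝ) + 1 → x < y →
      x * (r j).eval x ≤ y * (r j).eval y := by
    intro x y hx hy hxy
    obtain ⟨ξ, hξ, he⟩ := (Polynomial.X * r j).exists_eval_sub_eq hxy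
    have h1 := h.deriv_nonneg j ξ (hx.trans hξ.1.le) (hξ.2.le.trans hy)
    have h2 := mul_nonneg h1 (sub_pos.2 hxy).le
    simp at he
    linarith
  rcases lt_trichotomy x y with hlt | heq | hlt
  · exact div_nonneg_of_nonpos (sub_nonpos.2 (key x y hx hyR hlt)) (sub_neg.2 hlt).le
  · simp [heq]
  · exact div_nonneg (sub_nonneg.2 (key y x hy hxR hlt)) (sub_pos.2 hlt).le

/-- The spectrum `c_k (n - p - 1) / λ_k + ∑_{l ≠ k} (c_l - c_k) / (λ_l - λ_k)` of the divergence of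
Stein's shrinkage field. -/
noncomputable def steinDiv (n : ℕ) {p : ℕ} (lam : Fin p → ℝ) (k : Fin p) : ℝ :=
  steinCoeff n p k * ((n - p - 1) / lam k)
    + ∑ l ∈ Finset.univ.erase k, (steinCoeff n p l - steinCoeff n p k) / (lam l - lam k)

/-! ### Positivity and domination for the fields c_k r_j(λ_k) -/

section InvBounds

variable {n p : ℕ} {lam : Fin p → ℝ}

/-- Rewritten through g(x) = x f(x): each of the p - 1 divided differences gives up one f(λ_k), so n
becomes (n - p - 1) + 2, and 2f + 2λf' is 2g'. For f = r_j the function g is increasing with values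
in [0, 1], so every term is nonnegative; as g tends to 1 only the terms of `steinDiv` survive. -/
theorem coeffDiv_eq (f : Polynomial ℝ) (hi : Function.Injective lam) (k : Fin p) :
    coeffDiv n f lam k = steinCoeff n p k * ((n - p - 1) * f.eval (lam k)
        + 2 * (f.eval (lam k) + lam k * f.derivative.eval (lam k))
        + ∑ l ∈ Finset.univ.erase k,
          (lam l * f.eval (lam l) - lam k * f.eval (lam k)) / (lam l - lam k))
      + ∑ l ∈ Finset.univ.erase k, lam l * f.eval (lam l)
        * ((steinCoeff n p l - steinCoeff n p k) / (lam l - lam k)) := by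
  have hs : ∑ l ∈ Finset.univ.erase k,
        lam l * ((f.eval (lam l) - f.eval (lam k)) / (lam l - lam k))
      = ∑ l ∈ Finset.univ.erase k,
        (lam l * f.eval (lam l) - lam k * f.eval (lam k)) / (lam l - lam k)
        - (p - 1) * f.eval (lam k) := by
    have hc : ∑ l ∈ Finset.univ.erase k, f.eval (lam k) = ((p : ℝ) - 1) * f.eval (lam k) := by
      rw [Finset.sum_const, Finset.card_erase_of_mem (Finset.mem_univ k), Finset.card_univ,
        Fintype.card_fin, nsmul_eq_mul, Nat.cast_sub k.pos, Nat.cast_one]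
    rw [← hc, ← Finset.sum_sub_distrib]
    refine Finset.sum_congr rfl fun l hl => ?_
    have : lam l - lam k ≠ 0 := sub_ne_zero.2 fun e => Finset.ne_of_mem_erase hl (hi e)
    field_simp
    ring
  rw [coeffDiv, hs]
  ring

theorem steinCoeff_slope_nonneg (ha : Antitone lam) (hi : Function.Injective lam) {k l : Fin p}
    (h : l ≠ k) : 0 ≤ (steinCoeff n p l - steinCoeff n p k) / (lam l - lam k) :=
  le_trans (by positivity) (two_div_abs_le_steinCoeff_slope ha hi h)

theorem natCast_sub_sub_one_nonneg (hn : p + 1 ≤ n) : (0 : ℝ) ≤ n - p - 1 := by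
  have : (p : ℝ) + 1 ≤ n := by exact_mod_cast hn
  linarith

theorem steinDiv_nonneg (hn : p + 1 ≤ n) (hpos : ∀ k, 0 < lam k) (ha : Antitone lam)
    (hi : Function.Injective lam) (k : Fin p) : 0 ≤ steinDiv n lam k :=
  add_nonneg (mul_nonneg (steinCoeff_nonneg hn k)
      (div_nonneg (natCast_sub_sub_one_nonneg hn) (hpos k).le))
    (Finset.sum_nonneg fun _ hl => steinCoeff_slope_nonneg ha hi (Finset.ne_of_mem_erase hl))

theorem steinCoeff_slope_le_sum_steinDiv (hn : p + 1 ≤ n) (hpos : ∀ k, 0 < lam k)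
    (ha : Antitone lam) (hi : Function.Injective lam) {k l : Fin p} (h : l ≠ k) :
    (steinCoeff n p l - steinCoeff n p k) / (lam l - lam k) ≤ ∑ k, steinDiv n lam k := by
  refine le_trans ?_ (Finset.single_le_sum (f := steinDiv n lam)
    (fun k _ => steinDiv_nonneg hn hpos ha hi k) (Finset.mem_univ k))
  have h1 := mul_nonneg (steinCoeff_nonneg hn k)
      (div_nonneg (natCast_sub_sub_one_nonneg hn) (hpos k).le)
  have h2 := Finset.single_le_sum
    (f := fun l => (steinCoeff n p l - steinCoeff n p k) / (lam l - lam k))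
    (fun l hl => steinCoeff_slope_nonneg (n := n) ha hi (Finset.ne_of_mem_erase hl))
    (Finset.mem_erase.2 ⟨h, Finset.mem_univ l⟩)
  unfold steinDiv
  linarith

namespace IsInvApprox

variable {r : ℕ → Polynomial ℝ}

theorem tendsto_mul (h : IsInvApprox r) {x : ℝ} (hx : 0 < x) :
    Filter.Tendsto (fun j => x * (r j).eval x) Filter.atTop (nhds 1) := by
  have := (h.tendsto_inv x hx).const_mul x
  rwa [mul_one_div_cancel hx.ne'] at this

theorem tendsto_coeffDiv (h : IsInvApprox r) (hpos : ∀ k, 0 < lam k)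
    (hi : Function.Injective lam) (k : Fin p) :
    Filter.Tendsto (fun j => coeffDiv n (r j) lam k) Filter.atTop (nhds (steinDiv n lam k)) := by
  have h1 := ((h.tendsto_inv _ (hpos k)).const_mul ((n : ℝ) - p - 1)).add
    ((h.tendsto_deriv _ (hpos k)).const_mul 2)
  have h2 := tendsto_finsetSum (Finset.univ.erase k) fun l _ =>
    ((h.tendsto_mul (hpos l)).sub (h.tendsto_mul (hpos k))).div_const (lam l - lam k)
  have h3 := tendsto_finsetSum (Finset.univ.erase k) fun l _ =>
    (h.tendsto_mul (hpos l)).mul_const ((steinCoeff n p l - steinCoeff n p k) / (lam l - lam k))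
  have h4 := ((h1.add h2).const_mul (steinCoeff n p k)).add h3
  simp only [coeffDiv_eq _ hi k]
  convert! h4 using 2
  simp [steinDiv, div_eq_mul_inv]

variable {j : ℕ}

theorem coeff_mul_eval_nonneg (h : IsInvApprox r) (hn : p + 1 ≤ n) (h0 : ∀ k, 0 ≤ lam k)
    (hR : ∀ k, lam k ≤ (j : ℝ) + 1) (k : Fin p) : 0 ≤ steinCoeff n p k * (r j).eval (lam k) :=
  mul_nonneg (steinCoeff_nonneg hn k) (h.nonneg j _ (h0 k) (hR k))

theorem le_coeffDiv (h : IsInvApprox r) (hn : p + 1 ≤ n) (h0 : ∀ k, 0 ≤ lam k)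
    (hR : ∀ k, lam k ≤ (j : ℝ) + 1) (hi : Function.Injective lam) (k : Fin p) :
    steinCoeff n p k * ((n - p - 1) * (r j).eval (lam k))
      + ∑ l ∈ Finset.univ.erase k, lam l * (r j).eval (lam l)
        * ((steinCoeff n p l - steinCoeff n p k) / (lam l - lam k)) ≤ coeffDiv n (r j) lam k := by
  rw [coeffDiv_eq _ hi]
  have h1 := h.deriv_nonneg j _ (h0 k) (hR k)
  have h2 : 0 ≤ ∑ l ∈ Finset.univ.erase k,
      (lam l * (r j).eval (lam l) - lam k * (r j).eval (lam k)) / (lam l - lam k) :=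
    Finset.sum_nonneg fun l _ => h.slope_nonneg j (h0 l) (hR l) (h0 k) (hR k)
  have := steinCoeff_nonneg hn k
  gcongr
  linarith

theorem weight_nonneg (h : IsInvApprox r) (h0 : ∀ k, 0 ≤ lam k)
    (hR : ∀ k, lam k ≤ (j : ℝ) + 1) (ha : Antitone lam) (hi : Function.Injective lam) {k l : Fin p}
    (hl : l ≠ k) : 0 ≤ lam l * (r j).eval (lam l)
        * ((steinCoeff n p l - steinCoeff n p k) / (lam l - lam k)) :=
  mul_nonneg (mul_nonneg (h0 l) (h.nonneg j _ (h0 l) (hR l)))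
    (steinCoeff_slope_nonneg ha hi hl)

theorem coeffDiv_nonneg (h : IsInvApprox r) (hn : p + 1 ≤ n) (h0 : ∀ k, 0 ≤ lam k)
    (hR : ∀ k, lam k ≤ (j : ℝ) + 1) (ha : Antitone lam) (hi : Function.Injective lam) (k : Fin p) :
    0 ≤ coeffDiv n (r j) lam k := by
  refine le_trans (add_nonneg ?_ ?_) (h.le_coeffDiv hn h0 hR hi k)
  · exact mul_nonneg (steinCoeff_nonneg hn k) (mul_nonneg (natCast_sub_sub_one_nonneg hn)
      (h.nonneg j _ (h0 k) (hR k)))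
  · exact Finset.sum_nonneg fun l hl => h.weight_nonneg (n := n) h0 hR ha hi (Finset.ne_of_mem_erase hl)

/-- For n ≥ p + 2 this is the first term of the k-th divergence, with factor n - p - 1 ≥ 1. For n =
p + 1 that factor vanishes and the bound comes from the last index instead. -/
theorem coeff_mul_eval_le_sum_coeffDiv (h : IsInvApprox r) (hn : p + 1 ≤ n) (h0 : ∀ k, 0 ≤ lam k)
    (hR : ∀ k, lam k ≤ (j : ℝ) + 1) (ha : Antitone lam)
    (hi : Function.Injective lam) (k : Fin p) :
    steinCoeff n p k * (r j).eval (lam k) ≤ ∑ k, coeffDiv n (r j) lam k := by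
  have hS : ∀ q, coeffDiv n (r j) lam q ≤ ∑ k, coeffDiv n (r j) lam k := fun q =>
    Finset.single_le_sum (fun k _ => h.coeffDiv_nonneg hn h0 hR ha hi k) (Finset.mem_univ q)
  have hle := fun q => (h.le_coeffDiv hn h0 hR hi q).trans (hS q)
  have hw := fun q => Finset.sum_nonneg fun l (hl : l ∈ Finset.univ.erase q) =>
    h.weight_nonneg (n := n) h0 hR ha hi (Finset.ne_of_mem_erase hl)
  have hc := h.coeff_mul_eval_nonneg hn h0 hR k
  rcases hn.lt_or_eq with hlt | heq
  · have h1 : (p : ℝ) + 2 ≤ n := by exact_mod_cast hlt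
    have h2 := hle k
    have h3 := hw k
    nlinarith
  -- Here the last coefficient c_q is 0, so the q-th divergence contains c_k r(λ_k) λ_k/(λ_k - λ_q),
  -- and λ_k/(λ_k - λ_q) ≥ 1.
  · obtain ⟨q, hq⟩ : ∃ q : Fin p, q.val + 1 = p :=
      ⟨⟨p - 1, by have := k.pos; omega⟩, by have := k.pos; simp; omega⟩
    have hq0 : steinCoeff n p q = 0 := by
      have e1 : ((q.val : ℝ)) + 1 = p := by exact_mod_cast hq
      have e2 : (n : ℝ) = p + 1 := by exact_mod_cast heq.symm
      rw [steinCoeff, e1, e2]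
      ring
    by_cases hk : k = q
    · rw [hk, hq0, zero_mul, ← zero_mul ((n - p - 1) * (r j).eval (lam q)), ← hq0]
      linarith [hle q, hw q]
    have h1 := hle q
    rw [hq0, zero_mul, zero_add] at h1
    refine le_trans ?_ h1
    refine le_trans ?_ (Finset.single_le_sum (f := fun l => lam l * (r j).eval (lam l)
        * ((steinCoeff n p l - 0) / (lam l - lam q))) (fun l hl => ?_)
        (Finset.mem_erase.2 ⟨hk, Finset.mem_univ k⟩))
    · have hkq : k < q := lt_of_le_of_ne (Fin.le_def.2 (by have := k.2; omega)) hk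
      have h2 : 0 < lam k - lam q := sub_pos.2 ((ha hkq.le).lt_of_ne fun e => hk (hi e).symm)
      have h3 : 1 ≤ lam k / (lam k - lam q) := by
        rw [le_div_iff₀ h2]
        linarith [h0 q]
      have e : lam k * (r j).eval (lam k) * ((steinCoeff n p k - 0) / (lam k - lam q))
          = lam k / (lam k - lam q) * (steinCoeff n p k * (r j).eval (lam k)) := by ring
      simp only [e]
      nlinarith
    · have := h.weight_nonneg (n := n) h0 hR ha hi (Finset.ne_of_mem_erase hl)
      rwa [hq0] at this

/-- The spectrum of `(X Φ)ᵀ (X Φ)` for the field `Φ` with spectrum `c_k f(λ_k)`. -/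
theorem lam_mul_coeffField_sq_le (h : IsInvApprox r) (hn : p + 1 ≤ n) (h0 : ∀ k, 0 ≤ lam k)
    (hR : ∀ k, lam k ≤ (j : ℝ) + 1) (k : Fin p) :
    lam k * coeffField n (r j) lam k ^ 2
      ≤ (n + p) * (steinCoeff n p k * (r j).eval (lam k)) := by
  have h1 := h.mul_le_one j _ (h0 k) (hR k)
  have h2 := h.coeff_mul_eval_nonneg hn h0 hR k
  have h3 := steinCoeff_le (n := n) k
  have h4 := steinCoeff_nonneg hn k
  calc lam k * coeffField n (r j) lam k ^ 2
      = steinCoeff n p k * (lam k * (r j).eval (lam k))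
        * (steinCoeff n p k * (r j).eval (lam k)) := by
        rw [coeffField]
        ring
    _ ≤ (n + p) * 1 * (steinCoeff n p k * (r j).eval (lam k)) := by
        have := mul_nonneg (h0 k) (h.nonneg j _ (h0 k) (hR k))
        gcongr
    _ = _ := by ring

theorem abs_lam_mul_coeffField_le (h : IsInvApprox r) (hn : p + 1 ≤ n) (h0 : ∀ k, 0 ≤ lam k)
    (hR : ∀ k, lam k ≤ (j : ℝ) + 1) (k : Fin p) :
    |lam k * coeffField n (r j) lam k| ≤ n + p := by
  have h1 := h.mul_le_one j _ (h0 k) (hR k)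
  have h2 := mul_nonneg (h0 k) (h.nonneg j _ (h0 k) (hR k))
  have h3 := steinCoeff_le (n := n) k
  have h4 := steinCoeff_nonneg hn k
  have e : lam k * coeffField n (r j) lam k
      = steinCoeff n p k * (lam k * (r j).eval (lam k)) := by
    rw [coeffField]
    ring
  rw [e, abs_of_nonneg (mul_nonneg h4 h2)]
  calc _ ≤ ((n : ℝ) + p) * 1 := by gcongr
    _ = _ := mul_one _

theorem eval_le (h : IsInvApprox r) {x : ℝ} (hx : 0 < x) (hxR : x ≤ (j : ℝ) + 1) :
    (r j).eval x ≤ 1 / x := by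
  rw [le_div_iff₀ hx, mul_comm]
  exact h.mul_le_one j x hx.le hxR

end IsInvApprox

theorem steinCoeff_div_le_sum_steinDiv (hn : p + 1 ≤ n) (hpos : ∀ k, 0 < lam k)
    (ha : Antitone lam) (hi : Function.Injective lam) (k : Fin p) :
    steinCoeff n p k * (1 / lam k) ≤ ∑ k, steinDiv n lam k := by
  obtain ⟨r, h⟩ := exists_isInvApprox
  refine le_of_tendsto_of_tendsto ((h.tendsto_inv _ (hpos k)).const_mul (steinCoeff n p k))
    (tendsto_finsetSum _ fun k _ => h.tendsto_coeffDiv hpos hi k) ?_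
  have hev : ∀ k, ∀ᶠ j : ℕ in Filter.atTop, lam k ≤ (j : ℝ) + 1 := by
    intro k
    filter_upwards [Filter.eventually_ge_atTop ⌈lam k⌉₊] with j hj
    have : lam k ≤ j := (Nat.le_ceil _).trans (by exact_mod_cast hj)
    linarith
  filter_upwards [Filter.eventually_all.2 hev] with j hj
  exact h.coeff_mul_eval_le_sum_coeffDiv hn (fun k => (hpos k).le) hj ha hi k

/-- The limit divergence dominates all approximants: r(x) and the derivative of x r(x) are at most
1/x, slopes of x r(x) are at most 2/|λ_l - λ_k|, and both singularities are controlled by ∑ₖ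
`steinDiv`. -/
theorem IsInvApprox.coeffDiv_le {r : ℕ → Polynomial ℝ} {j : ℕ} (h : IsInvApprox r)
    (hn : p + 1 ≤ n) (hpos : ∀ k, 0 < lam k) (hR : ∀ k, lam k ≤ (j : ℝ) + 1) (ha : Antitone lam)
    (hi : Function.Injective lam) (k : Fin p) :
    coeffDiv n (r j) lam k ≤ (n + 2 + p * (n + p) + p) * ∑ k, steinDiv n lam k := by
  set H := ∑ k, steinDiv n lam k with hH
  have hH0 : 0 ≤ H := Finset.sum_nonneg fun k _ => steinDiv_nonneg hn hpos ha hi k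
  have hc := steinCoeff_nonneg hn k
  have hcH := steinCoeff_div_le_sum_steinDiv hn hpos ha hi k
  have hn0 := natCast_sub_sub_one_nonneg hn
  have hcard : ∀ {F : Fin p → ℝ} {B : ℝ}, 0 ≤ B → (∀ l, l ≠ k → F l ≤ B) →
      ∑ l ∈ Finset.univ.erase k, F l ≤ p * B := by
    intro F B hB hF
    refine (Finset.sum_le_card_nsmul _ _ B fun l hl => hF l (Finset.ne_of_mem_erase hl)).trans ?_
    rw [nsmul_eq_mul]
    gcongr
    exact (Finset.card_le_univ _).trans (by simp)
  have hρ : ∀ l, 0 ≤ lam l * (r j).eval (lam l) ∧ lam l * (r j).eval (lam l) ≤ 1 := fun l =>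
    ⟨mul_nonneg (hpos l).le (h.nonneg j _ (hpos l).le (hR l)),
      h.mul_le_one j _ (hpos l).le (hR l)⟩
  have b1 : steinCoeff n p k * ((n - p - 1) * (r j).eval (lam k)) ≤ n * H := by
    have h1 := h.eval_le (hpos k) (hR k)
    have h2 := h.nonneg j _ (hpos k).le (hR k)
    calc steinCoeff n p k * ((n - p - 1) * (r j).eval (lam k))
        = ((n : ℝ) - p - 1) * (steinCoeff n p k * (r j).eval (lam k)) := by ring
      _ ≤ n * (steinCoeff n p k * (1 / lam k)) := by
          gcongr
          have : (0 : ℝ) ≤ p := by positivity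
          linarith
      _ ≤ n * H := by gcongr
  have b2 : steinCoeff n p k * (2 * ((r j).eval (lam k) + lam k * (r j).derivative.eval (lam k)))
      ≤ 2 * H := by
    have h1 : (r j).eval (lam k) + lam k * (r j).derivative.eval (lam k) ≤ 1 / lam k := by
      rw [le_div_iff₀ (hpos k), mul_comm]
      exact h.mul_deriv_le_one j _ (hpos k).le (hR k)
    calc steinCoeff n p k * (2 * ((r j).eval (lam k) + lam k * (r j).derivative.eval (lam k)))
        ≤ steinCoeff n p k * (2 * (1 / lam k)) := by gcongr
      _ = 2 * (steinCoeff n p k * (1 / lam k)) := by ring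
      _ ≤ 2 * H := by gcongr
  have b3 : steinCoeff n p k * ∑ l ∈ Finset.univ.erase k,
      (lam l * (r j).eval (lam l) - lam k * (r j).eval (lam k)) / (lam l - lam k)
      ≤ (n + p) * (p * H) := by
    have h3 : ∑ l ∈ Finset.univ.erase k,
        (lam l * (r j).eval (lam l) - lam k * (r j).eval (lam k)) / (lam l - lam k) ≤ p * H := by
      refine hcard hH0 fun l hl => ?_
      have hne : 0 < |lam l - lam k| := abs_pos.2 (sub_ne_zero.2 fun e => hl (hi e))
      refine (le_abs_self _).trans ?_
      rw [abs_div]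
      calc |lam l * (r j).eval (lam l) - lam k * (r j).eval (lam k)| / |lam l - lam k|
          ≤ 2 / |lam l - lam k| := by
            gcongr
            have := hρ l
            have := hρ k
            exact abs_le.2 ⟨by linarith, by linarith⟩
        _ ≤ _ := (two_div_abs_le_steinCoeff_slope ha hi hl).trans
            (steinCoeff_slope_le_sum_steinDiv hn hpos ha hi hl)
    exact mul_le_mul (steinCoeff_le k) h3
      (Finset.sum_nonneg fun l _ => h.slope_nonneg j (hpos l).le (hR l) (hpos k).le (hR k))
      (by positivity)
  have b4 : ∑ l ∈ Finset.univ.erase k, lam l * (r j).eval (lam l)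
      * ((steinCoeff n p l - steinCoeff n p k) / (lam l - lam k)) ≤ p * H := by
    refine hcard hH0 fun l hl => ?_
    have h1 := steinCoeff_slope_nonneg (n := n) ha hi hl
    refine (mul_le_of_le_one_left h1 (hρ l).2).trans
      (steinCoeff_slope_le_sum_steinDiv hn hpos ha hi hl)
  rw [coeffDiv_eq _ hi]
  nlinarith

end InvBounds

/-! ### Integrability of the total divergence by absorption -/

section InvLimit

variable {n p : ℕ}

theorem ThinSVD.transpose_mul_self_spec {X : Matrix (Fin n) (Fin p) ℝ} (T : ThinSVD X)
    (φ : Fin p → ℝ) :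
    (X * T.spec φ)ᵀ * (X * T.spec φ) = T.spec fun k => T.lam k * φ k ^ 2 := by
  rw [Matrix.transpose_mul, T.spec_transpose, Matrix.mul_assoc, ← Matrix.mul_assoc Xᵀ, T.gram,
    T.spec_mul, T.spec_mul]
  congr 1
  ext k
  simp only [Pi.mul_apply]
  ring

/-- Young's inequality with a free weight L, so that the quadratic part of the field can be given a
small coefficient and absorbed. -/
theorem ThinSVD.abs_inner_le_add {X : Matrix (Fin n) (Fin p) ℝ} (T : ThinSVD X)
    (M : Matrix (Fin n) (Fin p) ℝ) (φ : Fin p → ℝ) {L : ℝ} (hL : 0 < L) (i j : Fin p) :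
    |((X - M)ᵀ * (X * T.spec φ)) i j|
      ≤ L / 2 * ∑ a, ∑ i, (X a i - M a i) * (X a i - M a i)
        + 1 / (2 * L) * ∑ k, T.lam k * φ k ^ 2 := by
  have h1 : ∑ a, (X * T.spec φ) a j ^ 2 ≤ ∑ k, T.lam k * φ k ^ 2 := by
    have h2 := congrFun (congrFun (T.transpose_mul_self_spec φ) j) j
    rw [Matrix.mul_apply] at h2
    simp only [Matrix.transpose_apply, ← pow_two] at h2
    rw [h2]
    refine (le_abs_self _).trans ((T.abs_spec_apply_le _ j j).trans (le_of_eq ?_))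
    exact Finset.sum_congr rfl fun k _ =>
      abs_of_nonneg (mul_nonneg (T.lam_nonneg k) (sq_nonneg _))
  have h3 : ∀ a, (X a i - M a i) * (X a i - M a i)
      ≤ ∑ i, (X a i - M a i) * (X a i - M a i) := fun a =>
    Finset.single_le_sum (f := fun i => (X a i - M a i) * (X a i - M a i))
      (fun i _ => mul_self_nonneg _) (Finset.mem_univ i)
  have h4 : ∀ x y : ℝ, |x * y| ≤ L / 2 * (x * x) + 1 / (2 * L) * y ^ 2 := by
    intro x y
    have e : L / 2 * (x * x) + 1 / (2 * L) * y ^ 2 - |x| * |y|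
        = 1 / (2 * L) * (L * |x| - |y|) ^ 2 := by
      rw [← abs_mul_abs_self x, ← sq_abs y]
      field_simp
      ring
    have : 0 ≤ 1 / (2 * L) * (L * |x| - |y|) ^ 2 := by positivity
    rw [abs_mul]
    linarith
  rw [Matrix.mul_apply]
  refine (Finset.abs_sum_le_sum_abs _ _).trans ?_
  calc ∑ a, |(X - M)ᵀ i a * (X * T.spec φ) a j|
      ≤ ∑ a, (L / 2 * ((X a i - M a i) * (X a i - M a i))
        + 1 / (2 * L) * (X * T.spec φ) a j ^ 2) := Finset.sum_le_sum fun a _ => h4 _ _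
    _ = L / 2 * ∑ a, (X a i - M a i) * (X a i - M a i)
        + 1 / (2 * L) * ∑ a, (X * T.spec φ) a j ^ 2 := by
      rw [Finset.sum_add_distrib, Finset.mul_sum, Finset.mul_sum]
    _ ≤ _ := by
      gcongr with a
      exact h3 a

theorem integrable_sum_sub_sq (M : Matrix (Fin n) (Fin p) ℝ) :
    Integrable (fun X : Matrix (Fin n) (Fin p) ℝ => ∑ a, ∑ i, (X a i - M a i) * (X a i - M a i))
      (normalMatrixLaw M) :=
  integrable_finsetSum _ fun a _ => integrable_finsetSum _ fun i _ =>
    integrable_sub_mul_sub_normalMatrixLaw M a a i i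

theorem tendsto_cutoff (X : Matrix (Fin n) (Fin p) ℝ) :
    Filter.Tendsto (fun j : ℕ => cutoff ((j : ℝ) + 1) X) Filter.atTop (nhds 1) := by
  have h : Filter.Tendsto (fun j : ℕ => (j : ℝ) + 1) Filter.atTop Filter.atTop :=
    Filter.tendsto_atTop_add_const_right _ _ tendsto_natCast_atTop_atTop
  have h1 := (tendsto_const_nhds (x := (Xᵀ * X).trace)).div_atTop h
  have h2 := (tendsto_const_nhds (x := (0 : ℝ))).max (h1.const_sub 1)
  simpa [cutoff] using h2

theorem cutoff_sq_le_one {R : ℝ} (hR : 0 < R) (X : Matrix (Fin n) (Fin p) ℝ) :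
    cutoff R X ^ 2 ≤ 1 :=
  pow_le_one₀ (cutoff_nonneg R X) (cutoff_le_one hR X)

variable {r : ℕ → Polynomial ℝ}

/-- Since λ_k φ_k = c_k λ_k r(λ_k) stays within [0, n + p] for every radius, the boundary term is
O(1/R) and disappears in the limit. -/
theorem IsInvApprox.abs_boundary_le (h : IsInvApprox r) (hn : p + 1 ≤ n)
    {X : Matrix (Fin n) (Fin p) ℝ} (T : ThinSVD X) (m : ℕ) (i j : Fin p) :
    |4 / ((m : ℝ) + 1) * cutoff ((m : ℝ) + 1) X
      * T.spec (T.lam * coeffField n (r m) T.lam) i j| ≤ 4 / ((m : ℝ) + 1) * (p * (n + p)) := by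
  have hR : (0 : ℝ) < (m : ℝ) + 1 := by positivity
  by_cases hc : cutoff ((m : ℝ) + 1) X = 0
  · rw [hc, mul_zero, zero_mul, abs_zero]
    positivity
  have h1 : |T.spec (T.lam * coeffField n (r m) T.lam) i j| ≤ p * (n + p) := by
    refine (T.abs_spec_apply_le _ i j).trans ((Finset.sum_le_sum fun k _ =>
      h.abs_lam_mul_coeffField_le hn T.lam_nonneg
        (fun k => (T.lam_lt_of_cutoff_ne_zero hR hc k).le) k).trans ?_)
    simp [mul_add]
  rw [abs_mul, abs_mul, abs_of_nonneg (cutoff_nonneg _ X), abs_of_nonneg (by positivity)]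
  have h2 := cutoff_le_one hR X
  have h3 := cutoff_nonneg ((m : ℝ) + 1) X
  calc 4 / ((m : ℝ) + 1) * cutoff ((m : ℝ) + 1) X
        * |T.spec (T.lam * coeffField n (r m) T.lam) i j|
      ≤ 4 / ((m : ℝ) + 1) * 1 * (p * (n + p)) := by gcongr
    _ = _ := by ring

theorem IsInvApprox.sum_coeffDiv_mul_cutoff_nonneg (h : IsInvApprox r) (hn : p + 1 ≤ n)
    {X : Matrix (Fin n) (Fin p) ℝ} (T : ThinSVD X) (hi : Function.Injective T.lam) (m : ℕ) :
    0 ≤ (∑ k, coeffDiv n (r m) T.lam k) * cutoff ((m : ℝ) + 1) X ^ 2 := by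
  by_cases hc : cutoff ((m : ℝ) + 1) X = 0
  · simp [hc]
  exact mul_nonneg (Finset.sum_nonneg fun k _ => h.coeffDiv_nonneg hn T.lam_nonneg
    (fun k => (T.lam_lt_of_cutoff_ne_zero (by positivity) hc k).le) T.lam_antitone hi k)
    (sq_nonneg _)

theorem integrable_sum_coeffDiv (hn : p + 1 ≤ n) (f : Polynomial ℝ)
    (svd : ∀ X : Matrix (Fin n) (Fin p) ℝ, ThinSVD X) (M : Matrix (Fin n) (Fin p) ℝ) {R : ℝ}
    (hR : 0 < R) :
    Integrable (fun X => (∑ k, coeffDiv n f (svd X).lam k) * cutoff R X ^ 2)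
      (normalMatrixLaw M) := by
  have := integrable_finsetSum (Finset.univ : Finset (Fin p)) fun i _ =>
    (integrable_coeffDiv_and_integral_eq hn f svd M hR i i).1
  refine this.congr (Filter.Eventually.of_forall fun X => ?_)
  simp only
  rw [← Finset.sum_mul, ← (svd X).trace_spec (coeffDiv n f (svd X).lam)]
  rfl

/-- Self-bounding: Stein's identity bounds the integral A of the total divergence by E‖X - M‖², a
boundary term and a multiple of the integral of ∑ₖ λ_k φ_k². The last sum is at most p(n + p) times
the total divergence, so it is absorbed into A, which is already known to be finite. -/
theorem IsInvApprox.exists_integral_sum_coeffDiv_le (h : IsInvApprox r) (hn : p + 1 ≤ n)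
    (svd : ∀ X : Matrix (Fin n) (Fin p) ℝ, ThinSVD X) (M : Matrix (Fin n) (Fin p) ℝ) :
    ∃ C, ∀ m : ℕ, ∫ X, (∑ k, coeffDiv n (r m) (svd X).lam k) * cutoff ((m : ℝ) + 1) X ^ 2
      ∂(normalMatrixLaw M) ≤ C := by
  set N : ℝ := ∫ X, (∑ a, ∑ i, (X a i - M a i) * (X a i - M a i)) ∂(normalMatrixLaw M) with hN
  -- Large enough that the coefficient p²(n + p)/(2L) of A on the right is at most 1/2; absorbing it
  -- doubles the remaining constant.
  set L : ℝ := (p : ℝ) ^ 2 * (n + p) + 1 with hL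
  have hL0 : 0 < L := by positivity
  refine ⟨2 * (p * (L / 2 * N + 4 * (p * (n + p)))), fun m => ?_⟩
  have hR : (0 : ℝ) < (m : ℝ) + 1 := by positivity
  have hS := integrable_sum_coeffDiv hn (r m) svd M hR
  set A : ℝ := ∫ X, (∑ k, coeffDiv n (r m) (svd X).lam k) * cutoff ((m : ℝ) + 1) X ^ 2
      ∂(normalMatrixLaw M) with hA
  have hinj := ae_lam_injective hn svd M
  have hA0 : 0 ≤ A := integral_nonneg_of_ae (by
    filter_upwards [hinj] with X hi
    exact h.sum_coeffDiv_mul_cutoff_nonneg hn (svd X) hi m)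
  have hterm : ∀ i, ∫ X, (svd X).spec (coeffDiv n (r m) (svd X).lam) i i
      * cutoff ((m : ℝ) + 1) X ^ 2 ∂(normalMatrixLaw M)
      ≤ L / 2 * N + 1 / (2 * L) * (p * (n + p)) * A + 4 * (p * (n + p)) := by
    intro i
    obtain ⟨h1, h2, h3, h4⟩ := integrable_coeffDiv_and_integral_eq hn (r m) svd M hR i i
    have b1 : ∫ X, ((X - M)ᵀ * (X * (svd X).spec (coeffField n (r m) (svd X).lam))) i i
        * cutoff ((m : ℝ) + 1) X ^ 2 ∂(normalMatrixLaw M)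
        ≤ L / 2 * N + 1 / (2 * L) * (p * (n + p)) * A := by
      rw [hN, hA, ← integral_const_mul, ← integral_const_mul,
        ← integral_add ((integrable_sum_sub_sq M).const_mul _) (hS.const_mul _)]
      refine integral_mono_ae h2 (((integrable_sum_sub_sq M).const_mul _).add
        (hS.const_mul _)) ?_
      filter_upwards [hinj] with X hi
      have hN0 : 0 ≤ ∑ a, ∑ i, (X a i - M a i) * (X a i - M a i) :=
        Finset.sum_nonneg fun a _ => Finset.sum_nonneg fun i _ => mul_self_nonneg _
      by_cases hc : cutoff ((m : ℝ) + 1) X = 0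
      · simp only [hc]
        norm_num
        positivity
      have hlam := fun k => ((svd X).lam_lt_of_cutoff_ne_zero hR hc k).le
      have c1 := (le_abs_self _).trans
        ((svd X).abs_inner_le_add M (coeffField n (r m) (svd X).lam) hL0 i i)
      have c2 : ∑ k, (svd X).lam k * coeffField n (r m) (svd X).lam k ^ 2
          ≤ p * ((n + p) * ∑ k, coeffDiv n (r m) (svd X).lam k) := by
        refine (Finset.sum_le_sum fun k _ => (h.lam_mul_coeffField_sq_le hn (svd X).lam_nonneg
          hlam k).trans (mul_le_mul_of_nonneg_left (h.coeff_mul_eval_le_sum_coeffDiv hn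
            (svd X).lam_nonneg hlam (svd X).lam_antitone hi k) (by positivity))).trans ?_
        simp
      have c3 := cutoff_sq_le_one hR X
      have c4 := sq_nonneg (cutoff ((m : ℝ) + 1) X)
      calc _ ≤ (L / 2 * (∑ a, ∑ i, (X a i - M a i) * (X a i - M a i))
            + 1 / (2 * L) * (p * ((n + p) * ∑ k, coeffDiv n (r m) (svd X).lam k)))
              * cutoff ((m : ℝ) + 1) X ^ 2 := by
            refine mul_le_mul_of_nonneg_right (c1.trans ?_) c4
            gcongr
        _ = L / 2 * (∑ a, ∑ i, (X a i - M a i) * (X a i - M a i)) * cutoff ((m : ℝ) + 1) X ^ 2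
            + 1 / (2 * L) * (p * (n + p)) * ((∑ k, coeffDiv n (r m) (svd X).lam k)
              * cutoff ((m : ℝ) + 1) X ^ 2) := by ring
        _ ≤ _ := by
            refine add_le_add (mul_le_of_le_one_right (by positivity) c3) le_rfl
    have b2 : ∫ X, 4 / ((m : ℝ) + 1) * cutoff ((m : ℝ) + 1) X
        * (svd X).spec ((svd X).lam * coeffField n (r m) (svd X).lam) i i ∂(normalMatrixLaw M)
        ≤ 4 * (p * (n + p)) := by
      refine (integral_mono h3 (integrable_const (4 / ((m : ℝ) + 1) * (p * (n + p)))) fun X =>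
        (le_abs_self _).trans (h.abs_boundary_le hn (svd X) m i i)).trans ?_
      simp only [integral_const, probReal_univ, one_smul]
      have : 4 / ((m : ℝ) + 1) ≤ 4 := div_le_self (by norm_num) (by simp)
      gcongr
    linarith
  have hsum : A ≤ p * (L / 2 * N + 1 / (2 * L) * (p * (n + p)) * A + 4 * (p * (n + p))) := by
    have e : A = ∑ i, ∫ X, (svd X).spec (coeffDiv n (r m) (svd X).lam) i i
        * cutoff ((m : ℝ) + 1) X ^ 2 ∂(normalMatrixLaw M) := by
      rw [← integral_finsetSum _ fun i _ =>
        (integrable_coeffDiv_and_integral_eq hn (r m) svd M hR i i).1, hA]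
      congr 1
      ext X
      rw [← Finset.sum_mul, ← (svd X).trace_spec (coeffDiv n (r m) (svd X).lam)]
      rfl
    rw [e]
    refine (Finset.sum_le_sum fun i _ => hterm i).trans ?_
    rw [← e]
    simp [mul_add]
  have hhalf : (p : ℝ) * (1 / (2 * L) * (p * (n + p)) * A) ≤ 1 / 2 * A := by
    have e : (p : ℝ) * (1 / (2 * L) * (p * (n + p)) * A)
        = (p : ℝ) ^ 2 * (n + p) / L * (1 / 2 * A) := by
      field_simp
    rw [e]
    refine mul_le_of_le_one_left (by positivity) ?_
    rw [div_le_one hL0]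
    linarith
  nlinarith

/-- The total divergence of Stein's shrinkage field is integrable. -/
theorem integrable_sum_steinDiv (hn : p + 1 ≤ n)
    (svd : ∀ X : Matrix (Fin n) (Fin p) ℝ, ThinSVD X) (M : Matrix (Fin n) (Fin p) ℝ) :
    Integrable (fun X => ∑ k, steinDiv n (svd X).lam k) (normalMatrixLaw M) := by
  obtain ⟨r, h⟩ := exists_isInvApprox
  obtain ⟨C, hC⟩ := h.exists_integral_sum_coeffDiv_le hn svd M
  refine integrable_of_tendsto_of_integral_le
    (fun m => integrable_sum_coeffDiv hn (r m) svd M (by positivity)) (fun m => ?_) hC ?_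
  · filter_upwards [ae_lam_injective hn svd M] with X hi
    exact h.sum_coeffDiv_mul_cutoff_nonneg hn (svd X) hi m
  · filter_upwards [ae_lam_injective hn svd M, ae_lam_pos hn svd M] with X hi hpos
    have := (tendsto_finsetSum Finset.univ fun k _ => h.tendsto_coeffDiv (n := n) hpos hi k).mul
      ((tendsto_cutoff X).pow 2)
    simpa using this

end InvLimit

/-! ### Second limit: Stein's identity for the shrinkage field -/

theorem integrable_of_tendsto_of_norm_le {Ω : Type*} [MeasurableSpace Ω] {μ : Measure Ω}
    {F : ℕ → Ω → ℝ} {f G : Ω → ℝ} (hF : ∀ m, AEStronglyMeasurable (F m) μ) (hG : Integrable G μ)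
    (hb : ∀ m, ∀ᵐ ω ∂μ, ‖F m ω‖ ≤ G ω)
    (hlim : ∀ᵐ ω ∂μ, Filter.Tendsto (fun m => F m ω) Filter.atTop (nhds (f ω))) :
    Integrable f μ := by
  refine hG.mono' (aestronglyMeasurable_of_tendsto_ae _ hF hlim) ?_
  filter_upwards [hlim, ae_all_iff.2 hb] with ω h1 h2
  exact le_of_tendsto' h1.norm h2

/-- The spectrum `c_k / λ_k` of Stein's shrinkage field. -/
noncomputable def steinField (n : ℕ) {p : ℕ} (lam : Fin p → ℝ) (k : Fin p) : ℝ :=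
  steinCoeff n p k * (1 / lam k)

section SteinField

variable {n p : ℕ}

theorem aestronglyMeasurable_steinField (hn : p + 1 ≤ n)
    (svd : ∀ X : Matrix (Fin n) (Fin p) ℝ, ThinSVD X) (M : Matrix (Fin n) (Fin p) ℝ)
    (a : Fin n) (j : Fin p) :
    AEStronglyMeasurable (fun X => (X * (svd X).spec (steinField n (svd X).lam)) a j)
      (normalMatrixLaw M) := by
  obtain ⟨r, h⟩ := exists_isInvApprox
  refine aestronglyMeasurable_of_tendsto_ae Filter.atTop (fun m : ℕ =>
    aestronglyMeasurable_coeffField hn (r m) svd M (R := (m : ℝ) + 1) (by positivity) a j) ?_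
  filter_upwards [ae_lam_pos hn svd M] with X hpos
  have h1 : Filter.Tendsto (fun m => (X * (svd X).spec (coeffField n (r m) (svd X).lam)) a j)
      Filter.atTop (nhds ((X * (svd X).spec (steinField n (svd X).lam)) a j)) := by
    simp only [Matrix.mul_apply]
    exact tendsto_finsetSum _ fun l _ => ((svd X).tendsto_spec_apply
      (fun k => (h.tendsto_inv _ (hpos k)).const_mul _) l j).const_mul _
  simpa using h1.mul (tendsto_cutoff X)

/-- Stein's identity for the shrinkage field. -/
theorem integrable_steinDiv_and_integral_eq (hn : p + 1 ≤ n)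
    (svd : ∀ X : Matrix (Fin n) (Fin p) ℝ, ThinSVD X) (M : Matrix (Fin n) (Fin p) ℝ)
    (i j : Fin p) :
    Integrable (fun X => (svd X).spec (steinDiv n (svd X).lam) i j) (normalMatrixLaw M) ∧
      Integrable (fun X => ((X - M)ᵀ * (X * (svd X).spec (steinField n (svd X).lam))) i j)
        (normalMatrixLaw M) ∧
      ∫ X, ((X - M)ᵀ * (X * (svd X).spec (steinField n (svd X).lam))) i j ∂(normalMatrixLaw M)
        = ∫ X, (svd X).spec (steinDiv n (svd X).lam) i j ∂(normalMatrixLaw M) := by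
  obtain ⟨r, h⟩ := exists_isInvApprox
  have hR : ∀ m : ℕ, (0 : ℝ) < (m : ℝ) + 1 := fun m => by positivity
  have hst := fun m => integrable_coeffDiv_and_integral_eq hn (r m) svd M (hR m) i j
  have hinj := ae_lam_injective hn svd M
  have hps := ae_lam_pos hn svd M
  have hH := integrable_sum_steinDiv hn svd M
  have hτ := fun X : Matrix (Fin n) (Fin p) ℝ => (tendsto_cutoff X).pow 2
  simp only [one_pow] at hτ
  have hG1 := hH.const_mul ((p : ℝ) * (n + 2 + p * (n + p) + p))
  have hG2 := ((integrable_sum_sub_sq M).const_mul (1 / 2)).add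
    (hH.const_mul (1 / (2 * 1) * (p * ((n : ℝ) + p))))
  have hb1 : ∀ m : ℕ, ∀ᵐ X ∂(normalMatrixLaw M),
      ‖(svd X).spec (coeffDiv n (r m) (svd X).lam) i j * cutoff ((m : ℝ) + 1) X ^ 2‖
        ≤ (p : ℝ) * (n + 2 + p * (n + p) + p) * ∑ k, steinDiv n (svd X).lam k := by
    intro m
    filter_upwards [hinj, hps] with X hi hpos
    have hH0 : 0 ≤ ∑ k, steinDiv n (svd X).lam k := Finset.sum_nonneg fun k _ =>
      steinDiv_nonneg hn hpos (svd X).lam_antitone hi k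
    by_cases hc : cutoff ((m : ℝ) + 1) X = 0
    · simp only [hc]
      norm_num
      positivity
    have hlam := fun k => ((svd X).lam_lt_of_cutoff_ne_zero (hR m) hc k).le
    rw [norm_mul, Real.norm_of_nonneg (sq_nonneg _)]
    refine (mul_le_of_le_one_right (norm_nonneg _) (cutoff_sq_le_one (hR m) X)).trans ?_
    refine ((svd X).abs_spec_apply_le _ i j).trans ((Finset.sum_le_sum fun k _ => ?_).trans
      (b := ∑ k : Fin p, (n + 2 + p * (n + p) + p) * ∑ k, steinDiv n (svd X).lam k) ?_)
    · rw [abs_of_nonneg (h.coeffDiv_nonneg hn (svd X).lam_nonneg hlam (svd X).lam_antitone hi k)]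
      exact h.coeffDiv_le hn hpos hlam (svd X).lam_antitone hi k
    · rw [Finset.sum_const, Finset.card_univ, Fintype.card_fin, nsmul_eq_mul, mul_assoc]
  have hb2 : ∀ m : ℕ, ∀ᵐ X ∂(normalMatrixLaw M),
      ‖((X - M)ᵀ * (X * (svd X).spec (coeffField n (r m) (svd X).lam))) i j
        * cutoff ((m : ℝ) + 1) X ^ 2‖
        ≤ 1 / 2 * ∑ a, ∑ i, (X a i - M a i) * (X a i - M a i)
          + 1 / (2 * 1) * (p * ((n : ℝ) + p)) * ∑ k, steinDiv n (svd X).lam k := by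
    intro m
    filter_upwards [hinj, hps] with X hi hpos
    have hH0 : 0 ≤ ∑ k, steinDiv n (svd X).lam k := Finset.sum_nonneg fun k _ =>
      steinDiv_nonneg hn hpos (svd X).lam_antitone hi k
    have hN0 : 0 ≤ ∑ a, ∑ i, (X a i - M a i) * (X a i - M a i) :=
      Finset.sum_nonneg fun a _ => Finset.sum_nonneg fun i _ => mul_self_nonneg _
    by_cases hc : cutoff ((m : ℝ) + 1) X = 0
    · simp only [hc]
      norm_num
      positivity
    have hlam := fun k => ((svd X).lam_lt_of_cutoff_ne_zero (hR m) hc k).le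
    rw [norm_mul, Real.norm_of_nonneg (sq_nonneg (cutoff _ X))]
    refine (mul_le_of_le_one_right (norm_nonneg _) (cutoff_sq_le_one (hR m) X)).trans ?_
    refine ((svd X).abs_inner_le_add M _ one_pos i j).trans ?_
    rw [mul_assoc (1 / (2 * 1) : ℝ)]
    have c2 : ∑ k, (svd X).lam k * coeffField n (r m) (svd X).lam k ^ 2
        ≤ p * ((n : ℝ) + p) * ∑ k, steinDiv n (svd X).lam k := by
      refine (Finset.sum_le_sum fun k _ => (h.lam_mul_coeffField_sq_le hn (svd X).lam_nonneg
        hlam k).trans (mul_le_mul_of_nonneg_left ((mul_le_mul_of_nonneg_left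
          (h.eval_le (hpos k) (hlam k)) (steinCoeff_nonneg hn k)).trans
          (steinCoeff_div_le_sum_steinDiv hn hpos (svd X).lam_antitone hi k))
          (by positivity))).trans ?_
      rw [Finset.sum_const, Finset.card_univ, Fintype.card_fin, nsmul_eq_mul, mul_assoc]
    gcongr
  have hl1 : ∀ᵐ X ∂(normalMatrixLaw M), Filter.Tendsto (fun m : ℕ =>
      (svd X).spec (coeffDiv n (r m) (svd X).lam) i j * cutoff ((m : ℝ) + 1) X ^ 2) Filter.atTop
      (nhds ((svd X).spec (steinDiv n (svd X).lam) i j)) := by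
    filter_upwards [hinj, hps] with X hi hpos
    have := ((svd X).tendsto_spec_apply
      (fun k => h.tendsto_coeffDiv (n := n) hpos hi k) i j).mul (hτ X)
    rwa [mul_one] at this
  have hl2 : ∀ᵐ X ∂(normalMatrixLaw M), Filter.Tendsto (fun m : ℕ =>
      ((X - M)ᵀ * (X * (svd X).spec (coeffField n (r m) (svd X).lam))) i j
        * cutoff ((m : ℝ) + 1) X ^ 2) Filter.atTop
      (nhds (((X - M)ᵀ * (X * (svd X).spec (steinField n (svd X).lam))) i j)) := by
    filter_upwards [hps] with X hpos
    have h1 : ∀ k, Filter.Tendsto (fun m => coeffField n (r m) (svd X).lam k) Filter.atTop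
        (nhds (steinField n (svd X).lam k)) := fun k =>
      (h.tendsto_inv _ (hpos k)).const_mul (steinCoeff n p k)
    have := ((svd X).tendsto_inner M h1 i j).mul (hτ X)
    rwa [mul_one] at this
  have hm1 : ∀ m : ℕ, AEStronglyMeasurable (fun X =>
      (svd X).spec (coeffDiv n (r m) (svd X).lam) i j * cutoff ((m : ℝ) + 1) X ^ 2)
      (normalMatrixLaw M) := fun m => (hst m).1.aestronglyMeasurable
  have hm2 : ∀ m : ℕ, AEStronglyMeasurable (fun X =>
      ((X - M)ᵀ * (X * (svd X).spec (coeffField n (r m) (svd X).lam))) i j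
        * cutoff ((m : ℝ) + 1) X ^ 2) (normalMatrixLaw M) := fun m =>
    (hst m).2.1.aestronglyMeasurable
  have T1 := tendsto_integral_of_dominated_convergence _ hm1 hG1 hb1 hl1
  have T2 := tendsto_integral_of_dominated_convergence _ hm2 hG2 hb2 hl2
  -- The boundary integral is at most 4p(n + p)/(m + 1).
  have T3 : Filter.Tendsto (fun m : ℕ => ∫ X, 4 / ((m : ℝ) + 1) * cutoff ((m : ℝ) + 1) X
      * (svd X).spec ((svd X).lam * coeffField n (r m) (svd X).lam) i j ∂(normalMatrixLaw M))
      Filter.atTop (nhds 0) := by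
    have h0 : Filter.Tendsto (fun m : ℕ => 4 / ((m : ℝ) + 1) * (p * ((n : ℝ) + p))) Filter.atTop
        (nhds 0) := by
      have := ((tendsto_const_nhds (x := (4 : ℝ))).div_atTop
        (Filter.tendsto_atTop_add_const_right _ (1 : ℝ)
          (tendsto_natCast_atTop_atTop (R := ℝ)))).mul_const (p * ((n : ℝ) + p))
      rwa [zero_mul] at this
    refine squeeze_zero_norm (fun m => ?_) h0
    refine (norm_integral_le_of_norm_le (integrable_const (4 / ((m : ℝ) + 1) * (p * ((n : ℝ) + p))))
      (Filter.Eventually.of_forall fun X => h.abs_boundary_le hn (svd X) m i j)).trans ?_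
    simp only [integral_const, probReal_univ, one_smul, le_refl]
  have T4 := T1.sub T3
  rw [sub_zero] at T4
  refine ⟨integrable_of_tendsto_of_norm_le hm1 hG1 hb1 hl1,
    integrable_of_tendsto_of_norm_le hm2 hG2 hb2 hl2, tendsto_nhds_unique T2 (T4.congr fun m => ?_)⟩
  exact (hst m).2.2.2.symm

end SteinField

/-! ### Matrix expectations, the risk formula and domination -/

section Expectation

variable {Ω : Type*} [MeasurableSpace Ω] {μ : Measure Ω} {p : ℕ}

theorem matrixExpectation_posSemidef {F : Ω → Matrix (Fin p) (Fin p) ℝ}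
    (hF : MatrixIntegrable F μ) (h : ∀ᵐ ω ∂μ, (F ω).PosSemidef) :
    (matrixExpectation F μ).PosSemidef := by
  refine .of_dotProduct_mulVec_nonneg ?_ fun x => ?_
  · ext i j
    simp only [matrixExpectation, Matrix.conjTranspose_apply, Matrix.of_apply, star_trivial]
    refine integral_congr_ae ?_
    filter_upwards [h] with ω hω
    simpa using hω.isHermitian.apply i j
  · have hint : ∀ i j, Integrable (fun ω => x i * (F ω i j * x j)) μ := fun i j =>
      ((hF i j).mul_const _).const_mul _
    have e : star x ⬝ᵥ (matrixExpectation F μ *ᵥ x)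
        = ∫ ω, star x ⬝ᵥ (F ω *ᵥ x) ∂μ := by
      simp only [dotProduct, Matrix.mulVec, matrixExpectation, Matrix.of_apply, Pi.star_apply,
        star_trivial, Finset.mul_sum]
      rw [integral_finsetSum _ fun i _ => integrable_finsetSum _ fun j _ => hint i j]
      refine Finset.sum_congr rfl fun i _ => ?_
      rw [integral_finsetSum _ fun j _ => hint i j]
      refine Finset.sum_congr rfl fun j _ => ?_
      rw [integral_const_mul, integral_mul_const]
    rw [e]
    refine integral_nonneg_of_ae ?_
    filter_upwards [h] with ω hω
    exact hω.dotProduct_mulVec_nonneg x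

theorem integral_sub_sub_add {f g h k : Ω → ℝ} (hf : Integrable f μ) (hg : Integrable g μ)
    (hh : Integrable h μ) (hk : Integrable k μ) :
    ∫ ω, (f ω - g ω - h ω + k ω) ∂μ
      = ∫ ω, f ω ∂μ - ∫ ω, g ω ∂μ - ∫ ω, h ω ∂μ + ∫ ω, k ω ∂μ := by
  have h1 : Integrable (fun ω => f ω - g ω) μ := hf.sub hg
  have h2 : Integrable (fun ω => f ω - g ω - h ω) μ := h1.sub hh
  rw [integral_add h2 hk, integral_sub h1 hh, integral_sub hf hg]

end Expectation

section Risk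

variable {n p : ℕ}

theorem steinVDVt_eq_spec {X : Matrix (Fin n) (Fin p) ℝ} (T : ThinSVD X) :
    steinVDVt T = T.spec (steinD n p T.lam) := rfl

/-- Valid for every X: where σ_k = 0, both c_k/σ_k and c_k/σ_k² are 0 by the convention for
division. -/
theorem steinEstimator_eq (svd : ∀ X : Matrix (Fin n) (Fin p) ℝ, ThinSVD X)
    (X : Matrix (Fin n) (Fin p) ℝ) :
    steinEstimator svd X = X - X * (svd X).spec (steinField n (svd X).lam) := by
  set T := svd X with hT
  have h1 : X = T.U * Matrix.diagonal T.σ * T.Vᵀ := T.eq_mul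
  have h2 : X * T.spec (steinField n T.lam)
      = T.U * Matrix.diagonal (fun k => steinCoeff n p k / T.σ k) * T.Vᵀ := by
    rw [ThinSVD.spec, ← Matrix.mul_assoc, ← Matrix.mul_assoc, T.mul_V, Matrix.mul_assoc T.U,
      Matrix.diagonal_mul_diagonal]
    congr 3
    ext k
    rcases eq_or_ne (T.σ k) 0 with h | h
    · simp [h]
    · simp only [steinField, ThinSVD.lam]
      field_simp
  have h3 : Matrix.diagonal (fun k => T.σ k - steinCoeff n p k / T.σ k)
      = Matrix.diagonal T.σ - Matrix.diagonal (fun k => steinCoeff n p k / T.σ k) := by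
    rw [Matrix.diagonal_sub]
  rw [h2, steinEstimator, shrinkageEstimator, ← hT, h3, Matrix.mul_sub, Matrix.sub_mul, ← h1]

/-- The factor n - 3p + 2k - 1 of D arises as 2(n - p - 1) - c_k, with k counted from 1; the slopes
of c produce the sum over l because c_l - c_k = 2(k - l). -/
theorem steinD_eq (lam : Fin p → ℝ) (k : Fin p) :
    steinD n p lam k = lam k * steinField n lam k ^ 2 - 2 * steinDiv n lam k := by
  have hs : ∑ l ∈ Finset.univ.erase k, (steinCoeff n p l - steinCoeff n p k) / (lam l - lam k)
      = -2 * ∑ l ∈ Finset.univ.erase k,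
        (((k.val : ℝ) + 1) - ((l.val : ℝ) + 1)) / (lam k - lam l) := by
    rw [Finset.mul_sum]
    refine Finset.sum_congr rfl fun l _ => ?_
    rw [← neg_sub (lam k), div_neg, steinCoeff, steinCoeff]
    ring
  have hl : lam k * (1 / lam k) ^ 2 = 1 / lam k := by
    rcases eq_or_ne (lam k) 0 with h | h
    · simp [h]
    · field_simp
  have hf : lam k * steinField n lam k ^ 2 = steinCoeff n p k ^ 2 * (1 / lam k) := by
    rw [← hl, steinField]
    ring
  rw [hf, steinDiv, hs, steinD, steinCoeff]
  ring

theorem matrixQuadraticLoss_steinEstimator (svd : ∀ X : Matrix (Fin n) (Fin p) ℝ, ThinSVD X)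
    (M X : Matrix (Fin n) (Fin p) ℝ) (i j : Fin p) :
    matrixQuadraticLoss M (steinEstimator svd X) i j
      = matrixQuadraticLoss M X i j
        - ((X - M)ᵀ * (X * (svd X).spec (steinField n (svd X).lam))) i j
        - ((X - M)ᵀ * (X * (svd X).spec (steinField n (svd X).lam))) j i
        + (svd X).spec (fun k => (svd X).lam k * steinField n (svd X).lam k ^ 2) i j := by
  have e : ∀ A B : Matrix (Fin n) (Fin p) ℝ,
      (A - B)ᵀ * (A - B) = Aᵀ * A - Aᵀ * B - (Aᵀ * B)ᵀ + Bᵀ * B := by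
    intro A B
    rw [Matrix.transpose_sub, Matrix.sub_mul, Matrix.mul_sub, Matrix.mul_sub,
      Matrix.transpose_mul, Matrix.transpose_transpose]
    abel
  rw [matrixQuadraticLoss, matrixQuadraticLoss, steinEstimator_eq, sub_right_comm, e,
    (svd X).transpose_mul_self_spec]
  rfl

theorem matrixQuadraticLoss_apply (M X : Matrix (Fin n) (Fin p) ℝ) (i j : Fin p) :
    matrixQuadraticLoss M X i j = ∑ a, (X a i - M a i) * (X a j - M a j) := rfl

theorem hasMatrixQuadraticRisk_mle (M : Matrix (Fin n) (Fin p) ℝ) :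
    HasMatrixQuadraticRisk M mle := by
  intro i j
  simp only [mle, matrixQuadraticLoss_apply]
  exact integrable_finsetSum _ fun a _ => integrable_sub_mul_sub_normalMatrixLaw M a a i j

theorem matrixQuadraticRisk_mle (M : Matrix (Fin n) (Fin p) ℝ) :
    matrixQuadraticRisk M mle = (n : ℝ) • (1 : Matrix (Fin p) (Fin p) ℝ) := by
  ext i j
  simp only [matrixQuadraticRisk, matrixExpectation, Matrix.of_apply, mle,
    matrixQuadraticLoss_apply]
  rw [integral_finsetSum _ fun a _ => integrable_sub_mul_sub_normalMatrixLaw M a a i j]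
  simp only [integral_sub_mul_sub_normalMatrixLaw]
  simp [Matrix.one_apply]

theorem integrable_spec_lam_mul_steinField_sq (hn : p + 1 ≤ n)
    (svd : ∀ X : Matrix (Fin n) (Fin p) ℝ, ThinSVD X) (M : Matrix (Fin n) (Fin p) ℝ)
    (i j : Fin p) :
    Integrable (fun X => (svd X).spec
      (fun k => (svd X).lam k * steinField n (svd X).lam k ^ 2) i j) (normalMatrixLaw M) := by
  refine ((integrable_sum_steinDiv hn svd M).const_mul (p * ((n : ℝ) + p))).mono' ?_ ?_
  · have : ∀ X, (svd X).spec (fun k => (svd X).lam k * steinField n (svd X).lam k ^ 2) i j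
        = ∑ a, (X * (svd X).spec (steinField n (svd X).lam)) a i
          * (X * (svd X).spec (steinField n (svd X).lam)) a j := fun X => by
      rw [← (svd X).transpose_mul_self_spec]
      rfl
    simp only [this]
    exact Finset.aestronglyMeasurable_fun_sum _ fun a _ =>
      (aestronglyMeasurable_steinField hn svd M a i).mul
        (aestronglyMeasurable_steinField hn svd M a j)
  · filter_upwards [ae_lam_injective hn svd M, ae_lam_pos hn svd M] with X hi hpos
    refine ((svd X).abs_spec_apply_le _ i j).trans ((Finset.sum_le_sum fun k _ => ?_).trans
      (b := ∑ k : Fin p, ((n : ℝ) + p) * ∑ k, steinDiv n (svd X).lam k) ?_)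
    · have h1 := steinCoeff_div_le_sum_steinDiv hn hpos (svd X).lam_antitone hi k
      have h2 := steinCoeff_nonneg hn k
      have h3 := hpos k
      have e : (svd X).lam k * steinField n (svd X).lam k ^ 2
          = steinCoeff n p k * (steinCoeff n p k * (1 / (svd X).lam k)) := by
        rw [steinField]
        field_simp
      rw [e, abs_of_nonneg (by positivity)]
      exact mul_le_mul (steinCoeff_le k) h1 (by positivity) (by positivity)
    · rw [Finset.sum_const, Finset.card_univ, Fintype.card_fin, nsmul_eq_mul, mul_assoc]

theorem steinVDVt_apply {X : Matrix (Fin n) (Fin p) ℝ} (T : ThinSVD X) (i j : Fin p) :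
    steinVDVt T i j = T.spec (fun k => T.lam k * steinField n T.lam k ^ 2) i j
      - 2 * T.spec (steinDiv n T.lam) i j := by
  rw [steinVDVt_eq_spec, T.mul_spec_apply, ← Matrix.sub_apply, ← T.spec_sub]
  congr 2
  ext k
  exact steinD_eq T.lam k

theorem matrixIntegrable_steinVDVt (hn : p + 1 ≤ n)
    (svd : ∀ X : Matrix (Fin n) (Fin p) ℝ, ThinSVD X) (M : Matrix (Fin n) (Fin p) ℝ) :
    MatrixIntegrable (fun X => steinVDVt (svd X)) (normalMatrixLaw M) := by
  intro i j
  simp only [steinVDVt_apply]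
  exact (integrable_spec_lam_mul_steinField_sq hn svd M i j).sub
    ((integrable_steinDiv_and_integral_eq hn svd M i j).1.const_mul 2)

theorem hasMatrixQuadraticRisk_steinEstimator (hn : p + 1 ≤ n)
    (svd : ∀ X : Matrix (Fin n) (Fin p) ℝ, ThinSVD X) (M : Matrix (Fin n) (Fin p) ℝ) :
    HasMatrixQuadraticRisk M (steinEstimator svd) := by
  intro i j
  simp only [matrixQuadraticLoss_steinEstimator]
  exact (((hasMatrixQuadraticRisk_mle M i j).sub
    (integrable_steinDiv_and_integral_eq hn svd M i j).2.1).sub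
    (integrable_steinDiv_and_integral_eq hn svd M j i).2.1).add
    (integrable_spec_lam_mul_steinField_sq hn svd M i j)

/-- The two cross terms are entries (i, j) and (j, i) of the same matrix. Their expectations
coincide because the divergence is symmetric, which gives the factor 2. -/
theorem matrixQuadraticRisk_steinEstimator (hn : p + 1 ≤ n)
    (svd : ∀ X : Matrix (Fin n) (Fin p) ℝ, ThinSVD X) (M : Matrix (Fin n) (Fin p) ℝ) :
    matrixQuadraticRisk M (steinEstimator svd)
      = (n : ℝ) • (1 : Matrix (Fin p) (Fin p) ℝ)
        + matrixExpectation (fun X => steinVDVt (svd X)) (normalMatrixLaw M) := by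
  rw [← matrixQuadraticRisk_mle M]
  ext i j
  obtain ⟨a1, a2, a3⟩ := integrable_steinDiv_and_integral_eq hn svd M i j
  obtain ⟨-, b2, b3⟩ := integrable_steinDiv_and_integral_eq hn svd M j i
  have c := integrable_spec_lam_mul_steinField_sq hn svd M i j
  have d : Integrable (fun X => matrixQuadraticLoss M X i j) (normalMatrixLaw M) :=
    hasMatrixQuadraticRisk_mle M i j
  have hsymm : ∀ X, (svd X).spec (steinDiv n (svd X).lam) j i
      = (svd X).spec (steinDiv n (svd X).lam) i j := fun X =>
    congrFun (congrFun ((svd X).spec_transpose (steinDiv n (svd X).lam)) i) j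
  simp only [hsymm] at b3
  simp only [matrixQuadraticRisk, matrixExpectation, Matrix.of_apply, Matrix.add_apply, mle,
    matrixQuadraticLoss_steinEstimator, steinVDVt_apply]
  rw [integral_sub_sub_add d a2 b2 c, integral_sub c (a1.const_mul 2), integral_const_mul, a3, b3]
  ring

/-- The condition on n is the case k = 1 of n - 3p + 2k - 1 ≥ 0. Quotients with zero denominator are
0, so the sign holds for every decomposition, with no exceptional set. -/
theorem steinD_nonpos (hn : p + 1 ≤ n) (h : 3 * (p : ℤ) - 1 ≤ (n : ℤ)) {lam : Fin p → ℝ}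
    (h0 : ∀ k, 0 ≤ lam k) (ha : Antitone lam) (k : Fin p) : steinD n p lam k ≤ 0 := by
  have h1 : 0 ≤ (n : ℝ) + p - 2 * ((k.val : ℝ) + 1) - 1 := steinCoeff_nonneg hn k
  have h2 : 0 ≤ (n : ℝ) - 3 * p + 2 * ((k.val : ℝ) + 1) - 1 := by
    have : 3 * (p : ℝ) - 1 ≤ n := by exact_mod_cast h
    have : (0 : ℝ) ≤ k.val := by positivity
    linarith
  have h3 : ∑ l ∈ Finset.univ.erase k,
      (((k.val : ℝ) + 1) - ((l.val : ℝ) + 1)) / (lam k - lam l) ≤ 0 := by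
    refine Finset.sum_nonpos fun l _ => ?_
    rcases le_total k l with hkl | hkl
    · have : (k.val : ℝ) ≤ l.val := by exact_mod_cast hkl
      exact div_nonpos_of_nonpos_of_nonneg (by linarith) (sub_nonneg.2 (ha hkl))
    · have : (l.val : ℝ) ≤ k.val := by exact_mod_cast hkl
      exact div_nonpos_of_nonneg_of_nonpos (by linarith) (sub_nonpos.2 (ha hkl))
  have h4 : 0 ≤ 1 / lam k * ((n : ℝ) + p - 2 * ((k.val : ℝ) + 1) - 1)
      * ((n : ℝ) - 3 * p + 2 * ((k.val : ℝ) + 1) - 1) :=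
    mul_nonneg (mul_nonneg (one_div_nonneg.2 (h0 k)) h1) h2
  unfold steinD
  linarith

theorem neg_steinVDVt_posSemidef (hn : p + 1 ≤ n) (h : 3 * (p : ℤ) - 1 ≤ (n : ℤ))
    {X : Matrix (Fin n) (Fin p) ℝ} (T : ThinSVD X) : (-steinVDVt T).PosSemidef := by
  have hD : (Matrix.diagonal fun k => -steinD n p T.lam k).PosSemidef :=
    Matrix.posSemidef_diagonal_iff.2 fun k =>
      neg_nonneg.2 (steinD_nonpos hn h T.lam_nonneg T.lam_antitone k)
  have e : -steinVDVt T = T.V * (Matrix.diagonal fun k => -steinD n p T.lam k) * T.Vᴴ := by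
    rw [← Matrix.diagonal_neg, Matrix.mul_neg, Matrix.neg_mul, steinVDVt_eq_spec,
      Matrix.conjTranspose_eq_transpose_of_trivial]
    rfl
  rw [e]
  exact hD.mul_mul_conjTranspose_same T.V

theorem sub_matrixQuadraticRisk_steinEstimator_posSemidef (hn : p + 1 ≤ n)
    (h : 3 * (p : ℤ) - 1 ≤ (n : ℤ)) (svd : ∀ X : Matrix (Fin n) (Fin p) ℝ, ThinSVD X)
    (M : Matrix (Fin n) (Fin p) ℝ) :
    ((n : ℝ) • (1 : Matrix (Fin p) (Fin p) ℝ)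
      - matrixQuadraticRisk M (steinEstimator svd)).PosSemidef := by
  have e : (n : ℝ) • (1 : Matrix (Fin p) (Fin p) ℝ) - matrixQuadraticRisk M (steinEstimator svd)
      = matrixExpectation (fun X => -steinVDVt (svd X)) (normalMatrixLaw M) := by
    rw [matrixQuadraticRisk_steinEstimator hn, sub_add_cancel_left]
    ext i j
    simp [matrixExpectation, integral_neg]
  rw [e]
  exact matrixExpectation_posSemidef (fun i j => (matrixIntegrable_steinVDVt hn svd M i j).neg)
    (Filter.Eventually.of_forall fun X => neg_steinVDVt_posSemidef hn h (svd X))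

end Risk

theorem proposition1 (n p : ℕ) (hn : p + 1 ≤ n)
    (svd : ∀ X : Matrix (Fin n) (Fin p) ℝ, ThinSVD X) :
    (∀ M : Matrix (Fin n) (Fin p) ℝ,
      HasMatrixQuadraticRisk M (steinEstimator svd) ∧
      MatrixIntegrable (fun X => steinVDVt (svd X)) (normalMatrixLaw M) ∧
      matrixQuadraticRisk M (steinEstimator svd)
        = (n : ℝ) • (1 : Matrix (Fin p) (Fin p) ℝ)
          + matrixExpectation (fun X => steinVDVt (svd X)) (normalMatrixLaw M)) ∧
    (3 * (p : ℤ) - 1 ≤ (n : ℤ) →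
      Dominates (steinEstimator svd) mle ∧
      ∀ M : Matrix (Fin n) (Fin p) ℝ,
        ((n : ℝ) • (1 : Matrix (Fin p) (Fin p) ℝ)
          - matrixQuadraticRisk M (steinEstimator svd)).PosSemidef) := by
  refine ⟨fun M => ⟨hasMatrixQuadraticRisk_steinEstimator hn svd M,
    matrixIntegrable_steinVDVt hn svd M, matrixQuadraticRisk_steinEstimator hn svd M⟩,
    fun h => ⟨fun M => ⟨hasMatrixQuadraticRisk_steinEstimator hn svd M,
      hasMatrixQuadraticRisk_mle M, ?_⟩, fun M =>
      sub_matrixQuadraticRisk_steinEstimator_posSemidef hn h svd M⟩⟩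
  rw [matrixQuadraticRisk_mle]
  exact sub_matrixQuadraticRisk_steinEstimator_posSemidef hn h svd M
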